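/- Let $\mathbf{Z}_2$ be the cyclic group of order $2$ and let $\mathbf{D}_k$ be the dihedral group of order $2k$. The exponent $\exp(\mathcal G)$ of a finite $2$-group $\mathcal{G}$ is the maximum of the orders of its elements. Let $S=\{s_0,\dots,s_{n-1}\}$, $n\ge 1$, be a set of distinct involutions generating a group $\mathcal G$. The pair $(\mathcal G,S)$ is a *string C-group* if $s_js_k$ has order $2$ whenever $|j-k|\ge 2$ and $\langle s_j\mid j\in J\rangle\cap\langle s_k\mid k\in K\rangle=\langle s_i\mid i\in J\cap K\rangle$ for all $J,K\subseteq\{0,\dots,n-1\}$. It is *connected* if, in addition, $s_js_{j+1}$ has order greater than $2$ for $0\le j\le n-2$, and *disconnected* otherwise. The pair is a *smooth quotient* of a Coxeter group $W$ with distinguished generators $w_0,\dots,w_{n-1}$ if $w_i\mapsto s_i$ extends to a surjective homomorphism $W\to\mathcal G$ and $s_js_k$ has the same order as $w_jw_k$ for all $j,k$. For $m\ge 5$ and $e\in\{0,1\}$ put \[ P_e(m)=\Big\langle s_0,s_1,s_2\ \Big|\ s_0^2=s_1^2=s_2^2=(s_0s_1)^4=(s_0s_2)^2=(s_1s_2)^{2^{m-3}}=1,\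 (s_0s_1s_2s_1)^2(s_2s_1)^{2^{m-4}e}=1\Big\rangle . \] **Theorem.** Let $(\mathcal G,S)$ be a string C-group of order $2^m$. 1. If $\exp(\mathcal G)=2^m$, then $m=1$ and $\mathcal G\simeq\mathbf Z_2$. 2. If $\exp(\mathcal G)=2^{m-1}$ with $m\ge 2$, then $\mathcal G\simeq\mathbf D_{2^{m-1}}$. 3. If $\exp(\mathcal G)=2^{m-2}$ with $m\ge 3$, then $(\mathcal G,S)$ is disconnected and $\mathcal G\simeq\mathbf D_{2^{m-2}}\times\mathbf Z_2$. 4. If $\exp(\mathcal G)=2^{m-3}$ with $m\ge 4$ and $(\mathcal G,S)$ is disconnected, then $\mathcal G\simeq\mathbf D_{2^{m-3}}\times\mathbf Z_2\times\mathbf Z_2$. 5. If $\exp(\mathcal G)=2^{m-3}$ and $(\mathcal G,S)$ is connected, then $m\ge 5$, $n=3$, and there is an $e\in\{0,1\}$, with $e=0$ if $m=5$, such that, possibly after reversing the order of the distinguished generators $s_0,s_1,s_2$ of $\mathcal G$, there is an isomorphism $P_e(m)\simeq\mathcal G$ taking the generators $s_0,s_1,s_2$ of $P_e(m)$ to those of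 $\mathcal G$, and $\mathcal G$, with these generators, is a smooth quotient of the infinite string Coxeter group $W=[4,2^{m-3}]$ (that is, $w_0w_1$, $w_1w_2$, $w_0w_2$ have orders $4$, $2^{m-3}$, $2$). Furthermore, if $e=0$, then $\mathcal G\simeq(\mathbf D_{2^{m-4}}\times\mathbf D_2)\rtimes\mathbf Z_2$, and if $e=1$, then $\mathcal G\simeq(\mathbf D_{2^{m-4}}\rtimes\mathbf D_2)\rtimes\mathbf Z_2$, for suitable actions defining the semidirect products. Conversely, if $m=5$ and $e=0$, or $m\ge 6$ and $e\in\{0,1\}$, then $P_e(m)$ with the generators $s_0,s_1,s_2$ is a connected string C-group of order $2^m$ and exponent $2^{m-3}$. -/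

import Mathlib

universe u

namespace StringC

/-- The pair `(G, {s 0, …, s (n - 1)})` is a string C-group. -/
structure IsStringCGroup {G : Type u} [Group G] {n : ℕ} (s : Fin n → G) : Prop where
  /-- there is at least one distinguished generator -/
  pos : 0 < n
  /-- the distinguished generators are distinct -/
  injective : Function.Injective s
  /-- the distinguished generators are involutions -/
  involution : ∀ i, orderOf (s i) = 2
  /-- the distinguished generators generate the group -/
  generate : Subgroup.closure (Set.range s) = ⊤
  /-- the string condition -/
  string : ∀ j k : Fin n, (j : ℕ) + 2 ≤ (k : ℕ) → orderOf (s j * s k) = 2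
  /-- the intersection condition -/
  intersection : ∀ J K : Set (Fin n),
    Subgroup.closure (s '' J) ⊓ Subgroup.closure (s '' K) = Subgroup.closure (s '' (J ∩ K))

/-- The pair `(G, {s 0, …, s (n - 1)})` is a connected string C-group: consecutive generators have
a product of order at least three (`orderOf` is zero for elements of infinite order). -/
structure IsConnectedStringCGroup {G : Type u} [Group G] {n : ℕ} (s : Fin n → G) : Prop
    extends IsStringCGroup s where
  connected : ∀ j k : Fin n, (j : ℕ) + 1 = (k : ℕ) →
    orderOf (s j * s k) = 0 ∨ 2 < orderOf (s j * s k)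

/-- The Coxeter matrix of the string Coxeter group `[p, q]` of rank three. -/
def stringCoxeterMatrix (p q : ℕ) (hp : p ≠ 1) (hq : q ≠ 1) : CoxeterMatrix (Fin 3) where
  M := !![1, p, 2; p, 1, q; 2, q, 1]
  isSymm := by ext i j; fin_cases i <;> fin_cases j <;> rfl
  diagonal := by intro i; fin_cases i <;> rfl
  off_diagonal := by
    intro i j hij
    fin_cases i <;> fin_cases j <;> simp_all

/-- The group `G` with the generators `t` is a smooth quotient of the Coxeter group of `M`: sending
the simple reflections to the elements `t i` defines a surjective homomorphism, and the orders of
the products of two generators are exactly the entries of `M`. -/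
def IsSmoothQuotient {B : Type} (M : CoxeterMatrix B) {G : Type u} [Group G] (t : B → G) : Prop :=
  (∀ i j, orderOf (t i * t j) = M i j) ∧
    ∃ φ : M.Group →* G, Function.Surjective φ ∧ ∀ i, φ (M.simple i) = t i

/-- The relators of the presented group `Pres m e`, in terms of generators `x, y, z`
(standing for `s₀, s₁, s₂`). -/
def presRelators (m e : ℕ) : Set (FreeGroup (Fin 3)) :=
  let x : FreeGroup (Fin 3) := FreeGroup.of 0
  let y : FreeGroup (Fin 3) := FreeGroup.of 1
  let z : FreeGroup (Fin 3) := FreeGroup.of 2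
  {x ^ 2, y ^ 2, z ^ 2, (x * y) ^ 4, (x * z) ^ 2, (y * z) ^ 2 ^ (m - 3),
    (x * y * z * y) ^ 2 * (z * y) ^ (2 ^ (m - 4) * e)}

/-- The group `⟨s₀, s₁, s₂ ∣ s₀², s₁², s₂², (s₀s₁)⁴, (s₀s₂)², (s₁s₂)^(2^(m-3)),
(s₀s₁s₂s₁)² (s₂s₁)^(2^(m-4) e)⟩`; it is used for `5 ≤ m` only. -/
abbrev Pres (m e : ℕ) : Type := PresentedGroup (presRelators m e)

/-- The generators `s₀, s₁, s₂` of `Pres m e`. -/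
def presGen (m e : ℕ) (i : Fin 3) : Pres m e := PresentedGroup.of i

/-- The cyclic group of order two, written multiplicatively. -/
abbrev Z2 : Type := Multiplicative (ZMod 2)

end StringC

namespace StringC

/-! The classification rests on a parity map. By the intersection condition `s i` lies outside the
subgroup generated by the other generators, and in a 2-group that subgroup is contained in one of
index two which still misses `s i`. These subgroups give a surjection `E : G → {±1}ⁿ` whose kernel K
has order 2^(m-n) and contains every square (`IsStringCGroup.exists_parity`). The square of an
element of maximal order therefore generates a large cyclic subgroup L of K, which bounds the rank n
(`add_rank_le`).

A cyclic 2-group has at most one involution. If two of the elements (s_i s_j)², for pairs sharing at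
most one index, have nontrivial powers in one cyclic group, these have a common power w ≠ 1. The
intersection condition puts w in ⟨s_l⟩ or in the trivial group, while w ∈ K and s_l ∉ K: a
contradiction (`IsStringCGroup.sq_eq_one_or_of_mem_zpowers`). When K itself is cyclic, at most one
pair of neighbours fails to commute, and G is a dihedral group times copies of Z₂.

The remaining case is rank three with L of index two in K. Put x = (s₀s₁)² and y = (s₁s₂)². By the
same argument one of ⟨x⟩, ⟨y⟩ meets L trivially; reversing the generators if necessary, it is ⟨x⟩,
so x² = 1. A calculation in K then shows that s₁s₂ has order 2^(m-3) and that s₂ either fixes x or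
multiplies it by the involution of ⟨y⟩ (`IsStringCGroup.pow_eq_and_c_conj_eq`, and
`IsStringCGroup.c_conj_eq_of_natCard_ker_eq_four` when |K| = 4). These alternatives are the
relations for e = 0 and e = 1.

For the converse, every element of P_e(m) is s₀^i (s₁s₀s₁)^j d with d ∈ ⟨s₁, s₂⟩, so the order is at
most 2^m. Uniqueness of i and j is seen in a dihedral quotient of order eight, and uniqueness of d
in a permutation representation together with the sign (`pres_ofCoords_injective`). These
coordinates also describe the subgroups in the intersection condition. Equality of orders turns the
surjection P_e(m) → G into an isomorphism. -/

/-! ### Dihedral subgroups, internal semidirect products and collection of words -/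

theorem generators_induction {G ι : Type*} [Group G] {s : ι → G}
    (hs : Subgroup.closure (Set.range s) = ⊤) (hinv : ∀ i, s i * s i = 1) {p : G → Prop}
    (one : p 1) (mul : ∀ i g, p g → p (s i * g)) (g : G) : p g := by
  have hg : g ∈ Subgroup.closure (Set.range s) := hs ▸ Subgroup.mem_top g
  induction hg using Subgroup.closure_induction_left with
  | one => exact one
  | mul_left x hx y hy ih =>
    obtain ⟨i, rfl⟩ := hx
    exact mul i y ih
  | inv_mul_cancel x hx y hy ih =>
    obtain ⟨i, rfl⟩ := hx
    rw [inv_eq_of_mul_eq_one_left (hinv i)]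
    exact mul i y ih

theorem conj_zpow_of_conj_eq_inv {G : Type*} [Group G] {a b : G} (hb : b * b = 1)
    (hab : b * a * b = a⁻¹) (k : ℤ) : b * a ^ k * b = a ^ (-k) := by
  have hb' : b⁻¹ = b := inv_eq_of_mul_eq_one_left hb
  have h := conj_zpow (i := k) (a := b) (b := a)
  rw [hb', hab, inv_zpow, ← zpow_neg] at h
  exact h.symm

/-- In Mathlib `sr k = sr 0 * r k`, so the reflections have to go to `b * a ^ k`. The rotations
factor through `ZMod n` because `a ^ n = 1`. -/
theorem exists_dihedralHom {G : Type*} [Group G] {n : ℕ} {a b : G} (ha : a ^ n = 1)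
    (hb : b * b = 1) (hab : b * a * b = a⁻¹) :
    ∃ δ : DihedralGroup n →* G, (∀ k : ℤ, δ (.r k) = a ^ k) ∧ ∀ k : ℤ, δ (.sr k) = b * a ^ k := by
  let f : ZMod n →+ Additive G := ZMod.lift n ⟨zmultiplesHom (Additive G) (Additive.ofMul a), by
    simp [← ofMul_pow, ha]⟩
  let F : ZMod n → G := fun i => (f i).toMul
  have hF : ∀ k : ℤ, F k = a ^ k := by
    intro k
    simp [F, f, ← ofMul_zpow]
  have hbF : ∀ i, F i * b = b * F (-i) := by
    intro i
    obtain ⟨k, rfl⟩ := ZMod.intCast_surjective i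
    rw [← Int.cast_neg, hF, hF, ← conj_zpow_of_conj_eq_inv hb hab]
    simp only [← mul_assoc, hb, one_mul]
  have hadd : ∀ i j, F (i + j) = F i * F j := fun i j => by simp [F]
  refine ⟨MonoidHom.mk' (fun g => match g with
    | .r i => F i
    | .sr i => b * F i) ?_, hF, fun k => congrArg (b * ·) (hF k)⟩
  rintro (i | i) (j | j)
  · exact hadd i j
  · change b * F (j - i) = F i * (b * F j)
    rw [← mul_assoc, hbF, mul_assoc, ← hadd, sub_eq_neg_add]
  · change b * F (i + j) = b * F i * F j
    rw [hadd, mul_assoc]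
  · change F (j - i) = b * F i * (b * F j)
    rw [mul_assoc, ← mul_assoc (F i), hbF, ← mul_assoc, ← mul_assoc, hb, one_mul, ← hadd,
      sub_eq_neg_add]

theorem dihedralHom_injective {G : Type*} [Group G] {n : ℕ} {a b : G} (ha : orderOf a = n)
    (hb : ∀ k : ℤ, b * a ^ k ≠ 1) {δ : DihedralGroup n →* G} (hr : ∀ k : ℤ, δ (.r k) = a ^ k)
    (hsr : ∀ k : ℤ, δ (.sr k) = b * a ^ k) : Function.Injective δ := by
  rw [injective_iff_map_eq_one]
  rintro (i | i) h
  · obtain ⟨k, rfl⟩ := ZMod.intCast_surjective i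
    rw [hr, ← orderOf_dvd_iff_zpow_eq_one, ha] at h
    rw [(ZMod.intCast_zmod_eq_zero_iff_dvd k n).2 h]
    rfl
  · obtain ⟨k, rfl⟩ := ZMod.intCast_surjective i
    exact absurd (hsr k ▸ h) (hb k)

/-- The homomorphism from a dihedral group onto the group generated by two involutions. -/
theorem exists_dihedralHom_of_involutions {G : Type*} [Group G] {n : ℕ} {u v : G}
    (hu : u * u = 1) (hv : v * v = 1) (hn : orderOf (u * v) = n)
    (h : ∀ k : ℤ, v * (u * v) ^ k ≠ 1) :
    ∃ δ : DihedralGroup n →* G, Function.Injective δ ∧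
      (∀ k : ℤ, δ (.r k) = (u * v) ^ k) ∧ ∀ k : ℤ, δ (.sr k) = v * (u * v) ^ k := by
  obtain ⟨δ, hr, hsr⟩ := exists_dihedralHom (n := n) (a := u * v) (b := v)
    (hn ▸ pow_orderOf_eq_one _) hv (by
      rw [mul_inv_rev, inv_eq_of_mul_eq_one_left hu, inv_eq_of_mul_eq_one_left hv, mul_assoc,
        mul_assoc, hv, mul_one])
  exact ⟨δ, dihedralHom_injective hn h hr hsr, hr, hsr⟩

/-- Injectivity of `α` makes the conjugate `a'` unique, so conjugation defines an action of `B` on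
`A`. The last hypothesis says at once that the images meet trivially and that `β` is injective. -/
theorem exists_semidirectProduct_hom {A B G : Type*} [Group A] [Group B] [Group G]
    {α : A →* G} {β : B →* G} (hα : Function.Injective α)
    (hnorm : ∀ b a, ∃ a', β b * α a * (β b)⁻¹ = α a') (hdisj : ∀ a b, α a * β b = 1 → b = 1) :
    ∃ (χ : B →* MulAut A) (φ : A ⋊[χ] B →* G), Function.Injective φ ∧
      ∀ a b, φ ⟨a, b⟩ = α a * β b := by
  choose F hF using hnorm
  have hone : ∀ a, F 1 a = a := fun a => hα (by rw [← hF]; simp)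
  have hcomp : ∀ b c a, F (b * c) a = F b (F c a) := fun b c a => hα (by
    rw [← hF, ← hF, ← hF]; simp [mul_assoc])
  have hmul : ∀ b a a', F b (a * a') = F b a * F b a' := fun b a a' => hα (by
    rw [map_mul, ← hF, ← hF, ← hF]; simp [mul_assoc])
  let χ : B →* MulAut A :=
    { toFun := fun b =>
        { toFun := F b
          invFun := F b⁻¹
          left_inv := fun a => by rw [← hcomp, inv_mul_cancel, hone]
          right_inv := fun a => by rw [← hcomp, mul_inv_cancel, hone]
          map_mul' := hmul b }
      map_one' := MulEquiv.ext hone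
      map_mul' := fun b c => MulEquiv.ext (hcomp b c) }
  have hχ : ∀ b a, χ b a = F b a := fun _ _ => rfl
  refine ⟨χ, SemidirectProduct.lift α β ?_, ?_, fun a b => rfl⟩
  · intro b
    ext a
    simp [hχ, hF]
  · rw [injective_iff_map_eq_one]
    rintro ⟨a, b⟩ h
    change α a * β b = 1 at h
    obtain rfl := hdisj a b h
    rw [map_one, mul_one] at h
    obtain rfl : a = 1 := hα (by rw [h, map_one])
    rfl

/-- Since `x` is central in the image and all commutators of generators are powers of it, generators
can be sorted at the cost of powers of `x`. With `x = 1` this is the normal form in an abelian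
quotient; otherwise the quotient has class at most two. -/
theorem exists_pow_mul_pow {G Q : Type*} [Group G] [Group Q] {s : Fin 3 → G}
    (hs : Subgroup.closure (Set.range s) = ⊤) (hinv : ∀ i, s i * s i = 1) (π : G →* Q) {x : Q}
    {k : ℕ} (hx : ∀ i, Commute (π (s i)) x)
    (h₁₀ : π (s 1) * π (s 0) = π (s 0) * π (s 1) * x) (h₂₀ : Commute (π (s 2)) (π (s 0)))
    (h₂₁ : π (s 2) * π (s 1) = π (s 1) * π (s 2) * x ^ k) (g : G) :
    ∃ a b c d : ℕ, π g = π (s 0) ^ a * π (s 1) ^ b * π (s 2) ^ c * x ^ d := by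
  have key : ∀ (u v w : Q), Commute v w → Commute u w → u * v = v * u * w →
      ∀ n : ℕ, u * v ^ n = v ^ n * u * w ^ n := by
    intro u v w hvw huw huv n
    induction n with
    | zero => simp
    | succ n ih =>
      calc u * v ^ (n + 1) = u * v ^ n * v := by rw [pow_succ, mul_assoc]
        _ = v ^ n * u * (w ^ n * v) := by rw [ih, mul_assoc]
        _ = v ^ n * (u * v) * w ^ n := by rw [(hvw.symm.pow_left n).eq]; simp only [mul_assoc]
        _ = v ^ (n + 1) * u * w ^ (n + 1) := by
          rw [huv, pow_succ, pow_succ']; simp only [mul_assoc]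
  induction g using generators_induction hs hinv with
  | one => exact ⟨0, 0, 0, 0, by simp⟩
  | mul i g ih =>
    obtain ⟨a, b, c, d, ih⟩ := ih
    rw [map_mul, ih]
    fin_cases i
    · exact ⟨a + 1, b, c, d, by simp only [pow_succ', mul_assoc]; rfl⟩
    · refine ⟨a, b + 1, c, a + d, ?_⟩
      change π (s 1) * _ = _
      have h := key _ _ x (hx 0) (hx 1) h₁₀ a
      have h1 := ((hx 1).pow_pow b a).eq
      have h2 := ((hx 2).pow_pow c a).eq
      calc _ = (π (s 1) * π (s 0) ^ a) * π (s 1) ^ b * π (s 2) ^ c * x ^ d := by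
            simp only [mul_assoc]
        _ = π (s 0) ^ a * π (s 1) * (x ^ a * π (s 1) ^ b) * π (s 2) ^ c * x ^ d := by
            rw [h]; simp only [mul_assoc]
        _ = π (s 0) ^ a * π (s 1) * π (s 1) ^ b * (x ^ a * π (s 2) ^ c) * x ^ d := by
            rw [← h1]; simp only [mul_assoc]
        _ = _ := by rw [← h2, pow_succ', pow_add]; simp only [mul_assoc]
    · refine ⟨a, b, c + 1, k * b + d, ?_⟩
      change π (s 2) * _ = _
      have h := key _ _ (x ^ k) ((hx 1).pow_right k) ((hx 2).pow_right k) h₂₁ b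
      have h0 := (h₂₀.pow_right a).eq
      have h2 := ((hx 2).pow_pow c (k * b)).eq
      calc _ = (π (s 2) * π (s 0) ^ a) * π (s 1) ^ b * π (s 2) ^ c * x ^ d := by
            simp only [mul_assoc]
        _ = π (s 0) ^ a * (π (s 2) * π (s 1) ^ b) * π (s 2) ^ c * x ^ d := by
            rw [h0]; simp only [mul_assoc]
        _ = π (s 0) ^ a * π (s 1) ^ b * π (s 2) * (x ^ (k * b) * π (s 2) ^ c) * x ^ d := by
            rw [h, pow_mul]; simp only [mul_assoc]
        _ = _ := by rw [← h2, pow_succ', pow_add]; simp only [mul_assoc]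

/-! ### The relations of P_e(m) and four representations -/

/-- The elements `a, b, c` satisfy the relations defining `Pres m e`. -/
structure IsPresTriple {G : Type*} [Group G] (m e : ℕ) (a b c : G) : Prop where
  sq_a : a ^ 2 = 1
  sq_b : b ^ 2 = 1
  sq_c : c ^ 2 = 1
  pow_ab : (a * b) ^ 4 = 1
  pow_ac : (a * c) ^ 2 = 1
  pow_bc : (b * c) ^ 2 ^ (m - 3) = 1
  pow_abcb : (a * b * c * b) ^ 2 * (c * b) ^ (2 ^ (m - 4) * e) = 1

theorem isPresTriple_presGen (m e : ℕ) :
    IsPresTriple m e (presGen m e 0) (presGen m e 1) (presGen m e 2) := by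
  have h : ∀ w ∈ presRelators m e, PresentedGroup.mk (presRelators m e) w = 1 := fun w hw =>
    PresentedGroup.one_of_mem hw
  simp only [presRelators, Set.mem_insert_iff, Set.mem_singleton_iff, forall_eq_or_imp,
    forall_eq] at h
  obtain ⟨h1, h2, h3, h4, h5, h6, h7⟩ := h
  exact ⟨h1, h2, h3, h4, h5, h6, h7⟩

theorem IsPresTriple.exists_hom {G : Type*} [Group G] {m e : ℕ} {t : Fin 3 → G}
    (h : IsPresTriple m e (t 0) (t 1) (t 2)) :
    ∃ φ : Pres m e →* G, ∀ i, φ (presGen m e i) = t i := by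
  have hr : ∀ w ∈ presRelators m e, FreeGroup.lift t w = 1 := by
    simp only [presRelators, Set.mem_insert_iff, Set.mem_singleton_iff, forall_eq_or_imp,
      forall_eq, map_mul, map_pow, FreeGroup.lift_apply_of]
    exact ⟨h.sq_a, h.sq_b, h.sq_c, h.pow_ab, h.pow_ac, h.pow_bc, h.pow_abcb⟩
  exact ⟨PresentedGroup.toGroup hr, fun i => PresentedGroup.toGroup.of hr⟩

theorem closure_range_presGen (m e : ℕ) :
    Subgroup.closure (Set.range (presGen m e)) = ⊤ :=
  PresentedGroup.closure_range_of _

theorem two_pow_sub_four {m : ℕ} (hm : 5 ≤ m) : 2 * 2 ^ (m - 4) = 2 ^ (m - 3) := by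
  rw [← pow_succ']; congr 1; omega

theorem two_pow_sub_five {m : ℕ} (hm : 5 ≤ m) : 2 * 2 ^ (m - 5) = 2 ^ (m - 4) := by
  rw [← pow_succ']; congr 1; omega

/-- All relators have even length, so the parity of the word length is well defined. It shows later
that reflections in dihedral subgroups are nontrivial. -/
theorem exists_pres_hom_units (m e : ℕ) :
    ∃ φ : Pres m e →* ℤˣ, ∀ i, φ (presGen m e i) = -1 := by
  refine IsPresTriple.exists_hom (t := fun _ => (-1 : ℤˣ)) ?_
  constructor <;> simp

/-- The homomorphism to the dihedral group of order eight killing the third generator. -/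
theorem exists_pres_hom_dihedral {m : ℕ} (hm : 5 ≤ m) (e : ℕ) :
    ∃ φ : Pres m e →* DihedralGroup 4, φ (presGen m e 0) = .sr 0 ∧ φ (presGen m e 1) = .sr 1 ∧
      φ (presGen m e 2) = 1 := by
  have h : IsPresTriple m e (DihedralGroup.sr 0 : DihedralGroup 4) (.sr 1) 1 := by
    have hsq : (DihedralGroup.sr 1 : DihedralGroup 4) ^ 2 = 1 := by decide
    constructor
    · decide
    · decide
    · decide
    · decide
    · decide
    · rw [mul_one, ← two_pow_sub_four hm, pow_mul, hsq, one_pow]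
    -- For `5 ≤ m` the exponent `2 ^ (m - 4)` is even, so the tail of the last relator dies whatever
    -- `e` is.
    · rw [one_mul, ← two_pow_sub_five hm, Nat.mul_assoc, pow_mul _ 2, hsq, one_pow]
      decide
  obtain ⟨φ, hφ⟩ := IsPresTriple.exists_hom
    (t := ![(DihedralGroup.sr 0 : DihedralGroup 4), .sr 1, 1]) h
  exact ⟨φ, hφ 0, hφ 1, hφ 2⟩

/-- The homomorphism to the group of order two killing all generators but the second one. -/
theorem exists_pres_hom_second {m : ℕ} (hm : 5 ≤ m) (e : ℕ) :
    ∃ φ : Pres m e →* ℤˣ, φ (presGen m e 0) = 1 ∧ φ (presGen m e 1) = -1 ∧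
      φ (presGen m e 2) = 1 := by
  have h : IsPresTriple m e (1 : ℤˣ) (-1) 1 := by
    have hsq : (-1 : ℤˣ) ^ 2 = 1 := by decide
    constructor
    · decide
    · decide
    · decide
    · decide
    · decide
    · rw [mul_one, ← two_pow_sub_four hm, pow_mul, hsq, one_pow]
    · rw [one_mul, ← two_pow_sub_five hm, Nat.mul_assoc, pow_mul _ 2, hsq, one_pow]
      decide
  obtain ⟨φ, hφ⟩ := IsPresTriple.exists_hom (t := ![1, -1, 1]) h
  exact ⟨φ, hφ 0, hφ 1, hφ 2⟩

/-- A permutation representation of `Pres m e` of degree `2 ^ (m - 3)`. -/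
theorem exists_pres_hom_perm {m e : ℕ} (hm : 5 ≤ m) (he : e = 0 ∨ e = 1 ∧ 6 ≤ m) :
    ∃ φ : Pres m e →* Equiv.Perm (ZMod (2 ^ (m - 3))),
      (∀ x, φ (presGen m e 1) x = -x) ∧ ∀ x, φ (presGen m e 2) x = 1 - x := by
  have h4 : 4 ∣ 2 ^ (m - 3) := pow_dvd_pow 2 (by omega : 2 ≤ m - 3)
  -- The product `b c` is the translation by -1. The permutation `a` adds h = 2^(m-4) e exactly at
  -- the points congruent to 2 or 3 mod 4. The map `c` preserves this set of residues, and `b c b :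
  -- x ↦ -1 - x` exchanges it with its complement, so `(a b c b) ^ 2` adds h once at every point.
  let κ : ZMod (2 ^ (m - 3)) →+* ZMod 4 := ZMod.castHom h4 _
  let h : ZMod (2 ^ (m - 3)) := ((2 ^ (m - 4) * e : ℕ) : ZMod (2 ^ (m - 3)))
  -- Adding h must not change residues mod 4; this is where m = 5, e = 1 is excluded.
  have hκ : κ h = 0 := by
    have : 4 ∣ 2 ^ (m - 4) * e := by
      rcases he with rfl | ⟨rfl, hm'⟩
      · simp
      · rw [mul_one]; exact pow_dvd_pow 2 (by omega : 2 ≤ m - 4)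
    rw [map_natCast]
    exact (ZMod.natCast_eq_zero_iff _ _).2 this
  have h2 : h + h = 0 := by
    have : h + h = ((2 ^ (m - 3) * e : ℕ) : ZMod (2 ^ (m - 3))) := by
      rw [← Nat.cast_add]; congr 1; have := two_pow_sub_four hm; rw [← this]; ring
    rw [this, Nat.cast_mul, ZMod.natCast_self, zero_mul]
  let f : ZMod 4 → ZMod (2 ^ (m - 3)) := fun y => if y = 2 ∨ y = 3 then h else 0
  have hf : ∀ y, f y + f y = 0 := fun y => by
    simp only [f]; split_ifs <;> simp [h2]
  have hκf : ∀ y, κ (f y) = 0 := fun y => by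
    simp only [f]; split_ifs <;> simp [hκ]
  have hf1 : ∀ y, f (1 - y) = f y := by
    have : ∀ y : ZMod 4, (1 - y = 2 ∨ 1 - y = 3) ↔ (y = 2 ∨ y = 3) := by decide
    intro y; simp only [f, this]
  have hf2 : ∀ y, f (-1 - y) + f y = h := by
    have : ∀ y : ZMod 4, (-1 - y = 2 ∨ -1 - y = 3) ↔ ¬ (y = 2 ∨ y = 3) := by decide
    intro y; simp only [f, this]; split_ifs <;> simp_all
  let a : Equiv.Perm (ZMod (2 ^ (m - 3))) := Function.Involutive.toPerm (fun x => x + f (κ x))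
    fun x => by simp only [map_add, hκf, add_zero]; linear_combination hf (κ x)
  let b : Equiv.Perm (ZMod (2 ^ (m - 3))) := Function.Involutive.toPerm (fun x => -x)
    fun x => neg_neg x
  let c : Equiv.Perm (ZMod (2 ^ (m - 3))) := Function.Involutive.toPerm (fun x => 1 - x)
    fun x => by simp
  have ha : ∀ x, a x = x + f (κ x) := fun _ => rfl
  have hb : ∀ x, b x = -x := fun _ => rfl
  have hc : ∀ x, c x = 1 - x := fun _ => rfl
  have hbc : ∀ (k : ℕ) x, ((b * c) ^ k) x = x - k := by
    intro k
    induction k with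
    | zero => simp
    | succ k ih => intro x; rw [pow_succ, Equiv.Perm.mul_apply, ih]; simp [hb, hc]; ring
  have hcb : ∀ (k : ℕ) x, ((c * b) ^ k) x = x + k := by
    intro k
    induction k with
    | zero => simp
    | succ k ih => intro x; rw [pow_succ, Equiv.Perm.mul_apply, ih]; simp [hb, hc]; ring
  have hsq : ∀ (g : Equiv.Perm (ZMod (2 ^ (m - 3)))) (x), (g ^ 2) x = g (g x) := fun g x => by
    rw [sq, Equiv.Perm.mul_apply]
  have H : IsPresTriple m e a b c := by
    constructor
    · ext x; rw [hsq]; exact Function.Involutive.toPerm_involutive _ x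
    · ext x; rw [hsq]; exact Function.Involutive.toPerm_involutive _ x
    · ext x; rw [hsq]; exact Function.Involutive.toPerm_involutive _ x
    · ext x
      rw [show 4 = 2 * 2 from rfl, pow_mul, hsq, hsq, hsq]
      simp only [Equiv.Perm.mul_apply, ha, hb, map_add, map_neg, hκf, Equiv.Perm.one_apply,
        neg_neg, add_zero]
      linear_combination hf (κ x) - hf (-κ x)
    · ext x
      rw [hsq]
      simp only [Equiv.Perm.mul_apply, ha, hc, map_add, map_sub, map_one, hκf,
        Equiv.Perm.one_apply, add_zero, hf1]
      ring
    · ext x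
      rw [hbc, ZMod.natCast_self, sub_zero, Equiv.Perm.one_apply]
    · ext x
      rw [Equiv.Perm.mul_apply, hcb, hsq]
      change _ = x
      change (a * b * c * b) ((a * b * c * b) (x + h)) = x
      simp only [Equiv.Perm.mul_apply, ha, hb, hc, map_add, map_neg, map_one, hκf, hκ,
        add_zero, sub_neg_eq_add]
      have e1 : -(1 + κ x) = -1 - κ x := by ring
      have e2 : -(1 + (-1 - κ x)) = κ x := by ring
      rw [e1, e2]
      linear_combination hf (κ x) - hf2 (κ x)
  obtain ⟨φ, hφ⟩ := IsPresTriple.exists_hom (t := ![a, b, c]) H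
  exact ⟨φ, fun x => by rw [hφ]; rfl, fun x => by rw [hφ]; rfl⟩

/-! ### Consequences of the relations -/

section Consequences

variable {G : Type*} [Group G] {m e : ℕ} {a b c : G}

theorem IsPresTriple.mul_self_a (h : IsPresTriple m e a b c) : a * a = 1 := by rw [← sq, h.sq_a]

theorem IsPresTriple.mul_self_b (h : IsPresTriple m e a b c) : b * b = 1 := by rw [← sq, h.sq_b]

theorem IsPresTriple.mul_self_c (h : IsPresTriple m e a b c) : c * c = 1 := by rw [← sq, h.sq_c]

theorem IsPresTriple.commute_ac (h : IsPresTriple m e a b c) : Commute a c := by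
  have h1 := h.pow_ac
  rw [sq, mul_eq_one_iff_eq_inv, mul_inv_rev, inv_eq_of_mul_eq_one_left h.mul_self_a,
    inv_eq_of_mul_eq_one_left h.mul_self_c] at h1
  exact h1

theorem IsPresTriple.mul_self_conj (h : IsPresTriple m e a b c) : (b * a * b) * (b * a * b) = 1 := by
  calc (b * a * b) * (b * a * b) = b * a * (b * b) * a * b := by simp only [mul_assoc]
    _ = b * (a * a) * b := by rw [h.mul_self_b]; simp only [mul_assoc, mul_one]
    _ = 1 := by rw [h.mul_self_a, mul_one, h.mul_self_b]

theorem IsPresTriple.commute_conj (h : IsPresTriple m e a b c) : Commute a (b * a * b) := by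
  have h1 : (a * (b * a * b)) * (a * (b * a * b)) = 1 := by
    rw [← h.pow_ab]; simp only [pow_succ, pow_zero, one_mul, mul_assoc]
  rw [mul_eq_one_iff_eq_inv, mul_inv_rev, inv_eq_of_mul_eq_one_left h.mul_self_a,
    inv_eq_of_mul_eq_one_left h.mul_self_conj] at h1
  exact h1

theorem IsPresTriple.inv_bc (h : IsPresTriple m e a b c) : (b * c)⁻¹ = c * b := by
  rw [mul_inv_rev, inv_eq_of_mul_eq_one_left h.mul_self_b, inv_eq_of_mul_eq_one_left h.mul_self_c]

theorem IsPresTriple.mul_self_z (h : IsPresTriple m e a b c) (hm : 5 ≤ m) :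
    (b * c) ^ (2 ^ (m - 4) * e) * (b * c) ^ (2 ^ (m - 4) * e) = 1 := by
  rw [← pow_add, ← two_mul, ← mul_assoc, two_pow_sub_four hm, pow_mul, h.pow_bc, one_pow]

theorem IsPresTriple.inv_z (h : IsPresTriple m e a b c) (hm : 5 ≤ m) :
    ((b * c) ^ (2 ^ (m - 4) * e))⁻¹ = (b * c) ^ (2 ^ (m - 4) * e) :=
  inv_eq_of_mul_eq_one_left (h.mul_self_z hm)

theorem IsPresTriple.pow_cb (h : IsPresTriple m e a b c) (hm : 5 ≤ m) :
    (c * b) ^ (2 ^ (m - 4) * e) = (b * c) ^ (2 ^ (m - 4) * e) := by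
  rw [← h.inv_bc, inv_pow, h.inv_z hm]

theorem IsPresTriple.sq_abcb (h : IsPresTriple m e a b c) (hm : 5 ≤ m) :
    (a * b * c * b) ^ 2 = (b * c) ^ (2 ^ (m - 4) * e) := by
  have h1 := h.pow_abcb
  rw [h.pow_cb hm, mul_eq_one_iff_eq_inv, h.inv_z hm] at h1
  exact h1

theorem commute_of_conj_eq {g x : G} (hg : g * g = 1) (h : g * x * g = x) : Commute g x := by
  calc g * x = g * x * (g * g) := by rw [hg, mul_one]
    _ = (g * x * g) * g := by simp only [mul_assoc]
    _ = x * g := by rw [h]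

theorem conj_pow_of_mul_self {g x : G} (hg : g * g = 1) (n : ℕ) :
    g * x ^ n * g = (g * x * g) ^ n := by
  have h := conj_pow (i := n) (a := g) (b := x)
  rw [inv_eq_of_mul_eq_one_left hg] at h
  exact h.symm

/-- Conjugation by `b` inverts `b * c`, and z = (bc)^(2^(m-4) e) is its own inverse. The same holds
for `c`, so z is central in ⟨b, c⟩. -/
theorem IsPresTriple.commute_bz (h : IsPresTriple m e a b c) (hm : 5 ≤ m) :
    Commute b ((b * c) ^ (2 ^ (m - 4) * e)) := by
  refine commute_of_conj_eq h.mul_self_b ?_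
  rw [conj_pow_of_mul_self h.mul_self_b, ← mul_assoc, h.mul_self_b, one_mul, h.pow_cb hm]

theorem IsPresTriple.commute_cz (h : IsPresTriple m e a b c) (hm : 5 ≤ m) :
    Commute c ((b * c) ^ (2 ^ (m - 4) * e)) := by
  refine commute_of_conj_eq h.mul_self_c ?_
  rw [conj_pow_of_mul_self h.mul_self_c, mul_assoc, mul_assoc, h.mul_self_c, mul_one, h.pow_cb hm]

/-- Conjugating the last relation by `b` turns it into ((bab)c)² = z: the commutator of `c` with the
conjugate `b a b` is z. -/
theorem IsPresTriple.c_mul_conj (h : IsPresTriple m e a b c) (hm : 5 ≤ m) :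
    c * (b * a * b) = (b * a * b) * ((b * c) ^ (2 ^ (m - 4) * e) * c) := by
  have hbb : ∀ w, b * (b * w) = w := fun w => by rw [← mul_assoc, h.mul_self_b, one_mul]
  have h1 : ((b * a * b) * c) * ((b * a * b) * c) = (b * c) ^ (2 ^ (m - 4) * e) := by
    have h2 : b * (a * b * c * b) ^ 2 * b = (b * c) ^ (2 ^ (m - 4) * e) := by
      rw [h.sq_abcb hm, (h.commute_bz hm).eq, mul_assoc, h.mul_self_b, mul_one]
    rw [← h2]
    simp only [sq, mul_assoc, h.mul_self_b, mul_one]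
  have h3 : c * (b * a * b) = (b * a * b)⁻¹ * (((b * a * b) * c) * ((b * a * b) * c)) * c⁻¹ := by
    group
  rw [h3, h1, inv_eq_of_mul_eq_one_left h.mul_self_conj, inv_eq_of_mul_eq_one_left h.mul_self_c,
    mul_assoc]

theorem IsPresTriple.b_mul_a (h : IsPresTriple m e a b c) : b * a = (b * a * b) * b := by
  rw [mul_assoc, h.mul_self_b, mul_one]

theorem IsPresTriple.b_mul_conj (h : IsPresTriple m e a b c) : b * (b * a * b) = a * b := by
  simp only [← mul_assoc, h.mul_self_b, one_mul]

end Consequences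

/-! ### Coordinates a^i (bab)^j d and the order of P_e(m) -/

/-- `g` or `1`, according to a Boolean. -/
def bpow {G : Type*} [Group G] (g : G) (i : Bool) : G := bif i then g else 1

section Bpow

variable {G : Type*} [Group G]

theorem mul_bpow {g : G} (hg : g * g = 1) (i : Bool) : g * bpow g i = bpow g (!i) := by
  cases i <;> simp [bpow, hg]

theorem commute_bpow_bpow {g h : G} (H : Commute g h) (i j : Bool) :
    Commute (bpow g i) (bpow h j) := by
  cases i <;> cases j <;> simp [bpow, H]

theorem map_bpow {H : Type*} [Group H] (φ : G →* H) (g : G) (i : Bool) :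
    φ (bpow g i) = bpow (φ g) i := by
  cases i <;> simp [bpow]

end Bpow

/-- The element of `G` with coordinates `i`, `j`, `d`. -/
def ofCoords {G D : Type*} [Group G] [Group D] (a t : G) (δ : D →* G) (i j : Bool) (d : D) : G :=
  bpow a i * bpow t j * δ d

theorem isPresTriple_exists_dihedralHom {G : Type*} [Group G] {m e : ℕ} {a b c : G}
    (h : IsPresTriple m e a b c) :
    ∃ δ : DihedralGroup (2 ^ (m - 3)) →* G, (∀ k : ℤ, δ (.r k) = (b * c) ^ k) ∧
      ∀ k : ℤ, δ (.sr k) = c * (b * c) ^ k := by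
  refine exists_dihedralHom h.pow_bc h.mul_self_c ?_
  rw [h.inv_bc, mul_assoc, mul_assoc, h.mul_self_c, mul_one]

section Coords

variable {G : Type*} [Group G] {m e : ℕ} {a b c : G}
  {δ : DihedralGroup (2 ^ (m - 3)) →* G}

theorem dihedralHom_c (hsr : ∀ k : ℤ, δ (.sr k) = c * (b * c) ^ k) : δ (.sr 0) = c := by
  simpa using hsr 0

theorem dihedralHom_b (h : IsPresTriple m e a b c)
    (hsr : ∀ k : ℤ, δ (.sr k) = c * (b * c) ^ k) : δ (.sr (-1)) = b := by
  have h1 := hsr (-1)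
  rw [zpow_neg_one, h.inv_bc, ← mul_assoc, h.mul_self_c, one_mul] at h1
  simpa using h1

theorem dihedralHom_z (hr : ∀ k : ℤ, δ (.r k) = (b * c) ^ k) (N : ℕ) :
    δ (.r (N : ℕ)) = (b * c) ^ N := by
  simpa using hr N

theorem a_mul_ofCoords (h : IsPresTriple m e a b c) (t : G) (i j : Bool)
    (d : DihedralGroup (2 ^ (m - 3))) :
    a * ofCoords a t δ i j d = ofCoords a t δ (!i) j d := by
  simp only [ofCoords, ← mul_assoc, mul_bpow h.mul_self_a]

/-- Conjugation by `b` exchanges the commuting involutions `a` and `b a b`, hence the two Booleans.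
-/
theorem b_mul_ofCoords (h : IsPresTriple m e a b c)
    (hsr : ∀ k : ℤ, δ (.sr k) = c * (b * c) ^ k) (i j : Bool)
    (d : DihedralGroup (2 ^ (m - 3))) :
    b * ofCoords a (b * a * b) δ i j d = ofCoords a (b * a * b) δ j i (.sr (-1) * d) := by
  have h1 : b * bpow a i = bpow (b * a * b) i * b := by
    cases i
    · simp [bpow]
    · exact h.b_mul_a
  have h2 : b * bpow (b * a * b) j = bpow a j * b := by
    cases j
    · simp [bpow]
    · exact h.b_mul_conj
  simp only [ofCoords, map_mul, dihedralHom_b h hsr]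
  calc b * (bpow a i * bpow (b * a * b) j * δ d)
      = (b * bpow a i) * bpow (b * a * b) j * δ d := by simp only [mul_assoc]
    _ = bpow (b * a * b) i * (b * bpow (b * a * b) j) * δ d := by rw [h1]; simp only [mul_assoc]
    _ = (bpow (b * a * b) i * bpow a j) * b * δ d := by rw [h2]; simp only [mul_assoc]
    _ = bpow a j * bpow (b * a * b) i * (b * δ d) := by
      rw [(commute_bpow_bpow h.commute_conj j i).eq]; simp only [mul_assoc]

/-- Moving `c` to the right past `a` costs nothing; past `b a b` it costs the factor z, a rotation
absorbed by the dihedral coordinate. -/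
theorem c_mul_ofCoords (h : IsPresTriple m e a b c) (hm : 5 ≤ m)
    (hr : ∀ k : ℤ, δ (.r k) = (b * c) ^ k)
    (hsr : ∀ k : ℤ, δ (.sr k) = c * (b * c) ^ k) (i j : Bool)
    (d : DihedralGroup (2 ^ (m - 3))) :
    c * ofCoords a (b * a * b) δ i j d = ofCoords a (b * a * b) δ i j
      (bpow (.r ((2 ^ (m - 4) * e : ℕ) : ZMod (2 ^ (m - 3)))) j * .sr 0 * d) := by
  have h1 : c * bpow a i = bpow a i * c := by
    cases i
    · simp [bpow]
    · exact h.commute_ac.symm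
  have h2 : c * bpow (b * a * b) j =
      bpow (b * a * b) j * (bpow ((b * c) ^ (2 ^ (m - 4) * e)) j * c) := by
    cases j
    · simp [bpow]
    · exact h.c_mul_conj hm
  simp only [ofCoords, map_mul, dihedralHom_c hsr, map_bpow, dihedralHom_z hr]
  calc c * (bpow a i * bpow (b * a * b) j * δ d)
      = (c * bpow a i) * bpow (b * a * b) j * δ d := by simp only [mul_assoc]
    _ = bpow a i * (c * bpow (b * a * b) j) * δ d := by rw [h1]; simp only [mul_assoc]
    _ = _ := by rw [h2]; simp only [mul_assoc]

theorem exists_ofCoords {s : Fin 3 → G} (hs : Subgroup.closure (Set.range s) = ⊤)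
    (h : IsPresTriple m e (s 0) (s 1) (s 2)) (hm : 5 ≤ m)
    (hr : ∀ k : ℤ, δ (.r k) = (s 1 * s 2) ^ k)
    (hsr : ∀ k : ℤ, δ (.sr k) = s 2 * (s 1 * s 2) ^ k) (g : G) :
    ∃ i j d, g = ofCoords (s 0) (s 1 * s 0 * s 1) δ i j d := by
  have hinv : ∀ i, s i * s i = 1 := fun i => by
    fin_cases i
    exacts [h.mul_self_a, h.mul_self_b, h.mul_self_c]
  induction g using generators_induction hs hinv with
  | one => exact ⟨false, false, 1, by simp [ofCoords, bpow]⟩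
  | mul k g ih =>
    obtain ⟨i, j, d, rfl⟩ := ih
    fin_cases k
    · exact ⟨_, _, _, a_mul_ofCoords h _ i j d⟩
    · exact ⟨_, _, _, b_mul_ofCoords h hsr i j d⟩
    · exact ⟨_, _, _, c_mul_ofCoords h hm hr hsr i j d⟩

end Coords

theorem orderOf_presGen_one_mul_two {m e : ℕ} (hm : 5 ≤ m) (he : e = 0 ∨ e = 1 ∧ 6 ≤ m) :
    orderOf (presGen m e 1 * presGen m e 2) = 2 ^ (m - 3) := by
  obtain ⟨φ, h1, h2⟩ := exists_pres_hom_perm hm he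
  refine Nat.dvd_antisymm (orderOf_dvd_of_pow_eq_one (isPresTriple_presGen m e).pow_bc) ?_
  have key : ∀ (k : ℕ) x, φ ((presGen m e 1 * presGen m e 2) ^ k) x = x - k := by
    intro k
    induction k with
    | zero => simp
    | succ k ih =>
      intro x
      rw [pow_succ, map_mul, Equiv.Perm.mul_apply, ih, map_mul, Equiv.Perm.mul_apply, h1, h2]
      push_cast; ring
  have h := key (orderOf (presGen m e 1 * presGen m e 2)) 0
  rw [pow_orderOf_eq_one, map_one, Equiv.Perm.one_apply, zero_sub, eq_comm, neg_eq_zero] at h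
  exact (ZMod.natCast_eq_zero_iff _ _).1 h

theorem pres_dihedralHom_injective {m e : ℕ} (hm : 5 ≤ m) (he : e = 0 ∨ e = 1 ∧ 6 ≤ m)
    {δ : DihedralGroup (2 ^ (m - 3)) →* Pres m e}
    (hr : ∀ k : ℤ, δ (.r k) = (presGen m e 1 * presGen m e 2) ^ k)
    (hsr : ∀ k : ℤ, δ (.sr k) = presGen m e 2 * (presGen m e 1 * presGen m e 2) ^ k) :
    Function.Injective δ := by
  refine dihedralHom_injective (orderOf_presGen_one_mul_two hm he) (fun k h => ?_) hr hsr
  obtain ⟨φ, hφ⟩ := exists_pres_hom_units m e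
  have := congrArg φ h
  simp [hφ] at this

/-- In the quotient of order eight that kills the third generator, the dihedral coordinate lands in
`{1, sr 1}`. Products of the images of a, bab and b are distinct there, so the Booleans can be read
off; the rest is injectivity of `δ`. -/
theorem pres_ofCoords_injective {m e : ℕ} (hm : 5 ≤ m) (he : e = 0 ∨ e = 1 ∧ 6 ≤ m)
    {δ : DihedralGroup (2 ^ (m - 3)) →* Pres m e}
    (hr : ∀ k : ℤ, δ (.r k) = (presGen m e 1 * presGen m e 2) ^ k)
    (hsr : ∀ k : ℤ, δ (.sr k) = presGen m e 2 * (presGen m e 1 * presGen m e 2) ^ k)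
    {i j i' j' : Bool} {d d' : DihedralGroup (2 ^ (m - 3))}
    (h : ofCoords (presGen m e 0) (presGen m e 1 * presGen m e 0 * presGen m e 1) δ i j d =
      ofCoords (presGen m e 0) (presGen m e 1 * presGen m e 0 * presGen m e 1) δ i' j' d') :
    i = i' ∧ j = j' ∧ d = d' := by
  obtain ⟨φ, h0, h1, h2⟩ := exists_pres_hom_dihedral hm e
  have hpow : ∀ k : ℤ, (DihedralGroup.sr 1 : DihedralGroup 4) ^ k = 1 ∨
      (DihedralGroup.sr 1 : DihedralGroup 4) ^ k = .sr 1 := by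
    have hsq : (DihedralGroup.sr 1 : DihedralGroup 4) ^ (2 : ℤ) = 1 := by decide
    intro k
    obtain ⟨l, rfl | rfl⟩ := Int.even_or_odd' k
    · left; rw [zpow_mul, hsq, one_zpow]
    · right; rw [zpow_add, zpow_mul, hsq, one_zpow, one_mul, zpow_one]
  have hδ : ∀ d, φ (δ d) = 1 ∨ φ (δ d) = .sr 1 := by
    rintro (x | x)
    · obtain ⟨k, rfl⟩ := ZMod.intCast_surjective x
      rw [hr, map_zpow, map_mul, h1, h2, mul_one]
      exact hpow k
    · obtain ⟨k, rfl⟩ := ZMod.intCast_surjective x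
      rw [hsr, map_mul, map_zpow, map_mul, h1, h2, mul_one, one_mul]
      exact hpow k
  have hij : i = i' ∧ j = j' := by
    have h3 := congrArg φ h
    simp only [ofCoords, map_mul, map_bpow, h0, h1] at h3
    have key : ∀ i j i' j' : Bool, ∀ w w' : DihedralGroup 4, (w = 1 ∨ w = .sr 1) →
        (w' = 1 ∨ w' = .sr 1) →
        bpow (.sr 0) i * bpow (.sr 1 * .sr 0 * .sr 1) j * w =
          bpow (.sr 0) i' * bpow (.sr 1 * .sr 0 * .sr 1) j' * w' → i = i' ∧ j = j' := by
      rintro i j i' j' w w' (rfl | rfl) (rfl | rfl) <;> revert i j i' j' <;> decide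
    exact key _ _ _ _ _ _ (hδ d) (hδ d') h3
  obtain ⟨rfl, rfl⟩ := hij
  exact ⟨rfl, rfl, pres_dihedralHom_injective hm he hr hsr (mul_left_cancel h)⟩

theorem natCard_pres {m e : ℕ} (hm : 5 ≤ m) (he : e = 0 ∨ e = 1 ∧ 6 ≤ m) :
    Nat.card (Pres m e) = 2 ^ m := by
  have ht := isPresTriple_presGen m e
  obtain ⟨δ, hr, hsr⟩ := isPresTriple_exists_dihedralHom ht
  let F : Bool × Bool × DihedralGroup (2 ^ (m - 3)) → Pres m e := fun p =>
    ofCoords (presGen m e 0) (presGen m e 1 * presGen m e 0 * presGen m e 1) δ p.1 p.2.1 p.2.2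
  have hF : Function.Bijective F := by
    constructor
    · rintro ⟨i, j, d⟩ ⟨i', j', d'⟩ h
      obtain ⟨rfl, rfl, rfl⟩ := pres_ofCoords_injective hm he hr hsr h
      rfl
    · intro g
      obtain ⟨i, j, d, h⟩ := exists_ofCoords (closure_range_presGen m e) ht hm hr hsr g
      exact ⟨(i, j, d), h.symm⟩
  rw [← Nat.card_eq_of_bijective F hF, Nat.card_prod, Nat.card_prod, DihedralGroup.nat_card,
    Nat.card_eq_fintype_card, Fintype.card_bool]
  have : 2 ^ m = 2 ^ (m - 3) * 2 ^ 3 := by rw [← pow_add]; congr 1; omega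
  rw [this]; ring

/-! ### The intersection condition for P_e(m) -/

section Intersection

variable {m e : ℕ} {δ : DihedralGroup (2 ^ (m - 3)) →* Pres m e}

/-- The coordinates of an element of the subgroup generated by the `presGen m e i`, `i ∈ J`. -/
def CoordsMem (m : ℕ) (J : Set (Fin 3)) (i j : Bool) (d : DihedralGroup (2 ^ (m - 3))) : Prop :=
  (i = true → 0 ∈ J) ∧ (j = true → 0 ∈ J ∧ 1 ∈ J) ∧
    ((1 ∈ J ∧ 2 ∈ J) ∨ d = 1 ∨ (1 ∈ J ∧ d = .sr (-1)) ∨ (2 ∈ J ∧ d = .sr 0))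

/-- The admissible coordinates are stable under left multiplication by the generators in `J`; `sr
(-1)` and `sr 0` are the coordinates of the second and third generators. The factor z appears only
when `j` is true, which forces `1 ∈ J`; multiplying by the third generator then means that all
dihedral coordinates are admissible. -/
theorem exists_coordsMem (hm : 5 ≤ m)
    (hr : ∀ k : ℤ, δ (.r k) = (presGen m e 1 * presGen m e 2) ^ k)
    (hsr : ∀ k : ℤ, δ (.sr k) = presGen m e 2 * (presGen m e 1 * presGen m e 2) ^ k)
    {J : Set (Fin 3)} {g : Pres m e} (hg : g ∈ Subgroup.closure (presGen m e '' J)) :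
    ∃ i j d, CoordsMem m J i j d ∧
      g = ofCoords (presGen m e 0) (presGen m e 1 * presGen m e 0 * presGen m e 1) δ i j d := by
  have ht := isPresTriple_presGen m e
  have hmul : ∀ k ∈ J, ∀ g, (∃ i j d, CoordsMem m J i j d ∧
      g = ofCoords (presGen m e 0) (presGen m e 1 * presGen m e 0 * presGen m e 1) δ i j d) →
      ∃ i j d, CoordsMem m J i j d ∧ presGen m e k * g =
        ofCoords (presGen m e 0) (presGen m e 1 * presGen m e 0 * presGen m e 1) δ i j d := by
    rintro k hk _ ⟨i, j, d, ⟨hi, hj, hd⟩, rfl⟩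
    fin_cases k
    · exact ⟨_, _, _, ⟨fun _ => hk, hj, hd⟩, a_mul_ofCoords ht _ i j d⟩
    · refine ⟨_, _, _, ⟨fun h => (hj h).1, fun h => ⟨hi h, hk⟩, ?_⟩, b_mul_ofCoords ht hsr i j d⟩
      rcases hd with hd | rfl | ⟨-, rfl⟩ | ⟨h2, rfl⟩
      · exact .inl hd
      · exact .inr (.inr (.inl ⟨hk, mul_one _⟩))
      · exact .inr (.inl (DihedralGroup.sr_mul_self _))
      · exact .inl ⟨hk, h2⟩
    · refine ⟨_, _, _, ⟨hi, hj, ?_⟩, c_mul_ofCoords ht hm hr hsr i j d⟩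
      rcases hd with hd | rfl | ⟨h1, rfl⟩ | ⟨-, rfl⟩
      · exact .inl hd
      · cases j
        · exact .inr (.inr (.inr ⟨hk, by simp [bpow]⟩))
        · exact .inl ⟨(hj rfl).2, hk⟩
      · exact .inl ⟨h1, hk⟩
      · cases j
        · exact .inr (.inl (by simp [bpow]))
        · exact .inl ⟨(hj rfl).2, hk⟩
  have hinv : ∀ k, (presGen m e k)⁻¹ = presGen m e k := fun k => by
    fin_cases k
    exacts [inv_eq_of_mul_eq_one_left ht.mul_self_a, inv_eq_of_mul_eq_one_left ht.mul_self_b,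
      inv_eq_of_mul_eq_one_left ht.mul_self_c]
  induction hg using Subgroup.closure_induction_left with
  | one => exact ⟨false, false, 1, ⟨by simp, by simp, by simp⟩, by simp [ofCoords, bpow]⟩
  | mul_left x hx y hy ih =>
    obtain ⟨k, hk, rfl⟩ := hx
    exact hmul k hk y ih
  | inv_mul_cancel x hx y hy ih =>
    obtain ⟨k, hk, rfl⟩ := hx
    rw [hinv]
    exact hmul k hk y ih

theorem ofCoords_mem_closure
    (hr : ∀ k : ℤ, δ (.r k) = (presGen m e 1 * presGen m e 2) ^ k)
    (hsr : ∀ k : ℤ, δ (.sr k) = presGen m e 2 * (presGen m e 1 * presGen m e 2) ^ k)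
    {J : Set (Fin 3)} {i j : Bool} {d : DihedralGroup (2 ^ (m - 3))} (h : CoordsMem m J i j d) :
    ofCoords (presGen m e 0) (presGen m e 1 * presGen m e 0 * presGen m e 1) δ i j d ∈
      Subgroup.closure (presGen m e '' J) := by
  have ht := isPresTriple_presGen m e
  have hgen : ∀ k ∈ J, presGen m e k ∈ Subgroup.closure (presGen m e '' J) := fun k hk =>
    Subgroup.subset_closure ⟨k, hk, rfl⟩
  obtain ⟨hi, hj, hd⟩ := h
  refine mul_mem (mul_mem ?_ ?_) ?_
  · cases i
    · exact one_mem _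
    · exact hgen 0 (hi rfl)
  · cases j
    · exact one_mem _
    · obtain ⟨h0, h1⟩ := hj rfl
      exact mul_mem (mul_mem (hgen 1 h1) (hgen 0 h0)) (hgen 1 h1)
  · rcases hd with ⟨h1, h2⟩ | rfl | ⟨h1, rfl⟩ | ⟨h2, rfl⟩
    · have hz : ∀ k : ℤ, (presGen m e 1 * presGen m e 2) ^ k ∈
          Subgroup.closure (presGen m e '' J) := fun k => zpow_mem (mul_mem (hgen 1 h1) (hgen 2 h2)) k
      rcases d with x | x
      · obtain ⟨k, rfl⟩ := ZMod.intCast_surjective x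
        exact hr k ▸ hz k
      · obtain ⟨k, rfl⟩ := ZMod.intCast_surjective x
        exact hsr k ▸ mul_mem (hgen 2 h2) (hz k)
    · rw [map_one]
      exact one_mem _
    · rw [dihedralHom_b ht hsr]
      exact hgen 1 h1
    · rw [dihedralHom_c hsr]
      exact hgen 2 h2

/-- As coordinates are unique, the intersection condition reduces to this. For the dihedral
coordinate it uses that 1, `sr (-1)` and `sr 0` are distinct. -/
theorem CoordsMem.inter (hm : 5 ≤ m) {J K : Set (Fin 3)} {i j : Bool}
    {d : DihedralGroup (2 ^ (m - 3))} (hJ : CoordsMem m J i j d) (hK : CoordsMem m K i j d) :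
    CoordsMem m (J ∩ K) i j d := by
  have : Fact (1 < 2 ^ (m - 3)) := ⟨Nat.one_lt_two_pow (by omega)⟩
  have h01 : (DihedralGroup.sr (-1) : DihedralGroup (2 ^ (m - 3))) ≠ .sr 0 := by simp
  have h1 : ∀ x, (DihedralGroup.sr x : DihedralGroup (2 ^ (m - 3))) ≠ 1 := fun x h => by
    rw [DihedralGroup.one_def] at h; cases h
  obtain ⟨hi, hj, hd⟩ := hJ
  obtain ⟨hi', hj', hd'⟩ := hK
  refine ⟨fun h => ⟨hi h, hi' h⟩, fun h => ⟨⟨(hj h).1, (hj' h).1⟩, (hj h).2, (hj' h).2⟩, ?_⟩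
  simp only [Set.mem_inter_iff]
  rcases hd with hd | rfl | ⟨h2, rfl⟩ | ⟨h2, rfl⟩ <;>
    rcases hd' with hd' | hd' | ⟨h3, hd'⟩ | ⟨h3, hd'⟩ <;> simp_all

end Intersection

theorem isStringCGroup_presGen {m e : ℕ} (hm : 5 ≤ m) (he : e = 0 ∨ e = 1 ∧ 6 ≤ m) :
    IsStringCGroup (presGen m e) := by
  have ht := isPresTriple_presGen m e
  obtain ⟨φ, h0, h1, h2⟩ := exists_pres_hom_dihedral hm e
  obtain ⟨ψ, hψ⟩ := exists_pres_hom_units m e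
  have two : ∀ g : Pres m e, g ^ 2 = 1 → g ≠ 1 → orderOf g = 2 := fun g hg hg1 =>
    orderOf_eq_prime hg hg1
  refine ⟨by norm_num, ?_, fun i => two _ ?_ ?_, closure_range_presGen m e, ?_, ?_⟩
  · intro i j hij
    have h := congrArg φ hij
    fin_cases i <;> fin_cases j <;> simp [h0, h1, h2] at h ⊢ <;> revert h <;> decide
  · fin_cases i
    exacts [ht.sq_a, ht.sq_b, ht.sq_c]
  · intro h
    have h' := congrArg ψ h
    simp [hψ] at h'
  · intro j k hjk
    obtain rfl : j = 0 := by ext; simp; omega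
    obtain rfl : k = 2 := by ext; simp; have := k.2; simp at hjk; omega
    refine two _ ht.pow_ac fun h => ?_
    have h' := congrArg φ h
    rw [map_mul, map_one, h0, h2] at h'
    revert h'; decide
  · intro J K
    obtain ⟨δ, hr, hsr⟩ := isPresTriple_exists_dihedralHom ht
    refine le_antisymm ?_ (le_inf (Subgroup.closure_mono (Set.image_mono Set.inter_subset_left))
      (Subgroup.closure_mono (Set.image_mono Set.inter_subset_right)))
    rintro g ⟨hgJ, hgK⟩
    obtain ⟨i, j, d, hJ, rfl⟩ := exists_coordsMem hm hr hsr hgJ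
    obtain ⟨i', j', d', hK, h⟩ := exists_coordsMem hm hr hsr hgK
    obtain ⟨rfl, rfl, rfl⟩ := pres_ofCoords_injective hm he hr hsr h
    exact ofCoords_mem_closure hr hsr (hJ.inter hm hK)

theorem orderOf_presGen_zero_mul_one {m : ℕ} (hm : 5 ≤ m) (e : ℕ) :
    orderOf (presGen m e 0 * presGen m e 1) = 4 := by
  obtain ⟨φ, h0, h1, -⟩ := exists_pres_hom_dihedral hm e
  refine Nat.dvd_antisymm (orderOf_dvd_of_pow_eq_one (isPresTriple_presGen m e).pow_ab) ?_
  have h : orderOf (DihedralGroup.r 1 : DihedralGroup 4) = 4 := DihedralGroup.orderOf_r_one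
  have h' := orderOf_map_dvd φ (presGen m e 0 * presGen m e 1)
  rw [map_mul, h0, h1] at h'
  exact h ▸ h'

theorem isConnectedStringCGroup_presGen {m e : ℕ} (hm : 5 ≤ m) (he : e = 0 ∨ e = 1 ∧ 6 ≤ m) :
    IsConnectedStringCGroup (presGen m e) := by
  refine ⟨isStringCGroup_presGen hm he, fun j k hjk => .inr ?_⟩
  have : (j = 0 ∧ k = 1) ∨ (j = 1 ∧ k = 2) := by
    revert j k; decide
  rcases this with ⟨rfl, rfl⟩ | ⟨rfl, rfl⟩
  · rw [orderOf_presGen_zero_mul_one hm]; norm_num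
  · rw [orderOf_presGen_one_mul_two hm he]
    calc 2 < 2 ^ 2 := by norm_num
      _ ≤ 2 ^ (m - 3) := Nat.pow_le_pow_right (by norm_num) (by omega)

/-! ### The exponent of P_e(m) -/

theorem closure_normal_of_conj_mem {G ι : Type*} [Group G] {s : ι → G}
    (hs : Subgroup.closure (Set.range s) = ⊤) (hinv : ∀ i, s i * s i = 1) {T : Set G}
    (h : ∀ i, ∀ t ∈ T, s i * t * s i ∈ Subgroup.closure T) : (Subgroup.closure T).Normal := by
  have hconj : ∀ i, ∀ n ∈ Subgroup.closure T, s i * n * s i ∈ Subgroup.closure T := by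
    intro i n hn
    have hi : s i = (s i)⁻¹ := (inv_eq_of_mul_eq_one_left (hinv i)).symm
    have h1 : Subgroup.closure T ≤ (Subgroup.closure T).comap (MulAut.conj (s i)).toMonoidHom := by
      rw [Subgroup.closure_le]
      intro t ht
      simpa [← hi] using h i t ht
    simpa [← hi] using h1 hn
  refine ⟨fun n hn g => ?_⟩
  revert n
  induction g using generators_induction hs hinv with
  | one => intro n hn; simpa using hn
  | mul i g ih =>
    intro n hn
    have h1 := hconj i _ (ih n hn)
    rw [mul_inv_rev, inv_eq_of_mul_eq_one_left (hinv i)]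
    simpa only [mul_assoc] using h1

section Exponent

variable {G : Type*} [Group G] {m e : ℕ} {a b c : G}

theorem sq_mul_eq (a b : G) : (a * b) ^ 2 = a * (b * a * b) := by
  rw [sq]; simp only [mul_assoc]

theorem IsPresTriple.a_conj_x (h : IsPresTriple m e a b c) :
    a * (a * b) ^ 2 * a = (a * b) ^ 2 := by
  rw [sq_mul_eq, ← mul_assoc, h.mul_self_a, one_mul, ← h.commute_conj.eq]

theorem IsPresTriple.b_conj_x (h : IsPresTriple m e a b c) :
    b * (a * b) ^ 2 * b = (a * b) ^ 2 := by
  rw [sq_mul_eq]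
  calc b * (a * (b * a * b)) * b = (b * a * b) * a * (b * b) := by simp only [mul_assoc]
    _ = a * (b * a * b) := by rw [h.mul_self_b, mul_one, ← h.commute_conj.eq]

theorem IsPresTriple.c_conj_x (h : IsPresTriple m e a b c) (hm : 5 ≤ m) :
    c * (a * b) ^ 2 * c = (a * b) ^ 2 * (b * c) ^ (2 ^ (m - 4) * e) := by
  rw [sq_mul_eq]
  calc c * (a * (b * a * b)) * c = (c * a) * (b * a * b) * c := by simp only [mul_assoc]
    _ = a * (c * (b * a * b)) * c := by rw [← h.commute_ac.eq]; simp only [mul_assoc]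
    _ = a * (b * a * b) * (b * c) ^ (2 ^ (m - 4) * e) * (c * c) := by
      rw [h.c_mul_conj hm]; simp only [mul_assoc]
    _ = _ := by rw [h.mul_self_c, mul_one]

theorem IsPresTriple.a_conj_y (h : IsPresTriple m e a b c) (hm : 5 ≤ m) :
    a * (b * c) ^ 2 * a = (b * c) ^ (2 ^ (m - 4) * e) * (b * c) ^ 2 := by
  have h1 : a * (b * c * b) * a = (b * c) ^ (2 ^ (m - 4) * e) * (b * c * b) := by
    have h2 := h.sq_abcb hm
    have h3 : (b * c * b) * (b * c * b) = 1 := by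
      calc (b * c * b) * (b * c * b) = b * c * (b * b) * c * b := by simp only [mul_assoc]
        _ = b * (c * c) * b := by rw [h.mul_self_b]; simp only [mul_assoc, mul_one]
        _ = 1 := by rw [h.mul_self_c, mul_one, h.mul_self_b]
    calc a * (b * c * b) * a = a * (b * c * b) * a * ((b * c * b) * (b * c * b)) := by
          rw [h3, mul_one]
      _ = (a * b * c * b) ^ 2 * (b * c * b) := by rw [sq]; simp only [mul_assoc]
      _ = _ := by rw [h2]
  calc a * (b * c) ^ 2 * a = a * (b * c * b) * (c * a) := by rw [sq]; simp only [mul_assoc]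
    _ = a * (b * c * b) * a * c := by rw [← h.commute_ac.eq]; simp only [mul_assoc]
    _ = _ := by rw [h1, sq]; simp only [mul_assoc]

/-- Conjugation by `b` fixes x = (ab)² and conjugation by `c` multiplies it by z, so `b * c`
multiplies x by z and `(b * c) ^ 2` by z² = 1. -/
theorem IsPresTriple.commute_xy (h : IsPresTriple m e a b c) (hm : 5 ≤ m) :
    Commute ((b * c) ^ 2) ((a * b) ^ 2) := by
  set x := (a * b) ^ 2 with hx
  set z := (b * c) ^ (2 ^ (m - 4) * e) with hz
  have hbz : Commute b z := h.commute_bz hm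
  have hb : b * x = x * b := (commute_of_conj_eq h.mul_self_b h.b_conj_x).eq
  have hc : c * x = x * z * c := by
    rw [← h.c_conj_x hm, mul_assoc, h.mul_self_c, mul_one]
  have hcz : Commute c z := h.commute_cz hm
  have hbc : (b * c) * x = x * (z * (b * c)) := by
    calc (b * c) * x = b * (c * x) := by rw [mul_assoc]
      _ = (b * x) * z * c := by rw [hc]; simp only [mul_assoc]
      _ = x * (b * z) * c := by rw [hb]; simp only [mul_assoc]
      _ = _ := by rw [hbz.eq]; simp only [mul_assoc]
  change (b * c) ^ 2 * x = x * (b * c) ^ 2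
  calc (b * c) ^ 2 * x = (b * c) * (x * (z * (b * c))) := by rw [sq, mul_assoc, hbc]
    _ = ((b * c) * x) * (z * (b * c)) := (mul_assoc _ _ _).symm
    _ = x * (z * ((b * c) * z)) * (b * c) := by rw [hbc]; simp only [mul_assoc]
    _ = x * ((z * z) * (b * c)) * (b * c) := by
      rw [(hbz.mul_left hcz).eq]; simp only [mul_assoc]
    _ = x * (b * c) ^ 2 := by rw [h.mul_self_z hm, one_mul, sq, mul_assoc]

theorem zpow_pow_comm (g : G) (i : ℤ) (n : ℕ) : (g ^ i) ^ n = (g ^ n) ^ i := by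
  rw [← zpow_natCast, ← zpow_natCast, ← zpow_mul, ← zpow_mul, mul_comm]

theorem exists_zpow_mul_zpow_of_mem_closure {x y : G} (hxy : Commute x y) {g : G}
    (hg : g ∈ Subgroup.closure {x, y}) : ∃ i j : ℤ, g = x ^ i * y ^ j := by
  induction hg using Subgroup.closure_induction with
  | mem g hg =>
    rcases hg with rfl | rfl
    · exact ⟨1, 0, by simp⟩
    · exact ⟨0, 1, by simp⟩
  | one => exact ⟨0, 0, by simp⟩
  | mul g h _ _ hg hh =>
    obtain ⟨i, j, rfl⟩ := hg
    obtain ⟨k, l, rfl⟩ := hh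
    refine ⟨i + k, j + l, ?_⟩
    calc x ^ i * y ^ j * (x ^ k * y ^ l) = x ^ i * (y ^ j * x ^ k) * y ^ l := by
          simp only [mul_assoc]
      _ = x ^ i * (x ^ k * y ^ j) * y ^ l := by rw [(hxy.zpow_zpow k j).eq]
      _ = x ^ (i + k) * y ^ (j + l) := by simp only [zpow_add, mul_assoc]
  | inv g _ hg =>
    obtain ⟨i, j, rfl⟩ := hg
    exact ⟨-i, -j, by rw [mul_inv_rev, ← zpow_neg, ← zpow_neg, (hxy.zpow_zpow _ _).eq]⟩

/-- The subgroup A generated by x and y is abelian and normal. Modulo A the generators commute, so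
every square lies in A, and elements of A have order dividing 2^(m-4). -/
theorem IsPresTriple.pow_eq_one {s : Fin 3 → G} (hs : Subgroup.closure (Set.range s) = ⊤)
    (h : IsPresTriple m e (s 0) (s 1) (s 2)) (hm : 5 ≤ m) (g : G) : g ^ 2 ^ (m - 3) = 1 := by
  have hinv : ∀ i, s i * s i = 1 := fun i => by
    fin_cases i
    exacts [h.mul_self_a, h.mul_self_b, h.mul_self_c]
  set x := (s 0 * s 1) ^ 2 with hx
  set y := (s 1 * s 2) ^ 2 with hy
  set A := Subgroup.closure {x, y} with hA
  have hxA : x ∈ A := Subgroup.subset_closure (by simp)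
  have hyA : y ∈ A := Subgroup.subset_closure (by simp)
  have hzA : (s 1 * s 2) ^ (2 ^ (m - 4) * e) ∈ A := by
    rw [← two_pow_sub_five hm, mul_assoc, pow_mul]
    exact pow_mem hyA _
  have hy1 : s 1 * y * s 1 = y⁻¹ := by
    rw [hy, conj_pow_of_mul_self h.mul_self_b, ← inv_pow, h.inv_bc, ← mul_assoc, h.mul_self_b,
      one_mul]
  have hy2 : s 2 * y * s 2 = y⁻¹ := by
    rw [hy, conj_pow_of_mul_self h.mul_self_c, ← inv_pow, h.inv_bc, mul_assoc, mul_assoc,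
      h.mul_self_c, mul_one]
  have hn : A.Normal := by
    refine closure_normal_of_conj_mem hs hinv ?_
    intro i t ht
    rcases ht with rfl | rfl <;> fin_cases i
    · exact h.a_conj_x.symm ▸ hxA
    · exact h.b_conj_x.symm ▸ hxA
    · exact (h.c_conj_x hm).symm ▸ mul_mem hxA hzA
    · exact (h.a_conj_y hm).symm ▸ mul_mem hzA hyA
    · exact hy1.symm ▸ inv_mem hyA
    · exact hy2.symm ▸ inv_mem hyA
  let π := QuotientGroup.mk' A
  have hπinv : ∀ i, π (s i) * π (s i) = 1 := fun i => by rw [← map_mul, hinv, map_one]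
  have hcomm : ∀ u v : G, π u * π u = 1 → π v * π v = 1 → (u * v) ^ 2 ∈ A →
      π v * π u = π u * π v := by
    intro u v hu hv huv
    have h1 : π ((u * v) ^ 2) = 1 := (QuotientGroup.eq_one_iff _).2 huv
    rw [map_pow, map_mul, sq, mul_eq_one_iff_eq_inv, mul_inv_rev,
      inv_eq_of_mul_eq_one_left hu, inv_eq_of_mul_eq_one_left hv] at h1
    exact h1.symm
  have h10 := hcomm _ _ (hπinv 0) (hπinv 1) hxA
  have h21 := hcomm _ _ (hπinv 1) (hπinv 2) hyA
  have h20 : Commute (π (s 2)) (π (s 0)) := h.commute_ac.symm.map π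
  obtain ⟨i, j, k, l, hg⟩ := exists_pow_mul_pow hs hinv π (x := 1) (k := 0)
    (fun _ => Commute.one_right _) (by rw [mul_one]; exact h10) h20 (by simpa using h21) g
  have hg2 : g ^ 2 ∈ A := by
    have hp : ∀ i n, (π (s i) ^ n) ^ 2 = 1 := fun i n => by
      rw [← pow_mul, mul_comm, pow_mul, sq, hπinv, one_pow]
    have h10' : Commute (π (s 1)) (π (s 0)) := h10
    have h21' : Commute (π (s 2)) (π (s 1)) := h21
    refine (QuotientGroup.eq_one_iff _).1 ?_
    change π (g ^ 2) = 1
    rw [map_pow, hg, one_pow, mul_one,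
      (((h20.symm.pow_pow i k).mul_left (h21'.symm.pow_pow j k))).mul_pow,
      (h10'.symm.pow_pow i j).mul_pow, hp, hp, hp, one_mul, one_mul]
  obtain ⟨i, j, hij⟩ := exists_zpow_mul_zpow_of_mem_closure (h.commute_xy hm).symm hg2
  -- Already x² = 1, and `2 ^ (m - 4)` is even because `5 ≤ m`.
  have hxp : x ^ 2 ^ (m - 4) = 1 := by
    rw [← two_pow_sub_five hm, pow_mul, hx, ← pow_mul _ 2 2, h.pow_ab, one_pow]
  have hyp : y ^ 2 ^ (m - 4) = 1 := by
    rw [hy, ← pow_mul, two_pow_sub_four hm, h.pow_bc]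
  rw [← two_pow_sub_four hm, pow_mul, hij, ((h.commute_xy hm).symm.zpow_zpow i j).mul_pow, zpow_pow_comm x, zpow_pow_comm y, hxp,
    hyp, one_zpow, one_zpow, one_mul]

end Exponent

theorem exponent_pres {m e : ℕ} (hm : 5 ≤ m) (he : e = 0 ∨ e = 1 ∧ 6 ≤ m) :
    Monoid.exponent (Pres m e) = 2 ^ (m - 3) := by
  refine Nat.dvd_antisymm (Monoid.exponent_dvd_of_forall_pow_eq_one fun g =>
    (isPresTriple_presGen m e).pow_eq_one (closure_range_presGen m e) hm g) ?_
  rw [← orderOf_presGen_one_mul_two hm he]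
  exact Monoid.order_dvd_exponent _

/-! ### Semidirect product decompositions of P_e(m) -/

theorem exists_z2Hom {G : Type*} [Group G] {g : G} (hg : g * g = 1) :
    ∃ γ : Z2 →* G, γ (Multiplicative.ofAdd 1) = g := by
  refine ⟨MonoidHom.mk' (fun i => if i = 1 then 1 else g) fun i j => ?_, rfl⟩
  have h : ∀ i : Z2, i = 1 ∨ i = Multiplicative.ofAdd 1 := by decide
  have h1 : (Multiplicative.ofAdd 1 : Z2) ≠ 1 := by decide
  have h2 : (Multiplicative.ofAdd 1 * Multiplicative.ofAdd 1 : Z2) = 1 := by decide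
  rcases h i with rfl | rfl <;> rcases h j with rfl | rfl
  · simp
  · simp [h1]
  · simp [h1]
  · rw [h2, if_pos rfl, if_neg h1, hg]

theorem z2_eq_one_or (i : Z2) : i = 1 ∨ i = Multiplicative.ofAdd 1 := by
  revert i; decide

theorem natCard_z2 : Nat.card Z2 = 2 := by
  rw [Nat.card_eq_fintype_card]; rfl

/-- A group is a semidirect product of a subgroup of index two and the group generated by an
involution outside of it. -/
theorem exists_mulEquiv_semidirectProduct_z2 {A G : Type*} [Group A] [Group G] [Finite G]
    {α : A →* G} (hα : Function.Injective α) (hcard : Nat.card A * 2 = Nat.card G) {η : G →* ℤˣ}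
    (hη : ∀ a, η (α a) = 1) {g : G} (hg : g * g = 1) (hηg : η g = -1) :
    ∃ ψ : Z2 →* MulAut A, Nonempty (G ≃* A ⋊[ψ] Z2) := by
  obtain ⟨γ, hγ⟩ := exists_z2Hom hg
  have hrange : Nat.card α.range = Nat.card A := Nat.card_range_of_injective hα
  have hindex : α.range.index = 2 := by
    have h := α.range.card_mul_index
    rw [hrange, ← hcard] at h
    have hpos : 0 < Nat.card A := by
      rcases Nat.eq_zero_or_pos (Nat.card A) with h0 | h0
      · rw [h0, zero_mul] at hcard
        exact absurd hcard Nat.card_pos.ne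
      · exact h0
    exact Nat.eq_of_mul_eq_mul_left hpos h
  have hnormal : α.range.Normal := Subgroup.normal_of_index_eq_two hindex
  obtain ⟨ψ, φ, hφ, -⟩ := exists_semidirectProduct_hom (α := α) (β := γ) hα
    (fun b a => by
      obtain ⟨a', h⟩ := hnormal.conj_mem (α a) ⟨a, rfl⟩ (γ b)
      exact ⟨a', h.symm⟩)
    (fun a b h => by
      rcases z2_eq_one_or b with rfl | rfl
      · rfl
      · have h1 := congrArg η h
        rw [map_mul, hη, hγ, hηg, map_one] at h1
        exact absurd h1 (by decide))
  refine ⟨ψ, ⟨(MulEquiv.ofBijective φ ?_).symm⟩⟩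
  have := Finite.of_injective φ hφ
  exact (Nat.bijective_iff_injective_and_card φ).2 ⟨hφ, by
    rw [SemidirectProduct.card, natCard_z2, hcard]⟩

theorem commute_dihedralHom {G : Type*} [Group G] {n : ℕ} {u v : G} {δ : DihedralGroup n →* G}
    (hr : ∀ k : ℤ, δ (.r k) = u ^ k) (hsr : ∀ k : ℤ, δ (.sr k) = v * u ^ k) {g : G}
    (hu : Commute g u) (hv : Commute g v) (d : DihedralGroup n) : Commute g (δ d) := by
  rcases d with i | i
  · obtain ⟨k, rfl⟩ := ZMod.intCast_surjective i
    exact hr k ▸ hu.zpow_right k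
  · obtain ⟨k, rfl⟩ := ZMod.intCast_surjective i
    exact hsr k ▸ hv.mul_right (hu.zpow_right k)

theorem map_dihedralHom_eq_one {G H : Type*} [Group G] [Group H] {n : ℕ} {u v : G}
    {δ : DihedralGroup n →* G} (hr : ∀ k : ℤ, δ (.r k) = u ^ k)
    (hsr : ∀ k : ℤ, δ (.sr k) = v * u ^ k) {φ : G →* H} (hu : φ u = 1) (hv : φ v = 1)
    (d : DihedralGroup n) : φ (δ d) = 1 := by
  rcases d with i | i
  · obtain ⟨k, rfl⟩ := ZMod.intCast_surjective i
    rw [hr, map_zpow, hu, one_zpow]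
  · obtain ⟨k, rfl⟩ := ZMod.intCast_surjective i
    rw [hsr, map_mul, map_zpow, hu, hv, one_zpow, one_mul]

theorem closure_eq_range_dihedralHom {G : Type*} [Group G] {n : ℕ} {u v : G}
    {δ : DihedralGroup n →* G} (hr : ∀ k : ℤ, δ (.r k) = u ^ k)
    (hsr : ∀ k : ℤ, δ (.sr k) = v * u ^ k) : Subgroup.closure {u, v} = δ.range := by
  apply le_antisymm
  · rw [Subgroup.closure_le]
    rintro g (rfl | rfl)
    · exact ⟨_, (hr 1).trans (zpow_one _)⟩
    · exact ⟨_, (hsr 0).trans (by simp)⟩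
  · have hu : u ∈ Subgroup.closure {u, v} := Subgroup.subset_closure (by simp)
    have hv : v ∈ Subgroup.closure {u, v} := Subgroup.subset_closure (by simp)
    rintro _ ⟨i | i, rfl⟩
    · obtain ⟨k, rfl⟩ := ZMod.intCast_surjective i
      exact hr k ▸ zpow_mem hu k
    · obtain ⟨k, rfl⟩ := ZMod.intCast_surjective i
      exact hsr k ▸ mul_mem hv (zpow_mem hu k)

theorem finite_pres {m e : ℕ} (hm : 5 ≤ m) (he : e = 0 ∨ e = 1 ∧ 6 ≤ m) : Finite (Pres m e) :=
  Nat.finite_of_card_ne_zero (natCard_pres hm he ▸ by positivity)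

/-- The dihedral subgroups of `Pres m e` of orders `2 ^ (m - 3)` and `4`. -/
theorem exists_pres_dihedralHoms {m e : ℕ} (hm : 5 ≤ m) (he : e = 0 ∨ e = 1 ∧ 6 ≤ m) :
    ∃ (α : DihedralGroup (2 ^ (m - 4)) →* Pres m e) (β : DihedralGroup 2 →* Pres m e),
      Function.Injective α ∧ α.range.Normal ∧ (∀ d d', α d * β d' = 1 → d' = 1) ∧
      (∃ η : Pres m e →* ℤˣ, (∀ d, η (α d) = 1) ∧ (∀ d, η (β d) = 1) ∧
        η (presGen m e 1) = -1) ∧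
      (e = 0 → ∀ d d', Commute (α d) (β d')) := by
  have ht := isPresTriple_presGen m e
  have := finite_pres hm he
  obtain ⟨φ, h0, h1, h2⟩ := exists_pres_hom_dihedral hm e
  obtain ⟨ε, hε⟩ := exists_pres_hom_units m e
  obtain ⟨η, η0, η1, η2⟩ := exists_pres_hom_second hm e
  set a := presGen m e 0
  set b := presGen m e 1
  set c := presGen m e 2
  -- The involutions bcb and c generate the normal dihedral factor, with rotation (bc)²; the
  -- involutions a and bab generate the four-group. The remaining involution b is detected by `η`.
  have hy : (b * c * b) * c = (b * c) ^ 2 := by rw [sq]; simp only [mul_assoc]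
  have hyo : orderOf ((b * c * b) * c) = 2 ^ (m - 4) := by
    have h := orderOf_presGen_one_mul_two hm he
    rw [hy, orderOf_pow, h, ← two_pow_sub_four hm, Nat.gcd_eq_right (dvd_mul_right _ _),
      Nat.mul_div_cancel_left _ two_pos]
  have hu : (b * c * b) * (b * c * b) = 1 := by
    calc (b * c * b) * (b * c * b) = b * c * (b * b) * c * b := by simp only [mul_assoc]
      _ = b * (c * c) * b := by rw [ht.mul_self_b]; simp only [mul_assoc, mul_one]
      _ = 1 := by rw [ht.mul_self_c, mul_one, ht.mul_self_b]
  obtain ⟨α, hα, hαr, hαsr⟩ := exists_dihedralHom_of_involutions hu ht.mul_self_c hyo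
    (fun k h => by
      have := congrArg ε h
      simp [hε, b, c] at this)
  have hx : a * (b * a * b) = (a * b) ^ 2 := (sq_mul_eq a b).symm
  have hxo : orderOf (a * (b * a * b)) = 2 := by
    rw [hx, orderOf_pow, orderOf_presGen_zero_mul_one hm]
    rfl
  obtain ⟨β, -, hβr, hβsr⟩ := exists_dihedralHom_of_involutions ht.mul_self_a
    ht.mul_self_conj hxo (fun k h => by
      have := congrArg ε h
      simp [hε, a, b] at this)
  rw [hy] at hαr hαsr
  have hφα := map_dihedralHom_eq_one hαr hαsr (φ := φ)
    (by rw [map_pow, map_mul, h1, h2]; decide) h2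
  -- The quotient of order eight kills the image of `α` and is faithful on the four-group, so the
  -- two subgroups meet trivially.
  have hφβ : ∀ d, φ (β d) = 1 → d = 1 := by
    rintro (i | i) h
    · fin_cases i
      · rfl
      · have h' : φ (β (.r ((1 : ℤ) : ZMod 2))) = 1 := by
          push_cast
          exact h
        rw [hβr, zpow_one] at h'
        simp only [map_mul, h0, h1] at h'
        exact absurd h' (by decide)
    · fin_cases i
      · have h' : φ (β (.sr ((0 : ℤ) : ZMod 2))) = 1 := by
          push_cast
          exact h
        rw [hβsr, zpow_zero, mul_one] at h'
        simp only [map_mul, h0, h1] at h'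
        exact absurd h' (by decide)
      · have h' : φ (β (.sr ((1 : ℤ) : ZMod 2))) = 1 := by
          push_cast
          exact h
        rw [hβsr, zpow_one] at h'
        simp only [map_mul, h0, h1] at h'
        exact absurd h' (by decide)
  have hinv : ∀ i, presGen m e i * presGen m e i = 1 := fun i => by
    fin_cases i
    exacts [ht.mul_self_a, ht.mul_self_b, ht.mul_self_c]
  refine ⟨α, β, hα, ?_, fun d d' h => hφβ d' ?_, ⟨η, ?_, ?_, η1⟩, ?_⟩
  · rw [← closure_eq_range_dihedralHom hαr hαsr]
    set A := Subgroup.closure {(b * c) ^ 2, c}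
    have hyA : (b * c) ^ 2 ∈ A := Subgroup.subset_closure (by simp)
    have hcA : c ∈ A := Subgroup.subset_closure (by simp)
    refine closure_normal_of_conj_mem (closure_range_presGen m e) hinv ?_
    rintro i g (rfl | rfl) <;> fin_cases i
    · refine (ht.a_conj_y hm).symm ▸ mul_mem ?_ hyA
      rw [← two_pow_sub_five hm, mul_assoc, pow_mul]
      exact pow_mem hyA _
    · change b * (b * c) ^ 2 * b ∈ A
      rw [conj_pow_of_mul_self ht.mul_self_b, ← mul_assoc, ht.mul_self_b, one_mul, ← ht.inv_bc,
        inv_pow]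
      exact inv_mem hyA
    · exact mul_mem (mul_mem hcA hyA) hcA
    · change a * c * a ∈ A
      rw [ht.commute_ac.eq, mul_assoc, ht.mul_self_a, mul_one]
      exact hcA
    · change b * c * b ∈ A
      have : b * c * b = (b * c) ^ 2 * c := by
        rw [← hy, mul_assoc (b * c * b), ht.mul_self_c, mul_one]
      rw [this]
      exact mul_mem hyA hcA
    · exact mul_mem (mul_mem hcA hcA) hcA
  · have := congrArg φ h
    rwa [map_mul, hφα, one_mul, map_one] at this
  · exact map_dihedralHom_eq_one hαr hαsr (by rw [map_pow, map_mul, η1, η2]; decide) η2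
  · exact map_dihedralHom_eq_one hβr hβsr (by simp only [map_mul, η0, η1]; decide)
      (by simp only [map_mul, η0, η1]; decide)
  -- For e = 0 the element z is trivial, so a and bab commute with both c and (bc)².
  · rintro rfl d d'
    have hac := ht.commute_ac
    have htc : Commute (b * a * b) c := by
      have := ht.c_mul_conj hm
      rw [mul_zero, pow_zero, one_mul] at this
      exact this.symm
    have hay : Commute a ((b * c) ^ 2) := by
      have := ht.a_conj_y hm
      rw [mul_zero, pow_zero, one_mul] at this
      exact commute_of_conj_eq ht.mul_self_a this
    have hxy : Commute (a * (b * a * b)) ((b * c) ^ 2) := hx ▸ (ht.commute_xy hm).symm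
    have hty : Commute (b * a * b) ((b * c) ^ 2) := by
      have := hay.mul_left hxy
      rwa [← mul_assoc, ht.mul_self_a, one_mul] at this
    exact (commute_dihedralHom hβr hβsr
      (commute_dihedralHom hαr hαsr hxy (hac.mul_left htc) d).symm
      (commute_dihedralHom hαr hαsr hty htc d).symm d')

theorem natCard_dihedral_mul {m : ℕ} (hm : 5 ≤ m) :
    Nat.card (DihedralGroup (2 ^ (m - 4))) * Nat.card (DihedralGroup 2) * 2 = 2 ^ m := by
  rw [DihedralGroup.nat_card, DihedralGroup.nat_card]
  have : 2 ^ m = 2 ^ (m - 4) * 2 ^ 4 := by rw [← pow_add]; congr 1; omega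
  rw [this]; ring

theorem pres_mulEquiv_prod_semidirectProduct {m : ℕ} (hm : 5 ≤ m) :
    ∃ ψ : Z2 →* MulAut (DihedralGroup (2 ^ (m - 4)) × DihedralGroup 2),
      Nonempty (Pres m 0 ≃* (DihedralGroup (2 ^ (m - 4)) × DihedralGroup 2) ⋊[ψ] Z2) := by
  obtain ⟨α, β, hα, -, hdisj, ⟨η, ηα, ηβ, ηb⟩, hcomm⟩ := exists_pres_dihedralHoms hm (.inl rfl)
  have hcard := natCard_pres hm (.inl rfl)
  have := finite_pres hm (.inl rfl)
  refine exists_mulEquiv_semidirectProduct_z2 (α := α.noncommCoprod β (hcomm rfl)) ?_ ?_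
    (η := η) ?_ (isPresTriple_presGen m 0).mul_self_b ηb
  · rw [injective_iff_map_eq_one]
    rintro ⟨d, d'⟩ h
    change α d * β d' = 1 at h
    obtain rfl := hdisj d d' h
    rw [map_one, mul_one] at h
    obtain rfl : d = 1 := hα (by rw [h, map_one])
    rfl
  · rw [Nat.card_prod, natCard_dihedral_mul hm, hcard]
  · rintro ⟨d, d'⟩
    change η (α d * β d') = 1
    rw [map_mul, ηα, ηβ, one_mul]

theorem pres_mulEquiv_semidirectProduct_semidirectProduct {m e : ℕ} (hm : 5 ≤ m)
    (he : e = 0 ∨ e = 1 ∧ 6 ≤ m) :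
    ∃ (χ : DihedralGroup 2 →* MulAut (DihedralGroup (2 ^ (m - 4))))
      (ψ : Z2 →* MulAut (DihedralGroup (2 ^ (m - 4)) ⋊[χ] DihedralGroup 2)),
      Nonempty (Pres m e ≃* (DihedralGroup (2 ^ (m - 4)) ⋊[χ] DihedralGroup 2) ⋊[ψ] Z2) := by
  obtain ⟨α, β, hα, hn, hdisj, ⟨η, ηα, ηβ, ηb⟩, -⟩ := exists_pres_dihedralHoms hm he
  have hcard := natCard_pres hm he
  have := finite_pres hm he
  obtain ⟨χ, φ, hφ, hφ'⟩ := exists_semidirectProduct_hom (α := α) (β := β) hα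
    (fun b a => by
      obtain ⟨a', h⟩ := hn.conj_mem (α a) ⟨a, rfl⟩ (β b)
      exact ⟨a', h.symm⟩) hdisj
  refine ⟨χ, exists_mulEquiv_semidirectProduct_z2 hφ ?_ (η := η) ?_
    (isPresTriple_presGen m e).mul_self_b ηb⟩
  · rw [SemidirectProduct.card, natCard_dihedral_mul hm, hcard]
  · rintro ⟨d, d'⟩
    rw [hφ', map_mul, ηα, ηβ, one_mul]

/-! ### String Coxeter groups of rank three -/

theorem exists_coxeter_hom {B G : Type*} [Group G] (M : CoxeterMatrix B) {t : B → G}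
    (ht : ∀ i j, (t i * t j) ^ M i j = 1) : ∃ φ : M.Group →* G, ∀ i, φ (M.simple i) = t i := by
  let cs := M.toCoxeterSystem
  exact ⟨cs.lift ⟨t, ht⟩, fun i => cs.lift_apply_simple ht i⟩

theorem forall_pow_coxeter {G : Type*} [Group G] {p q : ℕ} {hp : p ≠ 1} {hq : q ≠ 1}
    {t : Fin 3 → G} (hinv : ∀ i, t i * t i = 1) (h01 : (t 0 * t 1) ^ p = 1)
    (h02 : (t 0 * t 2) ^ 2 = 1) (h12 : (t 1 * t 2) ^ q = 1) (i j : Fin 3) :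
    (t i * t j) ^ stringCoxeterMatrix p q hp hq i j = 1 := by
  have hswap : ∀ u v : G, u * u = 1 → v * v = 1 → ∀ n, (u * v) ^ n = 1 → (v * u) ^ n = 1 := by
    intro u v hu hv n h
    have h1 : v * u = (u * v)⁻¹ := by
      rw [mul_inv_rev, inv_eq_of_mul_eq_one_left hu, inv_eq_of_mul_eq_one_left hv]
    rw [h1, inv_pow, h, inv_one]
  fin_cases i <;> fin_cases j
  · exact (pow_one _).trans (hinv 0)
  · exact h01
  · exact h02
  · exact hswap _ _ (hinv 0) (hinv 1) _ h01
  · exact (pow_one _).trans (hinv 1)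
  · exact h12
  · exact hswap _ _ (hinv 0) (hinv 2) _ h02
  · exact hswap _ _ (hinv 1) (hinv 2) _ h12
  · exact (pow_one _).trans (hinv 2)

/-- The Coxeter group `[4, q]` is infinite if `q` is a multiple of four. -/
theorem infinite_stringCoxeterGroup {q : ℕ} {hp : 4 ≠ 1} {hq : q ≠ 1} (h : 4 ∣ q) :
    Infinite (stringCoxeterMatrix 4 q hp hq).Group := by
  -- These are the reflections generating the symmetry group [4,4] of the square tessellation, a
  -- quotient of [4,q] when 4 divides q. Here a·(bcb) is a translation by one unit, so it has
  -- infinite order.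
  let a : Equiv.Perm (ℤ × ℤ) := Function.Involutive.toPerm (fun p => (1 - p.1, p.2))
    fun p => by simp
  let b : Equiv.Perm (ℤ × ℤ) := Function.Involutive.toPerm (fun p => (p.2, p.1)) fun p => rfl
  let c : Equiv.Perm (ℤ × ℤ) := Function.Involutive.toPerm (fun p => (p.1, -p.2)) fun p => by simp
  have ha : ∀ p, a p = (1 - p.1, p.2) := fun _ => rfl
  have hb : ∀ p, b p = (p.2, p.1) := fun _ => rfl
  have hc : ∀ p, c p = (p.1, -p.2) := fun _ => rfl
  obtain ⟨φ, hφ⟩ := exists_coxeter_hom (stringCoxeterMatrix 4 q hp hq) (t := ![a, b, c]) (by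
    refine forall_pow_coxeter (fun i => ?_) ?_ ?_ ?_
    · fin_cases i
      · ext p <;> simp [ha]
      · ext p <;> simp [hb]
      · ext p <;> simp [hc]
    · change (a * b) ^ 4 = 1
      ext p <;> simp [pow_succ, ha, hb]
    · change (a * c) ^ 2 = 1
      ext p <;> simp [pow_succ, ha, hc]
    · change (b * c) ^ q = 1
      obtain ⟨k, rfl⟩ := h
      have h4 : (b * c) ^ 4 = 1 := by
        ext p <;> simp [pow_succ, hb, hc]
      rw [pow_mul, h4, one_pow])
  have key : ∀ n : ℕ, ((a * (b * c * b)) ^ n) (0, 0) = ((n : ℤ), 0) := by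
    intro n
    induction n with
    | zero => simp
    | succ n ih =>
      rw [pow_succ', Equiv.Perm.mul_apply, ih]
      simp [ha, hb, hc, add_comm]
  let M := stringCoxeterMatrix 4 q hp hq
  refine Infinite.of_injective
    (fun n : ℕ => (M.simple 0 * (M.simple 1 * M.simple 2 * M.simple 1)) ^ n) fun i j hij => ?_
  have h1 := congrArg (fun g => φ g (0, 0)) hij
  have h2 : φ (M.simple 0 * (M.simple 1 * M.simple 2 * M.simple 1)) = a * (b * c * b) := by
    simp only [map_mul, M, hφ]; rfl
  simp only [map_pow, h2, key] at h1
  simpa using h1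

theorem isSmoothQuotient_of_orderOf {G : Type u} [Group G] {p q : ℕ} {hp : p ≠ 1} {hq : q ≠ 1}
    {t : Fin 3 → G} (ht : Subgroup.closure (Set.range t) = ⊤) (hinv : ∀ i, t i * t i = 1)
    (h01 : orderOf (t 0 * t 1) = p) (h02 : orderOf (t 0 * t 2) = 2)
    (h12 : orderOf (t 1 * t 2) = q) : IsSmoothQuotient (stringCoxeterMatrix p q hp hq) t := by
  have hswap : ∀ i j, orderOf (t i * t j) = orderOf (t j * t i) := fun i j => by
    rw [← orderOf_inv, mul_inv_rev, inv_eq_of_mul_eq_one_left (hinv i),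
      inv_eq_of_mul_eq_one_left (hinv j)]
  have hord : ∀ i j, orderOf (t i * t j) = stringCoxeterMatrix p q hp hq i j := by
    intro i j
    fin_cases i <;> fin_cases j
    · exact (congrArg orderOf (hinv 0)).trans orderOf_one
    · exact h01
    · exact h02
    · exact (hswap _ _).trans h01
    · exact (congrArg orderOf (hinv 1)).trans orderOf_one
    · exact h12
    · exact (hswap _ _).trans h02
    · exact (hswap _ _).trans h12
    · exact (congrArg orderOf (hinv 2)).trans orderOf_one
  refine ⟨hord, ?_⟩
  obtain ⟨φ, hφ⟩ := exists_coxeter_hom (stringCoxeterMatrix p q hp hq) (t := t) fun i j => by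
    rw [← hord]; exact pow_orderOf_eq_one _
  refine ⟨φ, ?_, hφ⟩
  rw [← MonoidHom.range_eq_top, eq_top_iff, ← ht, Subgroup.closure_le]
  rintro _ ⟨i, rfl⟩
  exact ⟨_, hφ i⟩

/-! ### Involutions of cyclic 2-groups and the parity map -/

theorem commute_iff_sq_eq_one {G : Type*} [Group G] {u v : G} (hu : u * u = 1) (hv : v * v = 1) :
    Commute u v ↔ (u * v) ^ 2 = 1 := by
  rw [sq, mul_eq_one_iff_eq_inv, mul_inv_rev, inv_eq_of_mul_eq_one_left hu,
    inv_eq_of_mul_eq_one_left hv]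
  rfl

/-- A nontrivial cyclic 2-group has only one involution; this uniqueness drives the whole
classification. -/
theorem eq_one_or_eq_of_sq_eq_one {G : Type*} [Group G] {d w : G} {r : ℕ}
    (hd : orderOf d = 2 ^ (r + 1)) (hw : w ∈ Subgroup.zpowers d) (hw2 : w ^ 2 = 1) :
    w = 1 ∨ w = d ^ 2 ^ r := by
  obtain ⟨i, rfl⟩ := hw
  change (d ^ i) ^ 2 = 1 at hw2
  change d ^ i = 1 ∨ d ^ i = _
  rw [← zpow_natCast, ← zpow_mul, ← orderOf_dvd_iff_zpow_eq_one, hd] at hw2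
  obtain ⟨t, ht⟩ := hw2
  have hi : i = 2 ^ r * t := by
    push_cast at ht
    rw [pow_succ] at ht
    linarith
  have hu : (d ^ 2 ^ r) ^ (2 : ℤ) = 1 := by
    have := pow_orderOf_eq_one d
    rw [hd, pow_succ, pow_mul] at this
    exact_mod_cast this
  have hdi : d ^ i = (d ^ 2 ^ r) ^ t := by
    rw [hi, zpow_mul]
    norm_cast
  obtain ⟨k, rfl | rfl⟩ := Int.even_or_odd' t
  · left
    rw [hdi, zpow_mul, hu, one_zpow]
  · right
    rw [hdi, zpow_add, zpow_mul, hu, one_zpow, one_mul, zpow_one]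

theorem exists_sq_eq_one_of_ne_one {G : Type*} [Group G] (hG : IsPGroup 2 G) {x : G}
    (hx : x ≠ 1) : ∃ w ∈ Subgroup.zpowers x, w ^ 2 = 1 ∧ w ≠ 1 := by
  obtain ⟨k, hk⟩ := IsPGroup.iff_orderOf.1 hG x
  cases k with
  | zero => exact absurd (orderOf_eq_one_iff.1 hk) hx
  | succ k =>
    refine ⟨x ^ 2 ^ k, pow_mem (Subgroup.mem_zpowers x) _, ?_, ?_⟩
    · rw [← pow_mul, ← pow_succ, ← hk, pow_orderOf_eq_one]
    · refine pow_ne_one_of_lt_orderOf (by positivity) ?_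
      rw [hk]
      exact Nat.pow_lt_pow_right one_lt_two (Nat.lt_succ_self k)

/-- Two nontrivial elements of a cyclic `2`-group have a common power different from one. -/
theorem exists_common_involution {G : Type*} [Group G] (hG : IsPGroup 2 G) {d x y : G}
    (hx : x ∈ Subgroup.zpowers d) (hy : y ∈ Subgroup.zpowers d) (hx1 : x ≠ 1) (hy1 : y ≠ 1) :
    ∃ w ∈ Subgroup.zpowers x, w ∈ Subgroup.zpowers y ∧ w ≠ 1 := by
  obtain ⟨v, hv, hv2, hv1⟩ := exists_sq_eq_one_of_ne_one hG hx1
  obtain ⟨w, hw, hw2, hw1⟩ := exists_sq_eq_one_of_ne_one hG hy1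
  obtain ⟨k, hk⟩ := IsPGroup.iff_orderOf.1 hG d
  cases k with
  | zero =>
    obtain rfl : d = 1 := orderOf_eq_one_iff.1 hk
    simp at hx
    exact absurd hx hx1
  | succ k =>
    have h1 := (eq_one_or_eq_of_sq_eq_one hk (Subgroup.zpowers_le.2 hx hv) hv2).resolve_left hv1
    have h2 := (eq_one_or_eq_of_sq_eq_one hk (Subgroup.zpowers_le.2 hy hw) hw2).resolve_left hw1
    exact ⟨v, hv, by rwa [h1, ← h2], hv1⟩

/-- In a 2-group a proper subgroup `H` lies in a subgroup of index two. As `g` and `H` generate the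
group, that subgroup cannot contain `g`, and its index-two character separates them. -/
theorem exists_parity_of_notMem {G : Type*} [Group G] {m : ℕ} (hG : Nat.card G = 2 ^ m)
    {H : Subgroup G} {g : G} (hg : Subgroup.closure (insert g H) = ⊤) (hgH : g ∉ H) :
    ∃ ε : G →* ℤˣ, ε g = -1 ∧ ∀ h ∈ H, ε h = 1 := by
  have : Finite G := Nat.finite_of_card_ne_zero (hG ▸ by positivity)
  have : Fact (Nat.Prime 2) := ⟨Nat.prime_two⟩
  obtain ⟨k, hkm, hk⟩ := (Nat.dvd_prime_pow Nat.prime_two).1 (hG ▸ H.card_subgroup_dvd_card)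
  have hkm' : k + 1 ≤ m := by
    rcases hkm.lt_or_eq with h | rfl
    · exact h
    · have : H = ⊤ := Subgroup.eq_top_of_card_eq H (hk.trans hG.symm)
      exact absurd (this ▸ Subgroup.mem_top g) hgH
  obtain ⟨M, hM, hHM⟩ := Sylow.exists_subgroup_card_pow_prime_le 2 (m := m - 1)
    (hG ▸ pow_dvd_pow 2 (Nat.sub_le m 1)) H hk (by omega)
  have hindex : M.index = 2 := by
    have h := M.card_mul_index
    rw [hM, hG, show 2 ^ m = 2 ^ (m - 1) * 2 by rw [← pow_succ]; congr 1; omega] at h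
    exact Nat.eq_of_mul_eq_mul_left (by positivity) h
  have hgM : g ∉ M := by
    intro h
    have : M = ⊤ := by
      rw [eq_top_iff, ← hg, Subgroup.closure_le]
      rintro x (rfl | hx)
      exacts [h, hHM hx]
    rw [this, Subgroup.index_top] at hindex
    exact absurd hindex (by norm_num)
  classical
  refine ⟨MonoidHom.mk' (fun x => if x ∈ M then 1 else -1) fun x y => ?_, if_neg hgM,
    fun h hh => if_pos (hHM hh)⟩
  have := Subgroup.mul_mem_iff_of_index_two hindex (a := x) (b := y)
  by_cases hx : x ∈ M <;> by_cases hy : y ∈ M <;> simp [this, hx, hy]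

section StringCGroup

variable {G : Type u} [Group G] {m n k : ℕ} {s : Fin n → G}

theorem IsStringCGroup.sq_eq_one (hs : IsStringCGroup s) (i : Fin n) : s i ^ 2 = 1 := by
  rw [← hs.involution i, pow_orderOf_eq_one]

theorem IsStringCGroup.mul_self (hs : IsStringCGroup s) (i : Fin n) : s i * s i = 1 := by
  rw [← sq, hs.sq_eq_one]

theorem IsStringCGroup.ne_one (hs : IsStringCGroup s) (i : Fin n) : s i ≠ 1 := fun h => by
  have := hs.involution i
  rw [h, orderOf_one] at this
  exact absurd this (by norm_num)

theorem IsStringCGroup.commute (hs : IsStringCGroup s) {i j : Fin n} (hij : (i : ℕ) + 2 ≤ j) :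
    Commute (s i) (s j) :=
  (commute_iff_sq_eq_one (hs.mul_self i) (hs.mul_self j)).2 (by
    rw [← hs.string i j hij, pow_orderOf_eq_one])

/-- The intersection condition for `{i}` and its complement shows that `s i` is not generated by the
other generators. The resulting characters, one for each i, are the coordinates of `E`. -/
theorem IsStringCGroup.exists_parity (hs : IsStringCGroup s) (hG : Nat.card G = 2 ^ m) :
    ∃ E : G →* (Fin n → ℤˣ), Function.Surjective E ∧ ∀ i, E (s i) = Pi.mulSingle i (-1) := by
  have h : ∀ i, ∃ ε : G →* ℤˣ, ε (s i) = -1 ∧ ∀ j, j ≠ i → ε (s j) = 1 := by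
    intro i
    obtain ⟨ε, h1, h2⟩ := exists_parity_of_notMem hG (H := Subgroup.closure (s '' {i}ᶜ))
      (g := s i) (by
        rw [eq_top_iff, ← hs.generate, Subgroup.closure_le]
        rintro _ ⟨j, rfl⟩
        refine Subgroup.subset_closure ?_
        rcases eq_or_ne j i with rfl | hj
        · exact Set.mem_insert _ _
        · exact Set.mem_insert_of_mem _ (Subgroup.subset_closure ⟨j, hj, rfl⟩)) (fun h => by
        have h1 : s i ∈ Subgroup.closure (s '' {i}) ⊓ Subgroup.closure (s '' {i}ᶜ) :=
          ⟨Subgroup.subset_closure ⟨i, rfl, rfl⟩, h⟩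
        rw [hs.intersection, Set.inter_compl_self, Set.image_empty, Subgroup.closure_empty] at h1
        exact hs.ne_one i h1)
    exact ⟨ε, h1, fun j hj => h2 _ (Subgroup.subset_closure ⟨j, hj, rfl⟩)⟩
  choose ε h1 h2 using h
  have hE : ∀ i, MonoidHom.pi ε (s i) = Pi.mulSingle i (-1) := by
    intro i
    ext1 j
    rw [MonoidHom.pi_apply]
    rcases eq_or_ne j i with rfl | hj
    · rw [h1, Pi.mulSingle_eq_same]
    · rw [h2 j i hj.symm, Pi.mulSingle_eq_of_ne hj]
  refine ⟨MonoidHom.pi ε, ?_, hE⟩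
  rw [← MonoidHom.range_eq_top, eq_top_iff]
  intro v _
  refine Subgroup.pi_mem_of_mulSingle_mem v fun i => ?_
  rcases Int.units_eq_one_or (v i) with h | h
  · rw [h, Pi.mulSingle_one]
    exact one_mem _
  · rw [h]
    exact ⟨s i, hE i⟩

theorem sq_mem_ker (E : G →* (Fin n → ℤˣ)) (g : G) : g ^ 2 ∈ E.ker := by
  rw [MonoidHom.mem_ker, map_pow]
  ext1 i
  exact Int.units_sq _

theorem natCard_ker_mul {E : G →* (Fin n → ℤˣ)} (hE : Function.Surjective E) :
    Nat.card E.ker * 2 ^ n = Nat.card G := by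
  rw [← E.ker.card_mul_index, Subgroup.index_ker, MonoidHom.range_eq_top.2 hE, Subgroup.card_top,
    Nat.card_fun]
  simp

theorem exists_orderOf_eq_exponent (hexp : Monoid.exponent G = 2 ^ k) :
    ∃ c : G, orderOf c = 2 ^ k := by
  obtain ⟨c, hc⟩ := Nat.Prime.exists_orderOf_eq_pow_factorization_exponent G Nat.prime_two
  refine ⟨c, hc.trans ?_⟩
  rw [hexp, Nat.prime_two.factorization_pow, Finsupp.single_eq_same]

theorem orderOf_sq_of_orderOf {c : G} (hc : orderOf c = 2 ^ (k + 1)) :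
    orderOf (c ^ 2) = 2 ^ k := by
  rw [orderOf_pow' c two_ne_zero, hc, pow_succ, Nat.gcd_eq_right (dvd_mul_left _ _),
    Nat.mul_div_cancel _ two_pos]

/-- The rank of a string C-group of order `2 ^ m` and exponent `2 ^ (k + 1)` is at most `m - k`. -/
theorem add_rank_le {E : G →* (Fin n → ℤˣ)} (hE : Function.Surjective E)
    (hG : Nat.card G = 2 ^ m) (hexp : Monoid.exponent G = 2 ^ (k + 1)) : k + n ≤ m := by
  obtain ⟨c, hc⟩ := exists_orderOf_eq_exponent hexp
  have h : 2 ^ k ∣ Nat.card E.ker := by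
    rw [← orderOf_sq_of_orderOf hc, ← Nat.card_zpowers]
    exact Subgroup.card_dvd_of_le (Subgroup.zpowers_le.2 (sq_mem_ker E c))
  have h' := mul_dvd_mul_right h (2 ^ n)
  rw [natCard_ker_mul hE, hG, ← pow_add] at h'
  exact (Nat.pow_dvd_pow_iff_le_right (by norm_num)).1 h'

theorem exists_ker_eq_zpowers {E : G →* (Fin n → ℤˣ)} (hE : Function.Surjective E)
    (hG : Nat.card G = 2 ^ m) (hexp : Monoid.exponent G = 2 ^ (k + 1)) (hm : k + n = m) :
    ∃ d, E.ker = Subgroup.zpowers d := by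
  have : Finite G := Nat.finite_of_card_ne_zero (hG ▸ by positivity)
  obtain ⟨c, hc⟩ := exists_orderOf_eq_exponent hexp
  refine ⟨c ^ 2, (Subgroup.eq_of_le_of_card_ge (Subgroup.zpowers_le.2 (sq_mem_ker E c)) ?_).symm⟩
  have h := natCard_ker_mul hE
  rw [hG, ← hm, pow_add] at h
  rw [Nat.eq_of_mul_eq_mul_right (by positivity) h, Nat.card_zpowers, orderOf_sq_of_orderOf hc]

/-- The intersection condition leaves only the powers of `s i`, and `s i` itself has nontrivial
parity. -/
theorem IsStringCGroup.eq_one_of_mem_ker (hs : IsStringCGroup s) {E : G →* (Fin n → ℤˣ)}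
    (hE : ∀ i, E (s i) = Pi.mulSingle i (-1)) {J K : Set (Fin n)} {i : Fin n} (hJK : J ∩ K ⊆ {i})
    {w : G} (hw : w ∈ E.ker) (hJ : w ∈ Subgroup.closure (s '' J))
    (hK : w ∈ Subgroup.closure (s '' K)) : w = 1 := by
  have h1 : w ∈ Subgroup.closure (s '' (J ∩ K)) := hs.intersection J K ▸ ⟨hJ, hK⟩
  have h2 : w ∈ Subgroup.zpowers (s i) := by
    rw [Subgroup.zpowers_eq_closure, ← Set.image_singleton]
    exact Subgroup.closure_mono (Set.image_mono hJK) h1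
  obtain ⟨t, rfl⟩ := h2
  change s i ^ t = 1
  have hsq : s i ^ (2 : ℤ) = 1 := by exact_mod_cast hs.sq_eq_one i
  obtain ⟨l, rfl | rfl⟩ := Int.even_or_odd' t
  · rw [zpow_mul, hsq, one_zpow]
  · have h3 : s i ^ (2 * l + 1) = s i := by
      rw [zpow_add, zpow_mul, hsq, one_zpow, one_mul, zpow_one]
    have h4 : E (s i) = 1 := by rw [← h3]; exact hw
    rw [hE] at h4
    have := congrFun h4 i
    rw [Pi.mulSingle_eq_same, Pi.one_apply] at this
    exact absurd this (by decide)

theorem sq_mul_mem_closure (s : Fin n → G) (i j : Fin n) :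
    (s i * s j) ^ 2 ∈ Subgroup.closure (s '' {i, j}) :=
  pow_mem (mul_mem (Subgroup.subset_closure (Set.mem_image_of_mem s (by simp)))
    (Subgroup.subset_closure (Set.mem_image_of_mem s (by simp)))) _

/-- A cyclic subgroup meets the groups generated by `(s i * s j) ^ 2` and `(s i' * s j') ^ 2`
nontrivially for at most one of the two pairs, if the pairs have at most one index in common. -/
theorem IsStringCGroup.sq_eq_one_or_of_mem_zpowers (hs : IsStringCGroup s)
    (hG : Nat.card G = 2 ^ m) {E : G →* (Fin n → ℤˣ)}
    (hE : ∀ i, E (s i) = Pi.mulSingle i (-1)) {d x y : G} {i j i' j' l : Fin n}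
    (hl : ({i, j} : Set (Fin n)) ∩ {i', j'} ⊆ {l})
    (hxi : x ∈ Subgroup.zpowers ((s i * s j) ^ 2)) (hyi : y ∈ Subgroup.zpowers ((s i' * s j') ^ 2))
    (hx : x ∈ Subgroup.zpowers d) (hy : y ∈ Subgroup.zpowers d) : x = 1 ∨ y = 1 := by
  have : Fact (Nat.Prime 2) := ⟨Nat.prime_two⟩
  by_contra! hne
  obtain ⟨w, hw, hw', hw1⟩ := exists_common_involution (IsPGroup.of_card hG) hx hy hne.1 hne.2
  have h1 := Subgroup.zpowers_le.2 hxi hw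
  refine hw1 (hs.eq_one_of_mem_ker hE hl (Subgroup.zpowers_le.2 (sq_mem_ker E _) h1)
    (Subgroup.zpowers_le.2 (sq_mul_mem_closure s i j) h1)
    (Subgroup.zpowers_le.2 (sq_mul_mem_closure s i' j') (Subgroup.zpowers_le.2 hyi hw')))

/-- Both squares lie in the cyclic kernel; were both nontrivial, they would have a common nontrivial
power, against the intersection condition. -/
theorem IsStringCGroup.commute_or_commute (hs : IsStringCGroup s)
    (hG : Nat.card G = 2 ^ m) {E : G →* (Fin n → ℤˣ)}
    (hE : ∀ i, E (s i) = Pi.mulSingle i (-1)) {d : G} (hd : E.ker = Subgroup.zpowers d)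
    {i j i' j' : Fin n} (l : Fin n) (hl : ({i, j} : Set (Fin n)) ∩ {i', j'} ⊆ {l}) :
    Commute (s i) (s j) ∨ Commute (s i') (s j') := by
  rw [commute_iff_sq_eq_one (hs.mul_self i) (hs.mul_self j),
    commute_iff_sq_eq_one (hs.mul_self i') (hs.mul_self j')]
  exact hs.sq_eq_one_or_of_mem_zpowers hG hE hl (Subgroup.mem_zpowers _) (Subgroup.mem_zpowers _)
    (hd ▸ sq_mem_ker E _) (hd ▸ sq_mem_ker E _)

theorem IsConnectedStringCGroup.not_commute (hs : IsConnectedStringCGroup s) {i j : Fin n}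
    (hij : (i : ℕ) + 1 = j) : ¬ Commute (s i) (s j) := by
  rw [commute_iff_sq_eq_one (hs.mul_self i) (hs.mul_self j)]
  intro h
  have h1 := orderOf_dvd_of_pow_eq_one h
  have h2 := Nat.le_of_dvd two_pos h1
  rcases hs.connected i j hij with h3 | h3
  · rw [h3] at h1
    exact absurd h1 (by norm_num)
  · omega

theorem IsStringCGroup.exists_commute (hs : IsStringCGroup s)
    (hc : ¬ IsConnectedStringCGroup s) :
    ∃ i j : Fin n, (i : ℕ) + 1 = j ∧ Commute (s i) (s j) := by
  by_contra! h
  refine hc ⟨hs, fun i j hij => ?_⟩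
  have h1 : orderOf (s i * s j) ≠ 2 := fun h2 => h i j hij
    ((commute_iff_sq_eq_one (hs.mul_self i) (hs.mul_self j)).2 (by
      rw [← h2, pow_orderOf_eq_one]))
  have h2 : orderOf (s i * s j) ≠ 1 := fun h2 => by
    rw [orderOf_eq_one_iff, mul_eq_one_iff_eq_inv, inv_eq_of_mul_eq_one_left (hs.mul_self j)] at h2
    have := hs.injective h2
    rw [this] at hij
    omega
  omega

end StringCGroup

/-! ### Small rank, and the disconnected cases -/

theorem exists_prod_z2Hom {A G : Type*} [Group A] [Group G] {α : A →* G}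
    (hα : Function.Injective α) {c : G} (hc : c * c = 1) (hcomm : ∀ a, Commute (α a) c)
    {η : G →* ℤˣ} (hη : ∀ a, η (α a) = 1) (hηc : η c = -1) :
    ∃ φ : A × Z2 →* G, Function.Injective φ ∧ (∀ a, φ (a, 1) = α a) ∧
      φ (1, Multiplicative.ofAdd 1) = c := by
  obtain ⟨γ, hγ⟩ := exists_z2Hom hc
  have hγ' : ∀ a i, Commute (α a) (γ i) := fun a i => by
    rcases z2_eq_one_or i with rfl | rfl
    · rw [map_one]
      exact Commute.one_right _
    · rw [hγ]
      exact hcomm a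
  refine ⟨α.noncommCoprod γ hγ', ?_, fun a => ?_, ?_⟩
  · rw [injective_iff_map_eq_one]
    rintro ⟨a, i⟩ h
    change α a * γ i = 1 at h
    rcases z2_eq_one_or i with rfl | rfl
    · rw [map_one, mul_one] at h
      obtain rfl : a = 1 := hα (by rw [h, map_one])
      rfl
    · have h1 := congrArg η h
      rw [map_mul, hη, hγ, hηc, map_one] at h1
      exact absurd h1 (by decide)
  · change α a * γ 1 = α a
    rw [map_one, mul_one]
  · change α 1 * γ _ = c
    rw [map_one, one_mul, hγ]

section StringCGroup

variable {G : Type u} [Group G] {m n : ℕ} {s : Fin n → G}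

theorem IsStringCGroup.surjective_of_mem_range (hs : IsStringCGroup s) {A : Type*} [Group A]
    {φ : A →* G} (h : ∀ i, s i ∈ φ.range) : Function.Surjective φ := by
  rw [← MonoidHom.range_eq_top, eq_top_iff, ← hs.generate, Subgroup.closure_le]
  rintro _ ⟨i, rfl⟩
  exact h i

/-- The last two properties allow further commuting generators to be split off as direct factors:
they centralize the dihedral group and are separated from it by their own parity. -/
theorem IsStringCGroup.exists_dihedralHom (hs : IsStringCGroup s) {E : G →* (Fin n → ℤˣ)}
    (hE : ∀ i, E (s i) = Pi.mulSingle i (-1)) {i j : Fin n} (hij : i ≠ j) :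
    ∃ δ : DihedralGroup (orderOf (s i * s j)) →* G, Function.Injective δ ∧
      s i ∈ δ.range ∧ s j ∈ δ.range ∧
      (∀ g, Commute (s i) g → Commute (s j) g → ∀ d, Commute (δ d) g) ∧
      ∀ l, l ≠ i → l ≠ j → ∀ d, E (δ d) l = 1 := by
  obtain ⟨δ, hδ, hr, hsr⟩ := exists_dihedralHom_of_involutions (hs.mul_self i) (hs.mul_self j) rfl
    (fun k h => by
      have h1 : E (s i) i * E (s i) j = -1 := by
        rw [hE, Pi.mulSingle_eq_same, Pi.mulSingle_eq_of_ne hij.symm, mul_one]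
      have h2 : E (s j) i * E (s j) j = -1 := by
        rw [hE, Pi.mulSingle_eq_same, Pi.mulSingle_eq_of_ne hij, one_mul]
      -- The product of the two parities is -1 on each of the two generators, hence on every
      -- reflection, which therefore is nontrivial.
      let τ : G →* ℤˣ := (Pi.evalMonoidHom _ i).comp E * (Pi.evalMonoidHom _ j).comp E
      have h3 : τ (s i) = -1 := h1
      have h4 : τ (s j) = -1 := h2
      have h5 := congrArg τ h
      rw [map_mul, map_zpow, map_mul, h3, h4, map_one] at h5
      simp at h5)
  have hj : s j ∈ δ.range := ⟨_, (hsr 0).trans (by simp)⟩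
  refine ⟨δ, hδ, ?_, hj, fun g h1 h2 d => ?_, fun l hi hj d => ?_⟩
  · have h1 : s i * s j ∈ δ.range := ⟨_, (hr 1).trans (by simp)⟩
    have h2 := mul_mem h1 hj
    rwa [mul_assoc, hs.mul_self, mul_one] at h2
  · exact (commute_dihedralHom hr hsr (h1.symm.mul_right h2.symm) h2.symm d).symm
  · refine map_dihedralHom_eq_one hr hsr (φ := (Pi.evalMonoidHom _ l).comp E) ?_ ?_ d
    · change E (s i * s j) l = 1
      rw [map_mul, Pi.mul_apply, hE, hE, Pi.mulSingle_eq_of_ne hi, Pi.mulSingle_eq_of_ne hj,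
        one_mul]
    · change E (s j) l = 1
      rw [hE, Pi.mulSingle_eq_of_ne hj]

theorem IsStringCGroup.natCard_of_rank_one {s : Fin 1 → G} (hs : IsStringCGroup s) :
    Nat.card G = 2 := by
  have h : Subgroup.zpowers (s 0) = ⊤ := by
    rw [← hs.generate, Subgroup.zpowers_eq_closure]
    congr 1
    ext g
    simp [eq_comm]
  rw [← Subgroup.card_top, ← h, Nat.card_zpowers, hs.involution]

theorem IsStringCGroup.mulEquiv_dihedral {s : Fin 2 → G} (hs : IsStringCGroup s)
    (hG : Nat.card G = 2 ^ (m + 1)) : orderOf (s 0 * s 1) = 2 ^ m ∧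
      Nonempty (G ≃* DihedralGroup (2 ^ m)) := by
  obtain ⟨E, -, hE⟩ := hs.exists_parity hG
  obtain ⟨δ, hδ, h0, h1, -⟩ := hs.exists_dihedralHom hE (i := 0) (j := 1) (by decide)
  have hbij : Function.Bijective δ := ⟨hδ, hs.surjective_of_mem_range fun i => by
    fin_cases i
    exacts [h0, h1]⟩
  have hcard := Nat.card_eq_of_bijective δ hbij
  rw [DihedralGroup.nat_card, hG, pow_succ', Nat.mul_right_inj two_ne_zero] at hcard
  refine ⟨hcard, ?_⟩
  rw [← hcard]
  exact ⟨(MulEquiv.ofBijective δ hbij).symm⟩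

/-- The order of the rotation comes from counting. It is part of the conclusion because it is also
used to rule out exponents that are too small. -/
theorem IsStringCGroup.mulEquiv_dihedral_prod {s : Fin 3 → G} (hs : IsStringCGroup s)
    (hG : Nat.card G = 2 ^ (m + 2)) {i j k : Fin 3} (hij : i ≠ j) (hik : i ≠ k) (hjk : j ≠ k)
    (hi : Commute (s i) (s k)) (hj : Commute (s j) (s k)) :
    orderOf (s i * s j) = 2 ^ m ∧ Nonempty (G ≃* DihedralGroup (2 ^ m) × Z2) := by
  obtain ⟨E, -, hE⟩ := hs.exists_parity hG
  obtain ⟨δ, hδ, h0, h1, hc, hη⟩ := hs.exists_dihedralHom hE hij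
  obtain ⟨φ, hφ, hφ1, hφ2⟩ := exists_prod_z2Hom hδ (hs.mul_self k) (hc _ hi hj)
    (η := (Pi.evalMonoidHom _ k).comp E) (hη k hik.symm hjk.symm)
    (by simp [hE])
  have hr : δ.range ≤ φ.range := by
    rintro _ ⟨d, rfl⟩
    exact ⟨_, hφ1 d⟩
  have hbij : Function.Bijective φ := ⟨hφ, hs.surjective_of_mem_range fun l => by
    have key : ∀ i j k l : Fin 3, i ≠ j → i ≠ k → j ≠ k → l = i ∨ l = j ∨ l = k := by decide
    rcases key i j k l hij hik hjk with rfl | rfl | rfl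
    exacts [hr h0, hr h1, ⟨_, hφ2⟩]⟩
  have hcard := Nat.card_eq_of_bijective φ hbij
  rw [Nat.card_prod, DihedralGroup.nat_card, natCard_z2, hG, mul_comm, ← mul_assoc, pow_add,
    mul_comm (2 ^ m)] at hcard
  have hord := Nat.eq_of_mul_eq_mul_left (by norm_num) hcard
  refine ⟨hord, ?_⟩
  rw [← hord]
  exact ⟨(MulEquiv.ofBijective φ hbij).symm⟩

theorem IsStringCGroup.mulEquiv_dihedral_prod_prod {s : Fin 4 → G} (hs : IsStringCGroup s)
    (hG : Nat.card G = 2 ^ (m + 3)) {i j k l : Fin 4} (hij : i ≠ j) (hik : i ≠ k) (hjk : j ≠ k)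
    (hil : i ≠ l) (hjl : j ≠ l) (hkl : k ≠ l)
    (hi : Commute (s i) (s k)) (hj : Commute (s j) (s k))
    (hi' : Commute (s i) (s l)) (hj' : Commute (s j) (s l)) (hk' : Commute (s k) (s l)) :
    Nonempty (G ≃* DihedralGroup (2 ^ m) × Z2 × Z2) := by
  obtain ⟨E, -, hE⟩ := hs.exists_parity hG
  obtain ⟨δ, hδ, h0, h1, hc, hη⟩ := hs.exists_dihedralHom hE hij
  obtain ⟨φ, hφ, hφ1, hφ2⟩ := exists_prod_z2Hom hδ (hs.mul_self k) (hc _ hi hj)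
    (η := (Pi.evalMonoidHom _ k).comp E) (hη k hik.symm hjk.symm)
    (by simp [hE])
  have hφ' : ∀ p, ∃ d, φ p = δ d ∨ φ p = δ d * s k := by
    rintro ⟨d, z⟩
    refine ⟨d, ?_⟩
    rcases z2_eq_one_or z with rfl | rfl
    · exact .inl (hφ1 d)
    · right
      rw [← hφ1, ← hφ2, ← map_mul, Prod.mk_mul_mk, mul_one, one_mul]
  obtain ⟨χ, hχ, hχ1, hχ2⟩ := exists_prod_z2Hom hφ (hs.mul_self l) (fun p => by
      obtain ⟨d, h | h⟩ := hφ' p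
      · rw [h]
        exact hc _ hi' hj' d
      · rw [h]
        exact (hc _ hi' hj' d).mul_left hk')
    (η := (Pi.evalMonoidHom _ l).comp E) (fun p => by
      have hd := hη l hil.symm hjl.symm
      obtain ⟨d, h | h⟩ := hφ' p
      · rw [h]
        exact hd d
      · rw [h, map_mul]
        change E (δ d) l * E (s k) l = 1
        rw [hd, hE, Pi.mulSingle_eq_of_ne hkl.symm, one_mul])
    (by simp [hE])
  have hr : δ.range ≤ χ.range := by
    rintro _ ⟨d, rfl⟩
    exact ⟨_, (hχ1 _).trans (hφ1 d)⟩
  have hbij : Function.Bijective χ := ⟨hχ, hs.surjective_of_mem_range fun o => by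
    have key : ∀ i j k l o : Fin 4, i ≠ j → i ≠ k → j ≠ k → i ≠ l → j ≠ l → k ≠ l →
        o = i ∨ o = j ∨ o = k ∨ o = l := by decide
    rcases key i j k l o hij hik hjk hil hjl hkl with rfl | rfl | rfl | rfl
    exacts [hr h0, hr h1, ⟨_, (hχ1 _).trans hφ2⟩, ⟨_, hχ2⟩]⟩
  have hcard := Nat.card_eq_of_bijective χ hbij
  rw [Nat.card_prod, Nat.card_prod, DihedralGroup.nat_card, natCard_z2, hG, pow_add] at hcard
  have hord : orderOf (s i * s j) = 2 ^ m := by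
    norm_num at hcard
    omega
  rw [← hord]
  exact ⟨(MulEquiv.ofBijective χ hbij).symm.trans MulEquiv.prodAssoc⟩

theorem IsStringCGroup.rank_le (hs : IsStringCGroup s) (hG : Nat.card G = 2 ^ m) : n ≤ m := by
  obtain ⟨E, hE, -⟩ := hs.exists_parity hG
  have h : 2 ^ n ∣ 2 ^ m := by
    rw [← hG, ← natCard_ker_mul hE]
    exact dvd_mul_left _ _
  exact (Nat.pow_dvd_pow_iff_le_right (by norm_num)).1 h

theorem IsStringCGroup.rank_ne_one (hs : IsStringCGroup s) (hG : Nat.card G = 2 ^ m)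
    (hm : 2 ≤ m) : n ≠ 1 := by
  rintro rfl
  have h := hs.natCard_of_rank_one
  rw [hG] at h
  exact absurd (Nat.pow_right_injective le_rfl (h.trans (pow_one 2).symm)) (by omega)

theorem not_orderOf_of_exponent {k l : ℕ} (hexp : Monoid.exponent G = 2 ^ k) (hkl : k < l) (g : G) :
    orderOf g ≠ 2 ^ l := fun h => by
  have h1 := Monoid.order_dvd_exponent g
  rw [h, hexp] at h1
  have := (Nat.pow_dvd_pow_iff_le_right (by norm_num)).1 h1
  omega

theorem IsStringCGroup.exponent_eq_card (hs : IsStringCGroup s) (hG : Nat.card G = 2 ^ m)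
    (hexp : Monoid.exponent G = 2 ^ m) : m = 1 ∧ Nonempty (G ≃* Z2) := by
  have hn := hs.pos
  have hnm := hs.rank_le hG
  obtain ⟨k, rfl⟩ : ∃ k, m = k + 1 := ⟨m - 1, by omega⟩
  obtain ⟨E, hE, -⟩ := hs.exists_parity hG
  have h := add_rank_le hE hG hexp
  obtain rfl : n = 1 := by omega
  have hcard := hs.natCard_of_rank_one
  have : Fact (Nat.Prime 2) := ⟨Nat.prime_two⟩
  refine ⟨Nat.pow_right_injective le_rfl ((hG.symm.trans hcard).trans (pow_one 2).symm), ?_⟩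
  exact ⟨mulEquivOfPrimeCardEq hcard natCard_z2⟩

theorem IsStringCGroup.exponent_eq_card_div_two (hs : IsStringCGroup s)
    (hG : Nat.card G = 2 ^ m) (hm : 2 ≤ m) (hexp : Monoid.exponent G = 2 ^ (m - 1)) :
    Nonempty (G ≃* DihedralGroup (2 ^ (m - 1))) := by
  have hn := hs.pos
  have hn1 := hs.rank_ne_one hG hm
  obtain ⟨k, rfl⟩ : ∃ k, m = k + 2 := ⟨m - 2, by omega⟩
  obtain ⟨E, hE, -⟩ := hs.exists_parity hG
  have h := add_rank_le hE hG hexp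
  obtain rfl : n = 2 := by omega
  exact (hs.mulEquiv_dihedral hG).2

theorem IsStringCGroup.exponent_eq_card_div_four (hs : IsStringCGroup s)
    (hG : Nat.card G = 2 ^ m) (hm : 3 ≤ m) (hexp : Monoid.exponent G = 2 ^ (m - 2)) :
    ¬ IsConnectedStringCGroup s ∧ Nonempty (G ≃* DihedralGroup (2 ^ (m - 2)) × Z2) := by
  have hn := hs.pos
  have hn1 := hs.rank_ne_one hG (by omega)
  obtain ⟨k, rfl⟩ : ∃ k, m = k + 3 := ⟨m - 3, by omega⟩
  obtain ⟨E, hE, hE'⟩ := hs.exists_parity hG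
  have h := add_rank_le hE hG hexp
  have hn2 : n ≠ 2 := by
    rintro rfl
    exact not_orderOf_of_exponent hexp (by omega) _ (hs.mulEquiv_dihedral hG).1
  obtain rfl : n = 3 := by omega
  obtain ⟨d, hd⟩ := exists_ker_eq_zpowers hE hG hexp rfl
  have h02 : Commute (s 0) (s 2) := hs.commute (by decide)
  rcases hs.commute_or_commute hG hE' hd (i := 0) (j := 1) (i' := 1) (j' := 2) 1
    (by rintro x ⟨hx, hx'⟩; revert x; decide) with h01 | h12
  · exact ⟨fun hc => hc.not_commute (by decide) h01,
      (hs.mulEquiv_dihedral_prod hG (i := 1) (j := 2) (k := 0) (by decide) (by decide) (by decide)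
        h01.symm h02.symm).2⟩
  · exact ⟨fun hc => hc.not_commute (by decide) h12,
      (hs.mulEquiv_dihedral_prod hG (i := 0) (j := 1) (k := 2) (by decide) (by decide) (by decide)
        h02 h12).2⟩

theorem IsStringCGroup.exists_commute_of_rank_four {s : Fin 4 → G} (hs : IsStringCGroup s)
    {k : ℕ} (hG : Nat.card G = 2 ^ (k + 4)) (hexp : Monoid.exponent G = 2 ^ (k + 1)) :
    (Commute (s 0) (s 1) ∨ Commute (s 1) (s 2)) ∧ (Commute (s 1) (s 2) ∨ Commute (s 2) (s 3)) ∧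
      (Commute (s 0) (s 1) ∨ Commute (s 2) (s 3)) := by
  obtain ⟨E, hE, hE'⟩ := hs.exists_parity hG
  obtain ⟨d, hd⟩ := exists_ker_eq_zpowers hE hG hexp rfl
  exact ⟨hs.commute_or_commute hG hE' hd 1 (by rintro x ⟨hx, hx'⟩; revert x; decide),
    hs.commute_or_commute hG hE' hd 2 (by rintro x ⟨hx, hx'⟩; revert x; decide),
    hs.commute_or_commute hG hE' hd 1 (by rintro x ⟨hx, hx'⟩; revert x; decide)⟩

/-- Rank one means order two, and rank two means a dihedral group, whose rotation exceeds the
exponent; the upper bound comes from the parity kernel. -/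
theorem IsStringCGroup.rank_eq_three_or_four (hs : IsStringCGroup s)
    {k : ℕ} (hG : Nat.card G = 2 ^ (k + 4)) (hexp : Monoid.exponent G = 2 ^ (k + 1)) :
    n = 3 ∨ n = 4 := by
  have hn := hs.pos
  have hn1 := hs.rank_ne_one hG (by omega)
  obtain ⟨E, hE, hE'⟩ := hs.exists_parity hG
  have h := add_rank_le hE hG hexp
  have hn2 : n ≠ 2 := by
    rintro rfl
    exact not_orderOf_of_exponent hexp (by omega) _ (hs.mulEquiv_dihedral hG).1
  omega

theorem IsStringCGroup.exponent_eq_card_div_eight (hs : IsStringCGroup s)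
    (hG : Nat.card G = 2 ^ m) (hm : 4 ≤ m) (hexp : Monoid.exponent G = 2 ^ (m - 3))
    (hc : ¬ IsConnectedStringCGroup s) :
    Nonempty (G ≃* DihedralGroup (2 ^ (m - 3)) × Z2 × Z2) := by
  obtain ⟨k, rfl⟩ : ∃ k, m = k + 4 := ⟨m - 4, by omega⟩
  rcases hs.rank_eq_three_or_four hG hexp with rfl | rfl
  · have h02 : Commute (s 0) (s 2) := hs.commute (by decide)
    obtain ⟨i, j, hij, h⟩ := hs.exists_commute hc
    have key : ∀ i j : Fin 3, (i : ℕ) + 1 = j → (i = 0 ∧ j = 1) ∨ (i = 1 ∧ j = 2) := by decide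
    rcases key i j hij with ⟨rfl, rfl⟩ | ⟨rfl, rfl⟩
    -- Disconnected rank three would give an element of order 2^(m-2), twice the exponent.
    · exact absurd (hs.mulEquiv_dihedral_prod hG (i := 1) (j := 2) (k := 0) (by decide)
        (by decide) (by decide) h.symm h02.symm).1 (not_orderOf_of_exponent hexp (by omega) _)
    · exact absurd (hs.mulEquiv_dihedral_prod hG (i := 0) (j := 1) (k := 2) (by decide)
        (by decide) (by decide) h02 h).1 (not_orderOf_of_exponent hexp (by omega) _)
  · have h02 : Commute (s 0) (s 2) := hs.commute (by decide)
    have h03 : Commute (s 0) (s 3) := hs.commute (by decide)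
    have h13 : Commute (s 1) (s 3) := hs.commute (by decide)
    -- In rank four the parity kernel is cyclic, so at least two of the three neighbouring pairs
    -- commute. The remaining pair spans the dihedral factor.
    obtain ⟨h1, h2, h3⟩ := hs.exists_commute_of_rank_four hG hexp
    rcases h1 with h01 | h12
    · rcases h2 with h12 | h23
      · exact hs.mulEquiv_dihedral_prod_prod hG (i := 2) (j := 3) (k := 0) (l := 1) (by decide)
          (by decide) (by decide) (by decide) (by decide) (by decide) h02.symm h03.symm h12.symm
          h13.symm h01
      · exact hs.mulEquiv_dihedral_prod_prod hG (i := 1) (j := 2) (k := 0) (l := 3) (by decide)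
          (by decide) (by decide) (by decide) (by decide) (by decide) h01.symm h02.symm h13 h23 h03
    · rcases h3 with h01 | h23
      · exact hs.mulEquiv_dihedral_prod_prod hG (i := 2) (j := 3) (k := 0) (l := 1) (by decide)
          (by decide) (by decide) (by decide) (by decide) (by decide) h02.symm h03.symm h12.symm
          h13.symm h01
      · exact hs.mulEquiv_dihedral_prod_prod hG (i := 0) (j := 1) (k := 2) (l := 3) (by decide)
          (by decide) (by decide) (by decide) (by decide) (by decide) h02 h12 h03 h13 h23

end StringCGroup

/-! ### Connected groups of rank three -/

section Group

variable {G : Type*} [Group G]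

theorem mul_mem_iff_of_card_eq [Finite G] {H K : Subgroup G} (hHK : H ≤ K)
    (hcard : Nat.card K = Nat.card H * 2) {g h : G} (hg : g ∈ K) (hh : h ∈ K) :
    g * h ∈ H ↔ (g ∈ H ↔ h ∈ H) := by
  have hindex : (H.subgroupOf K).index = 2 := by
    have h1 := (H.subgroupOf K).card_mul_index
    rw [Nat.card_congr (Subgroup.subgroupOfEquivOfLe hHK).toEquiv, hcard] at h1
    exact Nat.eq_of_mul_eq_mul_left Nat.card_pos h1
  exact Subgroup.mul_mem_iff_of_index_two hindex (a := ⟨g, hg⟩) (b := ⟨h, hh⟩)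

/-- The involutions `a` and `b` act on ⟨d⟩ as power maps of order at most two. Power maps commute,
so the square of `a * b` acts trivially. -/
theorem commute_sq_of_zpowers_normal {d : G} (hd : (Subgroup.zpowers d).Normal) {a b : G}
    (ha : a * a = 1) (hb : b * b = 1) : Commute ((a * b) ^ 2) d := by
  have key : ∀ g : G, g * g = 1 → ∃ p : ℤ, (∀ n : ℤ, g * d ^ n * g⁻¹ = d ^ (p * n)) ∧
      d ^ (p * p) = d := by
    intro g hg
    obtain ⟨p, hp⟩ := hd.conj_mem d (Subgroup.mem_zpowers d) g
    change d ^ p = g * d * g⁻¹ at hp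
    have h1 : ∀ n : ℤ, g * d ^ n * g⁻¹ = d ^ (p * n) := fun n => by
      rw [zpow_mul, hp, conj_zpow]
    refine ⟨p, h1, ?_⟩
    rw [← h1, hp, inv_eq_of_mul_eq_one_left hg]
    calc g * (g * d * g) * g = (g * g) * d * (g * g) := by simp only [mul_assoc]
      _ = d := by rw [hg, one_mul, mul_one]
  obtain ⟨p, hp, hpp⟩ := key a ha
  obtain ⟨q, hq, hqq⟩ := key b hb
  have h1 : (a * b) ^ 2 * d * ((a * b) ^ 2)⁻¹ = d := by
    calc (a * b) ^ 2 * d * ((a * b) ^ 2)⁻¹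
        = a * (b * (a * (b * d ^ (1 : ℤ) * b⁻¹) * a⁻¹) * b⁻¹) * a⁻¹ := by
          rw [sq, zpow_one]; group
      _ = d ^ (p * (q * (p * (q * 1)))) := by rw [hq, hp, hq, hp]
      _ = (d ^ (p * p)) ^ (q * q) := by rw [← zpow_mul]; congr 1; ring
      _ = d := by rw [hpp, hqq]
  exact mul_inv_eq_iff_eq_mul.1 h1

theorem mem_zpowers_sq_of_pow_eq_one {l w : G} {j : ℕ} (hl : orderOf l = 2 ^ (j + 1))
    (hw : w ∈ Subgroup.zpowers l) (hw1 : w ^ 2 ^ j = 1) : w ∈ Subgroup.zpowers (l ^ 2) := by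
  obtain ⟨i, rfl⟩ := hw
  change (l ^ i) ^ 2 ^ j = 1 at hw1
  change l ^ i ∈ _
  rw [← zpow_natCast, ← zpow_mul, ← orderOf_dvd_iff_zpow_eq_one, hl] at hw1
  obtain ⟨t, ht⟩ := hw1
  have hi : i = 2 * t := by
    push_cast at ht
    rw [pow_succ] at ht
    have h2 : (2 : ℤ) ^ j ≠ 0 := by positivity
    apply mul_right_cancel₀ h2
    linarith
  rw [hi, zpow_mul, zpow_ofNat]
  exact zpow_mem (Subgroup.mem_zpowers (l ^ 2)) _

theorem zpow_eq_one_or_of_sq_eq_one {u : G} (hu : u ^ 2 = 1) (t : ℤ) :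
    (Even t ∧ u ^ t = 1) ∨ (Odd t ∧ u ^ t = u) := by
  have hu' : u ^ (2 : ℤ) = 1 := by exact_mod_cast hu
  obtain ⟨k, rfl | rfl⟩ := Int.even_or_odd' t
  · exact .inl ⟨even_two_mul k, by rw [zpow_mul, hu', one_zpow]⟩
  · exact .inr ⟨odd_two_mul_add_one k, by
      rw [zpow_add, zpow_mul, hu', one_zpow, one_mul, zpow_one]⟩

/-- When x = (ab)² is an involution, the last relator of P_e(m) is, up to conjugation by `b`, the
commutator of x and `c`. The relation thus amounts to knowing how `c` acts on x. -/
theorem sq_abcb_eq {a b c : G} (ha : a * a = 1) (hb : b * b = 1) (hac : Commute a c)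
    (hx : ((a * b) ^ 2) ^ 2 = 1) :
    (a * b * c * b) ^ 2 = b * ((a * b) ^ 2 * (c * (a * b) ^ 2 * c)) * b := by
  have haa : ∀ w, a * (a * w) = w := fun w => by rw [← mul_assoc, ha, one_mul]
  have hbb : ∀ w, b * (b * w) = w := fun w => by rw [← mul_assoc, hb, one_mul]
  have hca : ∀ w, c * (a * w) = a * (c * w) := fun w => by
    rw [← mul_assoc, ← hac.eq, mul_assoc]
  have hx' : b * (a * b) ^ 2 = (a * b) ^ 2 * b := by
    have h1 : (a * b) ^ 2 = ((a * b) ^ 2)⁻¹ := by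
      rw [eq_inv_iff_mul_eq_one, ← sq, hx]
    calc b * (a * b) ^ 2 = b * ((a * b) ^ 2)⁻¹ := by rw [← h1]
      _ = (a * b) ^ 2 * b := by
        simp only [sq, mul_inv_rev, inv_eq_of_mul_eq_one_left ha, inv_eq_of_mul_eq_one_left hb,
          mul_assoc, hbb, hb, mul_one]
  rw [← mul_assoc, hx']
  simp only [sq, mul_assoc, hbb, hca, haa]

theorem conj_zpowers_inv {b c : G} (hb : b * b = 1) (hc : c * c = 1) (n : ℕ) :
    b * (b * c) ^ n * b = ((b * c) ^ n)⁻¹ ∧ c * (b * c) ^ n * c = ((b * c) ^ n)⁻¹ := by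
  have h : (b * c)⁻¹ = c * b := by
    rw [mul_inv_rev, inv_eq_of_mul_eq_one_left hb, inv_eq_of_mul_eq_one_left hc]
  constructor
  · rw [conj_pow_of_mul_self hb, ← mul_assoc, hb, one_mul, ← h, inv_pow]
  · rw [conj_pow_of_mul_self hc, mul_assoc, mul_assoc, hc, mul_one, ← h, inv_pow]

/-- Conjugation by `c` cannot multiply `(a * b) ^ 2` by `(b * c) ^ 2` if both are involutions. -/
theorem c_conj_ne {a b c : G} (ha : a * a = 1) (hb : b * b = 1) (hc : c * c = 1)
    (hac : Commute a c) (hx : ((a * b) ^ 2) ^ 2 = 1) (hy : ((b * c) ^ 2) ^ 2 = 1)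
    (hy1 : (b * c) ^ 2 ≠ 1) : c * (a * b) ^ 2 * c ≠ (a * b) ^ 2 * (b * c) ^ 2 := by
  intro h
  obtain ⟨hby, hcy⟩ := conj_zpowers_inv hb hc 2
  set x := (a * b) ^ 2 with hxdef
  set y := (b * c) ^ 2 with hydef
  have hyi : y⁻¹ = y := inv_eq_of_mul_eq_one_left (by rw [← sq, hy])
  have hxx : x * x = 1 := by rw [← sq, hx]
  rw [hyi] at hby hcy
  have hw : (a * b * c * b) ^ 2 = y := by
    rw [sq_abcb_eq ha hb hac hx, h, ← mul_assoc x, hxx, one_mul, hby]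
  have hay : Commute a y := by
    refine commute_of_conj_eq ha ?_
    -- The word a·bcb is a product of two involutions, so `a` inverts it; hence `a` inverts its
    -- square y, which is its own inverse.
    have hinv : a * (a * b * c * b) * a = (a * b * c * b)⁻¹ := by
      simp only [mul_inv_rev, inv_eq_of_mul_eq_one_left ha, inv_eq_of_mul_eq_one_left hb,
        inv_eq_of_mul_eq_one_left hc]
      simp only [← mul_assoc, ha, one_mul]
    rw [← hw, conj_pow_of_mul_self ha, hinv, inv_pow, hw, hyi]
  have hconj : ∀ g u v : G, g * g = 1 → g * (u * v) * g = (g * u * g) * (g * v * g) := by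
    intro g u v hg
    calc g * (u * v) * g = g * u * (g * g) * v * g := by rw [hg, mul_one]; simp only [mul_assoc]
      _ = _ := by simp only [mul_assoc]
  have h1 : b * a * b = a * x := by
    rw [hxdef, sq]; simp only [← mul_assoc, ha, one_mul]
  have hbx : b * x * b = x := by
    have := conj_zpowers_inv ha hb 2
    rw [← hxdef, inv_eq_of_mul_eq_one_left hxx] at this
    exact this.2
  have h2 : c * (a * x) * c = a * (x * y) := by
    rw [hconj c _ _ hc, h, ← hac.eq, mul_assoc a, hc, mul_one]
  have h3 : b * (a * (x * y)) * b = a * y := by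
    rw [hconj b _ _ hb, h1, hconj b _ _ hb, hbx, hby, mul_assoc, ← mul_assoc x, hxx, one_mul]
  have h4 : c * (a * y) * c = a * y := by
    rw [hconj c _ _ hc, hcy, ← hac.eq, mul_assoc a, hc, mul_one]
  -- The conjugate of `a` by y⁻¹ = cbcb is evaluated one letter at a time and gives `a * y`. But `a`
  -- commutes with y, which forces y = 1.
  have h5 : c * (b * (c * (b * a * b) * c) * b) * c = a * y := by rw [h1, h2, h3, h4]
  have h6 : c * (b * (c * (b * a * b) * c) * b) * c = y⁻¹ * a * y := by
    have : y⁻¹ = c * b * c * b := by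
      rw [hydef, sq]
      simp only [mul_inv_rev, inv_eq_of_mul_eq_one_left hb, inv_eq_of_mul_eq_one_left hc, mul_assoc]
    rw [this, hydef, sq]
    simp only [mul_assoc]
  rw [h6, mul_assoc, hay.eq, inv_mul_cancel_left] at h5
  exact hy1 (mul_eq_right.1 h5.symm)

end Group

section RankThree

variable {G : Type u} [Group G] {k : ℕ} {s : Fin 3 → G}

/-- Modulo `N`, x is central and y is a power of x, so elements have the normal form s₀^a s₁^b s₂^c
x^d. Trivial parity kills the first three factors: the kernel is covered by `N` and x`N`. This plays
the role of the Burnside basis theorem. -/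
theorem IsStringCGroup.mem_or_mul_mem_of_mem_ker (hs : IsStringCGroup s)
    {E : G →* (Fin 3 → ℤˣ)} (hE : ∀ i, E (s i) = Pi.mulSingle i (-1)) {N : Subgroup G}
    [hN : N.Normal] (hNE : N ≤ E.ker) (hx : ((s 0 * s 1) ^ 2) ^ 2 = 1)
    (hy : (s 1 * s 2) ^ 2 ∈ N ∨ (s 0 * s 1) ^ 2 * (s 1 * s 2) ^ 2 ∈ N) {g : G} (hg : g ∈ E.ker) :
    g ∈ N ∨ (s 0 * s 1) ^ 2 * g ∈ N := by
  have h02 : Commute (s 0) (s 2) := hs.commute (by decide)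
  have hinv := hs.mul_self
  set x := (s 0 * s 1) ^ 2 with hxdef
  set y := (s 1 * s 2) ^ 2 with hydef
  let π := QuotientGroup.mk' N
  have hxi : x⁻¹ = x := inv_eq_of_mul_eq_one_left (by rw [← sq, hx])
  have hyδ : ∃ δ : ℕ, π y = π x ^ δ := by
    rcases hy with h | h
    · exact ⟨0, by rw [pow_zero]; exact (QuotientGroup.eq_one_iff _).2 h⟩
    · refine ⟨1, ?_⟩
      have h1 : π (x * y) = 1 := (QuotientGroup.eq_one_iff _).2 h
      rw [map_mul, mul_eq_one_iff_inv_eq, ← map_inv, hxi] at h1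
      rw [pow_one, h1]
  obtain ⟨δ, hδ⟩ := hyδ
  have c0 : Commute (s 0) x := commute_of_conj_eq (hinv 0) (by
    rw [(conj_zpowers_inv (hinv 0) (hinv 1) 2).1, hxi])
  have c1 : Commute (s 1) x := commute_of_conj_eq (hinv 1) (by
    rw [(conj_zpowers_inv (hinv 0) (hinv 1) 2).2, hxi])
  have h10 : s 1 * s 0 = s 0 * s 1 * x := by
    have h : x = (s 0 * s 1)⁻¹ * (s 0 * s 1)⁻¹ := by
      rw [← hxi, hxdef, sq, mul_inv_rev]
    rw [h, mul_inv_cancel_left, mul_inv_rev, inv_eq_of_mul_eq_one_left (hinv 0),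
      inv_eq_of_mul_eq_one_left (hinv 1)]
  have h21' : s 2 * s 1 = y⁻¹ * (s 1 * s 2) := by
    have h : y = (s 1 * s 2) * (s 1 * s 2) := by rw [hydef, sq]
    rw [h, mul_inv_rev, mul_assoc, inv_mul_cancel, mul_one, mul_inv_rev,
      inv_eq_of_mul_eq_one_left (hinv 1), inv_eq_of_mul_eq_one_left (hinv 2)]
  have hπx2 : π x ^ 2 = 1 := by rw [← map_pow, hx, map_one]
  have c2 : Commute (π (s 2)) (π x) := by
    rcases hy with h | h
    · have h1 : π y = 1 := (QuotientGroup.eq_one_iff _).2 h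
      have h2 : Commute (π (s 2)) (π (s 1)) := by
        change _ * _ = _ * _
        rw [← map_mul, h21', map_mul, map_inv, h1, inv_one, one_mul, map_mul]
      rw [hxdef, map_pow, map_mul]
      exact ((h02.symm.map π).mul_right h2).pow_right 2
    · have h1 : π (x * y) = 1 := (QuotientGroup.eq_one_iff _).2 h
      have h2 : π x = π y := by
        rw [map_mul, mul_eq_one_iff_inv_eq, ← map_inv, hxi] at h1
        exact h1
      have h3 : (π y)⁻¹ = π y := by
        rw [← h2, ← map_inv, hxi]
      rw [h2]
      refine commute_of_conj_eq (by rw [← map_mul, hinv, map_one]) ?_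
      rw [← map_mul, ← map_mul, (conj_zpowers_inv (hinv 1) (hinv 2) 2).2, map_inv, h3]
  have hc : ∀ i, Commute (π (s i)) (π x) := fun i => by
    fin_cases i
    exacts [c0.map π, c1.map π, c2]
  have hπyi : (π y)⁻¹ = π x ^ δ := by
    rw [hδ, inv_eq_iff_mul_eq_one, ← pow_add, ← two_mul, pow_mul, hπx2, one_pow]
  obtain ⟨a, b, c, d, h⟩ := exists_pow_mul_pow hs.generate hinv π (x := π x) (k := δ) hc
    (by rw [← map_mul, h10, map_mul, map_mul]) (h02.symm.map π) (by
      rw [← map_mul, h21', map_mul, map_inv, hπyi, map_mul]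
      exact (((hc 1).mul_left (hc 2)).pow_right δ).symm.eq) g
  rw [← map_pow, ← map_pow, ← map_pow, ← map_pow, ← map_mul, ← map_mul, ← map_mul] at h
  obtain ⟨z, hz, hgz⟩ := (QuotientGroup.mk'_eq_mk' N).1 h
  have hpow : ∀ i n, s i ^ n = 1 ∨ s i ^ n = s i ∧ Odd n := fun i n => by
    rcases Nat.even_or_odd' n with ⟨t, rfl | rfl⟩
    · left; rw [pow_mul, hs.sq_eq_one, one_pow]
    · right
      exact ⟨by rw [pow_succ, pow_mul, hs.sq_eq_one, one_pow, one_mul], odd_two_mul_add_one t⟩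
  have hEx : E (x ^ d) = 1 := by
    rw [map_pow, (sq_mem_ker E _ : E x = 1), one_pow]
  have hE1 : E (s 0 ^ a * s 1 ^ b * s 2 ^ c) = 1 := by
    have h1 := congrArg E hgz
    rw [map_mul, (hg : E g = 1), (hNE hz : E z = 1), map_mul, hEx, mul_one, mul_one] at h1
    exact h1.symm
  have hcoord : ∀ i : Fin 3, (E (s 0) i) ^ a * (E (s 1) i) ^ b * (E (s 2) i) ^ c = 1 := fun i => by
    have := congrFun hE1 i
    simpa only [map_mul, map_pow, Pi.mul_apply, Pi.pow_apply, Pi.one_apply] using this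
  simp only [hE] at hcoord
  have hne : ∀ n, Odd n → ((-1 : ℤˣ) ^ n ≠ 1) := fun n hn => by
    rw [hn.neg_one_pow]; decide
  have ha : s 0 ^ a = 1 := by
    rcases hpow 0 a with h | ⟨-, h⟩
    · exact h
    · have := hcoord 0
      simp at this
      exact absurd this (hne a h)
  have hb : s 1 ^ b = 1 := by
    rcases hpow 1 b with h | ⟨-, h⟩
    · exact h
    · have := hcoord 1
      simp at this
      exact absurd this (hne b h)
  have hc' : s 2 ^ c = 1 := by
    rcases hpow 2 c with h | ⟨-, h⟩
    · exact h
    · have := hcoord 2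
      simp at this
      exact absurd this (hne c h)
  rw [ha, hb, hc', one_mul, one_mul, one_mul] at hgz
  have hg' : x ^ d * g ∈ N := by
    have h1 : g = x ^ d * z⁻¹ := by rw [← hgz, mul_inv_cancel_right]
    rw [h1, ← mul_assoc, ← pow_add, ← two_mul, pow_mul, hx, one_pow, one_mul]
    exact inv_mem hz
  rcases Nat.even_or_odd' d with ⟨t, rfl | rfl⟩
  · left
    rwa [pow_mul, hx, one_pow, one_mul] at hg'
  · right
    rwa [pow_succ, pow_mul, hx, one_pow, one_mul] at hg'

end RankThree

section RankThree

variable {G : Type u} [Group G] {k : ℕ} {s : Fin 3 → G}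

theorem IsStringCGroup.isPresTriple_zero (hs : IsStringCGroup s)
    (hx : ((s 0 * s 1) ^ 2) ^ 2 = 1) (hy : (s 1 * s 2) ^ 2 ^ (k + 1) = 1)
    (h : s 2 * (s 0 * s 1) ^ 2 * s 2 = (s 0 * s 1) ^ 2) :
    IsPresTriple (k + 4) 0 (s 0) (s 1) (s 2) := by
  have h02 : Commute (s 0) (s 2) := hs.commute (by decide)
  refine ⟨hs.sq_eq_one 0, hs.sq_eq_one 1, hs.sq_eq_one 2, ?_,
    (commute_iff_sq_eq_one (hs.mul_self 0) (hs.mul_self 2)).1 h02, hy, ?_⟩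
  · rw [← hx, ← pow_mul]
  · rw [sq_abcb_eq (hs.mul_self 0) (hs.mul_self 1) h02 hx, h, ← sq ((s 0 * s 1) ^ 2), hx, mul_zero,
      pow_zero, mul_one, mul_one, hs.mul_self]

theorem IsStringCGroup.isPresTriple_one (hs : IsStringCGroup s)
    (hx : ((s 0 * s 1) ^ 2) ^ 2 = 1) (hy : (s 1 * s 2) ^ 2 ^ (k + 1) = 1)
    (h : (s 0 * s 1) ^ 2 * (s 2 * (s 0 * s 1) ^ 2 * s 2) = (s 1 * s 2) ^ 2 ^ k) :
    IsPresTriple (k + 4) 1 (s 0) (s 1) (s 2) := by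
  have h02 : Commute (s 0) (s 2) := hs.commute (by decide)
  refine ⟨hs.sq_eq_one 0, hs.sq_eq_one 1, hs.sq_eq_one 2, ?_,
    (commute_iff_sq_eq_one (hs.mul_self 0) (hs.mul_self 2)).1 h02, hy, ?_⟩
  · rw [← hx, ← pow_mul]
  · have h1 : s 2 * s 1 = (s 1 * s 2)⁻¹ := by
      rw [mul_inv_rev, inv_eq_of_mul_eq_one_left (hs.mul_self 1),
        inv_eq_of_mul_eq_one_left (hs.mul_self 2)]
    rw [sq_abcb_eq (hs.mul_self 0) (hs.mul_self 1) h02 hx, h,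
      (conj_zpowers_inv (hs.mul_self 1) (hs.mul_self 2) _).1, h1, inv_pow, mul_one,
      Nat.add_sub_cancel, ← mul_inv_rev, ← pow_add, ← two_mul, ← pow_succ', hy, inv_one]

/-- Here K is the four-group {1, x, l, xl}, and y is l or xl. The conjugate of x by s₂ is not 1, not
y (which s₂ fixes) and not xy by `c_conj_ne`, so it is x. -/
theorem IsStringCGroup.c_conj_eq_of_natCard_ker_eq_four (hs : IsStringCGroup s)
    {E : G →* (Fin 3 → ℤˣ)} {l : G} (hl : orderOf l = 2) (hlE : l ∈ E.ker)
    (hmul : ∀ g ∈ E.ker, ∀ h ∈ E.ker,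
      (g * h ∈ Subgroup.zpowers l ↔ (g ∈ Subgroup.zpowers l ↔ h ∈ Subgroup.zpowers l)))
    (hx : ((s 0 * s 1) ^ 2) ^ 2 = 1) (hxl : (s 0 * s 1) ^ 2 ∉ Subgroup.zpowers l)
    (hxy : (s 0 * s 1) ^ 2 ≠ (s 1 * s 2) ^ 2) (hy1 : (s 1 * s 2) ^ 2 ≠ 1) :
    ((s 1 * s 2) ^ 2) ^ 2 = 1 ∧ s 2 * (s 0 * s 1) ^ 2 * s 2 = (s 0 * s 1) ^ 2 := by
  have hcinv := (conj_zpowers_inv (hs.mul_self 1) (hs.mul_self 2) 2).2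
  have hne := c_conj_ne (hs.mul_self 0) (hs.mul_self 1) (hs.mul_self 2) (hs.commute (by decide)) hx
  have hxE : (s 0 * s 1) ^ 2 ∈ E.ker := sq_mem_ker E _
  have hyE : (s 1 * s 2) ^ 2 ∈ E.ker := sq_mem_ker E _
  set x := (s 0 * s 1) ^ 2
  set y := (s 1 * s 2) ^ 2
  have hl2 : l ^ 2 = 1 := hl ▸ pow_orderOf_eq_one l
  have hl1 : l ≠ 1 := fun h => by
    rw [h, orderOf_one] at hl
    exact absurd hl (by norm_num)
  have hxx : x * x = 1 := by rw [← sq, hx]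
  have hxi : x⁻¹ = x := inv_eq_of_mul_eq_one_left hxx
  have hcases : ∀ w ∈ Subgroup.zpowers l, w = 1 ∨ w = l := by
    rintro _ ⟨i, rfl⟩
    exact (zpow_eq_one_or_of_sq_eq_one hl2 i).imp And.right And.right
  have hcover : ∀ g ∈ E.ker, g ∈ Subgroup.zpowers l ∨ x * g ∈ Subgroup.zpowers l := by
    intro g hg
    have := hmul x hxE g hg
    tauto
  have hcomm : Commute x l := by
    refine commute_of_conj_eq hxx ?_
    have h1 : x * l * x ∈ Subgroup.zpowers l := by
      rw [hmul _ (mul_mem hxE hlE) _ hxE, hmul _ hxE _ hlE]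
      simp [hxl, Subgroup.mem_zpowers]
    refine (hcases _ h1).resolve_left fun h2 => hl1 ?_
    calc l = x * (x * l * x) * x := by
          simp only [mul_assoc, hxx, mul_one]; rw [← mul_assoc, hxx, one_mul]
      _ = 1 := by rw [h2, mul_one, hxx]
  have hy : y = l ∨ x * y = l := by
    rcases hcover y hyE with h | h
    · exact .inl ((hcases y h).resolve_left hy1)
    · refine .inr ((hcases _ h).resolve_left fun h1 => hxy ?_)
      rw [← hxi]
      exact inv_eq_of_mul_eq_one_right h1
  have hy2 : y ^ 2 = 1 := by
    rcases hy with h | h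
    · rw [h, hl2]
    · have h1 : y = x * l := by rw [← h, ← mul_assoc, hxx, one_mul]
      rw [h1, hcomm.mul_pow, hx, hl2, one_mul]
  refine ⟨hy2, ?_⟩
  replace hne := hne hy2 hy1
  rw [inv_eq_of_mul_eq_one_left (by rw [← sq, hy2] : y * y = 1)] at hcinv
  have hcE : s 2 * x * s 2 ∈ E.ker := by
    have := (inferInstance : E.ker.Normal).conj_mem x hxE (s 2)
    rwa [inv_eq_of_mul_eq_one_left (hs.mul_self 2)] at this
  have hcc : ∀ w, s 2 * (s 2 * w * s 2) * s 2 = w := fun w => by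
    simp only [mul_assoc, hs.mul_self, mul_one]; rw [← mul_assoc, hs.mul_self, one_mul]
  have hney : s 2 * x * s 2 ≠ y := fun h => hxy (by rw [← hcc x, h, hcinv])
  rcases hcover _ hcE with h | h
  · rcases hcases _ h with h | h
    · exact absurd (by rw [← hcc x, h, mul_one, hs.mul_self] : x = 1)
        (fun h => hxl (h ▸ one_mem _))
    · rcases hy with h1 | h1
      · exact absurd (h.trans h1.symm) hney
      · exact absurd (h.trans h1.symm) hne
  · rcases hcases _ h with h | h
    · rw [← inv_eq_of_mul_eq_one_right h, hxi]
    · have h2 : s 2 * x * s 2 = x * l := by rw [← h, ← mul_assoc x x, hxx, one_mul]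
      rcases hy with h1 | h1
      · exact absurd (h2.trans (h1 ▸ rfl)) hne
      · exact absurd (by rw [h2, ← h1, ← mul_assoc, hxx, one_mul]) hney

/-- Let u be the involution of L = ⟨l⟩. Since y is nontrivial modulo ⟨l²⟩ and x, its 2^j-th power is
u. The conjugate of x by s₂ is an involution of K outside L, and such elements are x or xu. -/
theorem IsStringCGroup.pow_eq_and_c_conj_eq (hs : IsStringCGroup s) {j : ℕ} (hj : 1 ≤ j)
    {E : G →* (Fin 3 → ℤˣ)} (hE : ∀ i, E (s i) = Pi.mulSingle i (-1)) {l : G}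
    (hl : orderOf l = 2 ^ (j + 1)) (hlE : l ∈ E.ker)
    (hmul : ∀ g ∈ E.ker, ∀ h ∈ E.ker,
      (g * h ∈ Subgroup.zpowers l ↔ (g ∈ Subgroup.zpowers l ↔ h ∈ Subgroup.zpowers l)))
    (hx : ((s 0 * s 1) ^ 2) ^ 2 = 1) (hxl : (s 0 * s 1) ^ 2 ∉ Subgroup.zpowers l) :
    ((s 1 * s 2) ^ 2) ^ 2 ^ j = l ^ 2 ^ j ∧
      ((s 0 * s 1) ^ 2 * (s 2 * (s 0 * s 1) ^ 2 * s 2) = 1 ∨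
        (s 0 * s 1) ^ 2 * (s 2 * (s 0 * s 1) ^ 2 * s 2) = l ^ 2 ^ j) := by
  have hcinv := (conj_zpowers_inv (hs.mul_self 1) (hs.mul_self 2) (2 * 2 ^ j)).2
  have hkey := fun (N : Subgroup G) (hN : N.Normal) hNE => hs.mem_or_mul_mem_of_mem_ker hE
    (N := N) hNE hx
  have hcentral : ∀ d, (Subgroup.zpowers d).Normal → Commute ((s 0 * s 1) ^ 2) d := fun d hd =>
    commute_sq_of_zpowers_normal hd (hs.mul_self 0) (hs.mul_self 1)
  have hxE : (s 0 * s 1) ^ 2 ∈ E.ker := sq_mem_ker E _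
  have hyE : (s 1 * s 2) ^ 2 ∈ E.ker := sq_mem_ker E _
  rw [pow_mul] at hcinv
  set x := (s 0 * s 1) ^ 2
  set y := (s 1 * s 2) ^ 2
  set u := l ^ 2 ^ j with hu
  have hxx : x * x = 1 := by rw [← sq, hx]
  have hxi : x⁻¹ = x := inv_eq_of_mul_eq_one_left hxx
  have hu2 : u ^ 2 = 1 := by rw [hu, ← pow_mul, ← pow_succ, ← hl, pow_orderOf_eq_one]
  have hu1 : u ≠ 1 := by
    refine pow_ne_one_of_lt_orderOf (by positivity) ?_
    rw [hl]
    exact Nat.pow_lt_pow_right one_lt_two (Nat.lt_succ_self j)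
  have huL : u ∈ Subgroup.zpowers l := pow_mem (Subgroup.mem_zpowers l) _
  have hLE : Subgroup.zpowers l ≤ E.ker := Subgroup.zpowers_le.2 hlE
  have hsqL : ∀ g ∈ E.ker, g ^ 2 ∈ Subgroup.zpowers l := fun g hg => by
    rw [sq, hmul g hg g hg]
  have hcover : ∀ g ∈ E.ker, g ∈ Subgroup.zpowers l ∨ x * g ∈ Subgroup.zpowers l := by
    intro g hg
    have := hmul x hxE g hg
    tauto
  have hconjE : ∀ g, g * l * g⁻¹ ∈ E.ker := (inferInstance : E.ker.Normal).conj_mem l hlE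
  have hxlx : x * l * x ∈ Subgroup.zpowers l := by
    rw [hmul _ (mul_mem hxE hlE) _ hxE, hmul _ hxE _ hlE]
    simp [hxl, Subgroup.mem_zpowers]
  have hcommL : ∀ w ∈ Subgroup.zpowers l, Commute w l := by
    rintro _ ⟨i, rfl⟩
    exact (Commute.refl l).zpow_left i
  -- the subgroup generated by `l ^ 2` is normal
  have hN : (Subgroup.zpowers (l ^ 2)).Normal := by
    have h1 : ∀ g, g * l ^ 2 * g⁻¹ ∈ Subgroup.zpowers (l ^ 2) := fun g => by
      refine mem_zpowers_sq_of_pow_eq_one hl ?_ ?_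
      · rw [← conj_pow]
        exact hsqL _ (hconjE g)
      · rw [conj_pow, ← pow_mul, ← pow_succ', ← hl, pow_orderOf_eq_one, mul_one, mul_inv_cancel]
    refine ⟨?_⟩
    rintro _ ⟨i, rfl⟩ g
    change g * (l ^ 2) ^ i * g⁻¹ ∈ _
    rw [← conj_zpow]
    exact zpow_mem (h1 g) i
  have hxl2 : x * l ^ 2 * x = l ^ 2 := by
    rw [(hcentral _ hN).eq, mul_assoc, hxx, mul_one]
  -- the action of `x` on `l`
  have hact : x * l * x = l ∨ x * l * x = l * u ∧ 2 ≤ j := by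
    -- Since x centralizes l², the commutator of x and l lies in L and squares to 1, so it is 1 or
    -- u.
    have h1 : (x * l * x * l⁻¹) ^ 2 = 1 := by
      rw [((hcommL _ hxlx).inv_right).mul_pow, ← conj_pow_of_mul_self hxx, hxl2, inv_pow,
        mul_inv_cancel]
    rcases eq_one_or_eq_of_sq_eq_one hl (mul_mem hxlx (inv_mem (Subgroup.mem_zpowers l))) h1
      with h2 | h2
    · exact .inl (mul_inv_eq_one.1 h2)
    · have h3 : x * l * x = l * u := by
        rw [mul_inv_eq_iff_eq_mul, (hcommL _ huL).eq] at h2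
        exact h2
      -- For j = 1 the second alternative would make x invert l, of order 4. Elements of xL would
      -- then have square 1, so conjugates of l would stay in L, and L would be normal. But then x
      -- centralizes l after all.
      rcases hj.lt_or_eq with hj2 | rfl
      · exact .inr ⟨h3, hj2⟩
      · left
        have h4 : x * l * x = l⁻¹ := by
          rw [h3, eq_inv_iff_mul_eq_one, hu, pow_one, ← pow_succ', ← pow_succ, ← hu2, hu,
            ← pow_mul]
          rfl
        have hnormal : (Subgroup.zpowers l).Normal := by
          have h5 : ∀ g, g * l * g⁻¹ ∈ Subgroup.zpowers l := by
            intro g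
            rcases hcover _ (hconjE g) with h6 | ⟨i, h6⟩
            · exact h6
            · exfalso
              change l ^ i = x * (g * l * g⁻¹) at h6
              have h7 : g * l * g⁻¹ = x * l ^ i := by rw [h6, ← mul_assoc, hxx, one_mul]
              have h8 : (g * l * g⁻¹) ^ 2 = 1 := by
                rw [sq]
                nth_rw 1 [h7]
                rw [h7, ← mul_assoc, conj_zpow_of_conj_eq_inv hxx h4, ← zpow_add, neg_add_cancel,
                  zpow_zero]
              rw [conj_pow] at h8
              exact hu1 (conj_eq_one_iff.1 h8)
          refine ⟨?_⟩
          rintro _ ⟨i, rfl⟩ g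
          change g * l ^ i * g⁻¹ ∈ _
          rw [← conj_zpow]
          exact zpow_mem (h5 g) i
        rw [(hcentral l hnormal).eq, mul_assoc, hxx, mul_one]
  -- the squares of the elements of the kernel outside of the cyclic subgroup
  obtain ⟨v, hvL, hv, hvu⟩ : ∃ v ∈ Subgroup.zpowers l, (∀ i : ℤ, (x * l ^ i) ^ 2 = v ^ i) ∧
      v ^ 2 ^ (j - 1) = u := by
    -- This element is (xl)², equal to l² or to l²u, the latter only if 2 ≤ j. In both cases its
    -- 2^(j-1)-th power is u.
    refine ⟨x * l * x * l, mul_mem hxlx (Subgroup.mem_zpowers l), fun i => ?_, ?_⟩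
    · have h1 : x * l ^ i * x = (x * l * x) ^ i := by
        have := conj_zpow (i := i) (a := x) (b := l)
        rw [hxi] at this
        exact this.symm
      rw [(hcommL _ hxlx).mul_zpow, sq, ← mul_assoc, h1]
    · have h1 : (l ^ 2) ^ 2 ^ (j - 1) = u := by
        rw [← pow_mul, ← pow_succ', Nat.sub_add_cancel hj]
      rcases hact with h | ⟨h, hj2⟩
      · rw [h, ← sq, h1]
      · have h2 : u ^ 2 ^ (j - 1) = 1 := by
          rw [show j - 1 = (j - 2) + 1 by omega, pow_succ', pow_mul, hu2, one_pow]
        rw [h, mul_assoc, (hcommL _ huL).eq, ← mul_assoc, ← sq,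
          ((hcommL _ huL).symm.pow_left 2).mul_pow, h1, h2, mul_one]
  have hvo : orderOf v = 2 ^ j := by
    have h1 : ¬ v ^ 2 ^ (j - 1) = 1 := hvu ▸ hu1
    have h2 : v ^ 2 ^ (j - 1 + 1) = 1 := by rw [pow_succ, pow_mul, hvu, hu2]
    have := orderOf_eq_prime_pow h1 h2
    rwa [Nat.sub_add_cancel hj] at this
  -- Otherwise K would be covered by ⟨l²⟩ and x⟨l²⟩, but l belongs to neither.
  have hy : y ∉ Subgroup.zpowers (l ^ 2) ∧ x * y ∉ Subgroup.zpowers (l ^ 2) := by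
    rw [← not_or]
    intro h
    have hNL : Subgroup.zpowers (l ^ 2) ≤ Subgroup.zpowers l :=
      Subgroup.zpowers_le.2 (pow_mem (Subgroup.mem_zpowers l) 2)
    rcases hkey _ hN (hNL.trans hLE) h hlE with h1 | h1
    · obtain ⟨i, hi⟩ := h1
      change (l ^ 2) ^ i = l at hi
      have h2 : u ^ (2 * i) = u := by
        rw [hu, ← zpow_natCast, ← zpow_mul, mul_comm, zpow_mul, zpow_mul, zpow_ofNat, hi]
      rcases zpow_eq_one_or_of_sq_eq_one hu2 (2 * i) with ⟨-, h3⟩ | ⟨h3, -⟩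
      · exact hu1 (h2.symm.trans h3)
      · exact (Int.not_even_iff_odd.2 h3) (even_two_mul i)
    · have h2 := hNL h1
      rw [hmul x hxE l hlE] at h2
      exact hxl (h2.2 (Subgroup.mem_zpowers l))
  have hodd : ∀ i : ℤ, l ^ i ∉ Subgroup.zpowers (l ^ 2) → Odd i := by
    intro i hi
    rw [← Int.not_even_iff_odd]
    rintro ⟨t, rfl⟩
    apply hi
    rw [← two_mul, zpow_mul, zpow_ofNat]
    exact zpow_mem (Subgroup.mem_zpowers _) t
  have huodd : ∀ i : ℤ, Odd i → u ^ i = u := fun i hi =>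
    ((zpow_eq_one_or_of_sq_eq_one hu2 i).resolve_left fun h => Int.not_even_iff_odd.2 hi h.1).2
  have hyu : y ^ 2 ^ j = u := by
    -- Either y = l^i or y = x l^i, with i odd by the previous claim; both have 2^j-th power u.
    rcases hcover y hyE with ⟨i, h⟩ | ⟨i, h⟩
    · change l ^ i = y at h
      have hi := hodd i (h ▸ hy.1)
      rw [← h, zpow_pow_comm, ← hu, huodd i hi]
    · change l ^ i = x * y at h
      have hi := hodd i (h ▸ hy.2)
      have h1 : y = x * l ^ i := by rw [h, ← mul_assoc, hxx, one_mul]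
      have h2 : 2 ^ j = 2 * 2 ^ (j - 1) := by rw [← pow_succ', Nat.sub_add_cancel hj]
      rw [h2, pow_mul, h1, hv, zpow_pow_comm, hvu, huodd i hi]
  refine ⟨hyu, ?_⟩
  have hcE : s 2 * x * s 2 ∈ E.ker := by
    have := (inferInstance : E.ker.Normal).conj_mem x hxE (s 2)
    rwa [inv_eq_of_mul_eq_one_left (hs.mul_self 2)] at this
  have hcc : ∀ w, s 2 * (s 2 * w * s 2) * s 2 = w := fun w => by
    simp only [mul_assoc, hs.mul_self, mul_one]; rw [← mul_assoc, hs.mul_self, one_mul]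
  have hc2 : (s 2 * x * s 2) ^ 2 = 1 := by
    rw [← conj_pow_of_mul_self (hs.mul_self 2), hx, mul_one, hs.mul_self]
  rw [hyu, inv_eq_of_mul_eq_one_left (by rw [← sq, hu2] : u * u = 1)] at hcinv
  rcases hcover _ hcE with h | ⟨i, h⟩
  · exfalso
    -- Inside L the conjugate of x would be 1 or u. As a power of y of order two, u is fixed by s₂,
    -- so x itself would lie in L.
    rcases eq_one_or_eq_of_sq_eq_one hl h hc2 with h1 | h1
    · exact hxl (by rw [← hcc x, h1, mul_one, hs.mul_self]; exact one_mem _)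
    · exact hxl (by rw [← hcc x, h1, hcinv]; exact huL)
  · change l ^ i = x * (s 2 * x * s 2) at h
    have h1 : s 2 * x * s 2 = x * l ^ i := by rw [h, ← mul_assoc x x, hxx, one_mul]
    -- The square of x l^i is v^i, so it vanishes only if 2^j divides i, that is, if l^i is 1 or u.
    rw [h1, hv, ← orderOf_dvd_iff_zpow_eq_one, hvo] at hc2
    obtain ⟨t, rfl⟩ := hc2
    rw [← h, zpow_mul]
    have h2 : l ^ ((2 ^ j : ℕ) : ℤ) = u := zpow_natCast l _
    rw [h2]
    exact (zpow_eq_one_or_of_sq_eq_one hu2 t).imp And.right And.right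

end RankThree

section RankThree

variable {G : Type u} [Group G] {k : ℕ} {s : Fin 3 → G}

/-- With m = k + 4, `l` generates a subgroup of index two in the parity kernel. As x² lies in it and
⟨x⟩ meets it trivially, x is an involution. -/
theorem IsStringCGroup.exists_isPresTriple (hs : IsStringCGroup s) (hG : Nat.card G = 2 ^ (k + 4))
    {E : G →* (Fin 3 → ℤˣ)} (hE : ∀ i, E (s i) = Pi.mulSingle i (-1))
    {l : G} (hl : orderOf l = 2 ^ k) (hlE : l ∈ E.ker)
    (hmul : ∀ g ∈ E.ker, ∀ h ∈ E.ker,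
      (g * h ∈ Subgroup.zpowers l ↔ (g ∈ Subgroup.zpowers l ↔ h ∈ Subgroup.zpowers l)))
    (hx1 : (s 0 * s 1) ^ 2 ≠ 1) (hy1 : (s 1 * s 2) ^ 2 ≠ 1)
    (hxl : ∀ w ∈ Subgroup.zpowers ((s 0 * s 1) ^ 2), w ∈ Subgroup.zpowers l → w = 1) :
    1 ≤ k ∧ ∃ e, (e = 0 ∨ e = 1 ∧ 2 ≤ k) ∧ orderOf (s 0 * s 1) = 4 ∧
      orderOf (s 1 * s 2) = 2 ^ (k + 1) ∧ IsPresTriple (k + 4) e (s 0) (s 1) (s 2) := by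
  have : Fact (Nat.Prime 2) := ⟨Nat.prime_two⟩
  have hxE : (s 0 * s 1) ^ 2 ∈ E.ker := sq_mem_ker E _
  have hyE : (s 1 * s 2) ^ 2 ∈ E.ker := sq_mem_ker E _
  have hx : ((s 0 * s 1) ^ 2) ^ 2 = 1 := hxl _ (pow_mem (Subgroup.mem_zpowers _) 2) (by
    rw [sq ((s 0 * s 1) ^ 2), hmul _ hxE _ hxE])
  have hxl' : (s 0 * s 1) ^ 2 ∉ Subgroup.zpowers l := fun h =>
    hx1 (hxl _ (Subgroup.mem_zpowers _) h)
  have hxx : (s 0 * s 1) ^ 2 * (s 0 * s 1) ^ 2 = 1 := by rw [← sq, hx]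
  have hxi := inv_eq_of_mul_eq_one_left hxx
  have hxy : (s 0 * s 1) ^ 2 ≠ (s 1 * s 2) ^ 2 := fun h => by
    rcases hs.sq_eq_one_or_of_mem_zpowers hG hE (i := 0) (j := 1) (i' := 1) (j' := 2) (l := 1)
      (by rintro x ⟨hx, hx'⟩; revert x; decide) (Subgroup.mem_zpowers _) (Subgroup.mem_zpowers _)
      (Subgroup.mem_zpowers _) (h ▸ Subgroup.mem_zpowers _) with h | h
    exacts [hx1 h, hy1 h]
  have hord : orderOf (s 0 * s 1) = 4 := by
    refine orderOf_eq_prime_pow (p := 2) (n := 1) ?_ ?_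
    · rwa [pow_one]
    · change (s 0 * s 1) ^ (2 * 2) = 1
      rw [pow_mul, hx]
  have hk : 1 ≤ k := by
    rw [Nat.one_le_iff_ne_zero]
    rintro rfl
    obtain rfl : l = 1 := orderOf_eq_one_iff.1 hl
    have h := (hmul _ hxE _ hyE).2
    simp only [Subgroup.zpowers_one_eq_bot, Subgroup.mem_bot, hx1, hy1] at h
    have h1 := inv_eq_of_mul_eq_one_right (h trivial)
    rw [hxi] at h1
    exact hxy h1
  refine ⟨hk, ?_⟩
  obtain ⟨j, rfl⟩ : ∃ j, k = j + 1 := ⟨k - 1, by omega⟩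
  -- The kernel has order four when j = 0, that is m = 5; there only e = 0 occurs.
  rcases Nat.eq_zero_or_pos j with rfl | hj
  · obtain ⟨hy, hc⟩ := hs.c_conj_eq_of_natCard_ker_eq_four hl hlE hmul hx hxl' hxy hy1
    have hy4 : (s 1 * s 2) ^ 2 ^ 2 = 1 := by
      change (s 1 * s 2) ^ (2 * 2) = 1
      rw [pow_mul, hy]
    refine ⟨0, .inl rfl, hord, ?_, hs.isPresTriple_zero hx hy4 hc⟩
    refine orderOf_eq_prime_pow (p := 2) (n := 1) ?_ hy4
    rwa [pow_one]
  · obtain ⟨hyu, hc⟩ := hs.pow_eq_and_c_conj_eq hj hE hl hlE hmul hx hxl'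
    have hyu' : (s 1 * s 2) ^ 2 ^ (j + 1) = l ^ 2 ^ j := by rw [pow_succ', pow_mul, hyu]
    have hu1 : l ^ 2 ^ j ≠ 1 := by
      refine pow_ne_one_of_lt_orderOf (by positivity) ?_
      rw [hl]
      exact Nat.pow_lt_pow_right one_lt_two (Nat.lt_succ_self j)
    have hy2 : (s 1 * s 2) ^ 2 ^ (j + 1 + 1) = 1 := by
      rw [pow_succ, pow_mul, hyu', ← pow_mul, ← pow_succ, ← hl, pow_orderOf_eq_one]
    have hord2 : orderOf (s 1 * s 2) = 2 ^ (j + 1 + 1) :=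
      orderOf_eq_prime_pow (by rwa [hyu']) hy2
    rcases hc with h | h
    · refine ⟨0, .inl rfl, hord, hord2, hs.isPresTriple_zero hx hy2 ?_⟩
      rw [← inv_eq_of_mul_eq_one_right h, hxi]
    · exact ⟨1, .inr ⟨rfl, by omega⟩, hord, hord2, hs.isPresTriple_one hx hy2 (h.trans hyu'.symm)⟩

theorem IsStringCGroup.reverse (hs : IsStringCGroup s) : IsStringCGroup (s ∘ Fin.rev) where
  pos := hs.pos
  injective := hs.injective.comp Fin.rev_injective
  involution i := hs.involution _
  generate := by
    rw [Set.range_comp, Fin.rev_surjective.range_eq, Set.image_univ, hs.generate]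
  string j k hjk := by
    have h := hs.string k.rev j.rev (by simp only [Fin.val_rev]; omega)
    rw [← orderOf_inv, mul_inv_rev, inv_eq_of_mul_eq_one_left (hs.mul_self _),
      inv_eq_of_mul_eq_one_left (hs.mul_self _)] at h
    exact h
  intersection J K := by
    rw [Set.image_comp, Set.image_comp, Set.image_comp, hs.intersection,
      Set.image_inter Fin.rev_injective]

theorem sq_swap_ne_one {u v : G} (hu : u * u = 1) (hv : v * v = 1) (h : (u * v) ^ 2 ≠ 1) :
    (v * u) ^ 2 ≠ 1 := fun h1 => h ((commute_iff_sq_eq_one hu hv).1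
  ((commute_iff_sq_eq_one hv hu).2 h1).symm)

theorem zpowers_sq_swap {u v : G} (hu : u * u = 1) (hv : v * v = 1) :
    Subgroup.zpowers ((u * v) ^ 2) = Subgroup.zpowers ((v * u) ^ 2) := by
  have h : v * u = (u * v)⁻¹ := by
    rw [mul_inv_rev, inv_eq_of_mul_eq_one_left hu, inv_eq_of_mul_eq_one_left hv]
  rw [h, inv_pow, Subgroup.zpowers_inv]

theorem IsConnectedStringCGroup.exists_isPresTriple (hs : IsConnectedStringCGroup s)
    (hG : Nat.card G = 2 ^ (k + 4)) (hexp : Monoid.exponent G = 2 ^ (k + 1)) :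
    1 ≤ k ∧ ∃ e, (e = 0 ∨ e = 1 ∧ 2 ≤ k) ∧ ∃ f : Fin 3 ≃ Fin 3, (StrictMono f ∨ StrictAnti f) ∧
      IsStringCGroup (s ∘ f) ∧ orderOf (s (f 0) * s (f 1)) = 4 ∧
      orderOf (s (f 1) * s (f 2)) = 2 ^ (k + 1) ∧
      IsPresTriple (k + 4) e (s (f 0)) (s (f 1)) (s (f 2)) := by
  have hfin : Finite G := Nat.finite_of_card_ne_zero (hG ▸ by positivity)
  have hinv := hs.mul_self
  obtain ⟨E, hE', hE⟩ := hs.exists_parity hG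
  obtain ⟨c, hc⟩ := exists_orderOf_eq_exponent hexp
  have hl := orderOf_sq_of_orderOf hc
  have hlE := sq_mem_ker E c
  have hcard : Nat.card E.ker = 2 ^ k * 2 := by
    have h := natCard_ker_mul hE'
    rw [hG, show 2 ^ (k + 4) = 2 ^ k * 2 * 2 ^ 3 by ring] at h
    exact Nat.eq_of_mul_eq_mul_right (by norm_num) h
  have hmul : ∀ g ∈ E.ker, ∀ h ∈ E.ker, (g * h ∈ Subgroup.zpowers (c ^ 2) ↔
      (g ∈ Subgroup.zpowers (c ^ 2) ↔ h ∈ Subgroup.zpowers (c ^ 2))) := fun g hg h hh =>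
    mul_mem_iff_of_card_eq (Subgroup.zpowers_le.2 hlE)
      (by rw [hcard, Nat.card_zpowers, hl]) hg hh
  have hx1 : (s 0 * s 1) ^ 2 ≠ 1 := fun h => hs.not_commute (by decide)
    ((commute_iff_sq_eq_one (hinv 0) (hinv 1)).2 h)
  have hy1 : (s 1 * s 2) ^ 2 ≠ 1 := fun h => hs.not_commute (by decide)
    ((commute_iff_sq_eq_one (hinv 1) (hinv 2)).2 h)
  -- If ⟨x⟩ meets L nontrivially then ⟨y⟩ does not, and reversing the generators interchanges the
  -- two.
  by_cases hxl : ∀ w ∈ Subgroup.zpowers ((s 0 * s 1) ^ 2), w ∈ Subgroup.zpowers (c ^ 2) → w = 1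
  · obtain ⟨hk, e, he, h01, h12, ht⟩ :=
      hs.toIsStringCGroup.exists_isPresTriple hG hE hl hlE hmul hx1 hy1 hxl
    exact ⟨hk, e, he, Equiv.refl _, .inl strictMono_id, hs.toIsStringCGroup, h01, h12, ht⟩
  · push Not at hxl
    obtain ⟨w, hw, hwl, hw1⟩ := hxl
    have hr := hs.toIsStringCGroup.reverse
    obtain ⟨E₂, hE₂', hE₂⟩ := hr.exists_parity hG
    -- Reversal only permutes the coordinates of the parity map, so L is still a subgroup of index
    -- two in its kernel.
    have hker : E₂.ker = E.ker := by
      have hrev : ∀ g i, E₂ g (Fin.rev i) = E g i := by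
        intro g
        induction g using generators_induction hs.generate hinv with
        | one => simp
        | mul j g ih =>
          intro i
          have h1 : E₂ (s j) = Pi.mulSingle j.rev (-1) := by
            rw [← hE₂]; simp
          rw [map_mul, map_mul, Pi.mul_apply, Pi.mul_apply, ih, h1, hE]
          congr 1
          rcases eq_or_ne i j with rfl | hij
          · simp
          · rw [Pi.mulSingle_eq_of_ne hij, Pi.mulSingle_eq_of_ne (Fin.rev_injective.ne hij)]
      ext g
      rw [MonoidHom.mem_ker, MonoidHom.mem_ker, funext_iff, funext_iff]
      constructor
      · intro h i
        rw [← hrev, h]; rfl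
      · intro h i
        rw [← Fin.rev_rev i, hrev, h]; rfl
    obtain ⟨hk, e, he, h01, h12, ht⟩ := hr.exists_isPresTriple hG hE₂ hl (hker ▸ hlE) (hker ▸ hmul)
      (sq_swap_ne_one (hinv 1) (hinv 2) hy1) (sq_swap_ne_one (hinv 0) (hinv 1) hx1) (by
        intro v hv hvl
        have hv' : v ∈ Subgroup.zpowers ((s 1 * s 2) ^ 2) :=
          zpowers_sq_swap (hinv 1) (hinv 2) ▸ hv
        exact (hs.toIsStringCGroup.sq_eq_one_or_of_mem_zpowers hG hE (i := 0) (j := 1) (i' := 1)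
          (j' := 2) (l := 1) (by rintro x ⟨hx, hx'⟩; revert x; decide) hw hv' hwl hvl).resolve_left
          hw1)
    exact ⟨hk, e, he, Fin.revPerm, .inr Fin.rev_strictAnti, hr, h01, h12, ht⟩

end RankThree

/-! ### Identification with P_e(m) and conclusion -/

theorem IsStringCGroup.exists_pres_mulEquiv {G : Type u} [Group G] {m e : ℕ} {t : Fin 3 → G}
    (hs : IsStringCGroup t) (hG : Nat.card G = 2 ^ m) (hm : 5 ≤ m) (he : e = 0 ∨ e = 1 ∧ 6 ≤ m)
    (ht : IsPresTriple m e (t 0) (t 1) (t 2)) :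
    ∃ φ : Pres m e ≃* G, ∀ i, φ (presGen m e i) = t i := by
  obtain ⟨φ, hφ⟩ := ht.exists_hom
  have := finite_pres hm he
  have hbij : Function.Bijective φ := (Nat.bijective_iff_surjective_and_card φ).2
    ⟨hs.surjective_of_mem_range fun i => ⟨_, hφ i⟩, by rw [natCard_pres hm he, hG]⟩
  exact ⟨MulEquiv.ofBijective φ hbij, hφ⟩

/-- The bijection `f` encodes both that the rank is three and that the generators are taken in the
given or in the reversed order. -/
theorem IsConnectedStringCGroup.classification {G : Type u} [Group G] {m n : ℕ} {s : Fin n → G}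
    (hs : IsConnectedStringCGroup s) (hG : Nat.card G = 2 ^ m) (hm : 3 ≤ m)
    (hexp : Monoid.exponent G = 2 ^ (m - 3)) :
    5 ≤ m ∧ ∃ e : ℕ, (e = 0 ∨ e = 1 ∧ 6 ≤ m) ∧
      (∃ f : Fin 3 ≃ Fin n, (StrictMono f ∨ StrictAnti f) ∧
        (∃ φ : Pres m e ≃* G, ∀ i, φ (presGen m e i) = s (f i)) ∧
        (∃ hq : 2 ^ (m - 3) ≠ 1,
          Infinite (stringCoxeterMatrix 4 (2 ^ (m - 3)) (by decide) hq).Group ∧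
          IsSmoothQuotient (stringCoxeterMatrix 4 (2 ^ (m - 3)) (by decide) hq)
            (fun i => s (f i)))) := by
  have hm4 : 4 ≤ m := by
    -- For m = 3 the exponent would be one, although the generators are involutions.
    rcases hm.lt_or_eq with h | rfl
    · exact h
    · exfalso
      rw [Nat.sub_self, pow_zero] at hexp
      have h1 := Monoid.pow_exponent_eq_one (s ⟨0, hs.pos⟩)
      rw [hexp, pow_one] at h1
      exact hs.ne_one _ h1
  obtain ⟨k, rfl⟩ : ∃ k, m = k + 4 := ⟨m - 4, by omega⟩
  rcases hs.rank_eq_three_or_four hG hexp with rfl | rfl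
  · obtain ⟨hk, e, he, f, hf, hsf, h01, h12, ht⟩ := hs.exists_isPresTriple hG hexp
    have he' : e = 0 ∨ e = 1 ∧ 6 ≤ k + 4 := he.imp id fun h => ⟨h.1, by omega⟩
    refine ⟨by omega, e, he', f, hf, ?_, ?_⟩
    · exact hsf.exists_pres_mulEquiv hG (by omega) he' ht
    · have hq : 2 ^ (k + 4 - 3) ≠ 1 := (Nat.one_lt_two_pow (by omega)).ne'
      refine ⟨hq, infinite_stringCoxeterGroup (pow_dvd_pow 2 (by omega : 2 ≤ k + 4 - 3)), ?_⟩
      exact isSmoothQuotient_of_orderOf (t := s ∘ f) hsf.generate hsf.mul_self h01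
        (hsf.string 0 2 (by decide)) h12
  -- In rank four some pair of neighbours commutes, against connectedness.
  · exfalso
    have h01 := hs.not_commute (i := 0) (j := 1) (by decide)
    have h12 := hs.not_commute (i := 1) (j := 2) (by decide)
    rcases (hs.exists_commute_of_rank_four hG hexp).1 with h | h
    exacts [h01 h, h12 h]

end StringC

theorem mainTheorem1 :
    (∀ (m n : ℕ) (G : Type u) [Group G] (s : Fin n → G),
      StringC.IsStringCGroup s → Nat.card G = 2 ^ m →
        (Monoid.exponent G = 2 ^ m → m = 1 ∧ Nonempty (G ≃* StringC.Z2)) ∧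
        (2 ≤ m → Monoid.exponent G = 2 ^ (m - 1) →
          Nonempty (G ≃* DihedralGroup (2 ^ (m - 1)))) ∧
        (3 ≤ m → Monoid.exponent G = 2 ^ (m - 2) →
          ¬ StringC.IsConnectedStringCGroup s ∧
            Nonempty (G ≃* DihedralGroup (2 ^ (m - 2)) × StringC.Z2)) ∧
        (4 ≤ m → Monoid.exponent G = 2 ^ (m - 3) → ¬ StringC.IsConnectedStringCGroup s →
          Nonempty (G ≃* DihedralGroup (2 ^ (m - 3)) × StringC.Z2 × StringC.Z2)) ∧
        (3 ≤ m → Monoid.exponent G = 2 ^ (m - 3) → StringC.IsConnectedStringCGroup s →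
          5 ≤ m ∧
          ∃ e : ℕ, (e = 0 ∨ e = 1 ∧ 6 ≤ m) ∧
            (∃ f : Fin 3 ≃ Fin n, (StrictMono f ∨ StrictAnti f) ∧
              (∃ φ : StringC.Pres m e ≃* G, ∀ i, φ (StringC.presGen m e i) = s (f i)) ∧
              (∃ hq : 2 ^ (m - 3) ≠ 1,
                Infinite (StringC.stringCoxeterMatrix 4 (2 ^ (m - 3)) (by decide) hq).Group ∧
                StringC.IsSmoothQuotient
                  (StringC.stringCoxeterMatrix 4 (2 ^ (m - 3)) (by decide) hq)
                  (fun i => s (f i)))) ∧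
            (e = 0 →
              ∃ ψ : StringC.Z2 →* MulAut (DihedralGroup (2 ^ (m - 4)) × DihedralGroup 2),
                Nonempty (G ≃* (DihedralGroup (2 ^ (m - 4)) × DihedralGroup 2) ⋊[ψ] StringC.Z2)) ∧
            (e = 1 →
              ∃ (χ : DihedralGroup 2 →* MulAut (DihedralGroup (2 ^ (m - 4))))
                (ψ : StringC.Z2 →* MulAut (DihedralGroup (2 ^ (m - 4)) ⋊[χ] DihedralGroup 2)),
                Nonempty (G ≃*
                  (DihedralGroup (2 ^ (m - 4)) ⋊[χ] DihedralGroup 2) ⋊[ψ] StringC.Z2)))) ∧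
    (∀ m e : ℕ, 5 ≤ m → (e = 0 ∨ e = 1 ∧ 6 ≤ m) →
      StringC.IsConnectedStringCGroup (StringC.presGen m e) ∧
        Nat.card (StringC.Pres m e) = 2 ^ m ∧
        Monoid.exponent (StringC.Pres m e) = 2 ^ (m - 3)) := by
  refine ⟨fun m n G _ s hs hG => ⟨hs.exponent_eq_card hG, hs.exponent_eq_card_div_two hG,
    hs.exponent_eq_card_div_four hG, hs.exponent_eq_card_div_eight hG, fun hm hexp hc => ?_⟩,
    fun m e hm he => ⟨StringC.isConnectedStringCGroup_presGen hm he, StringC.natCard_pres hm he,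
      StringC.exponent_pres hm he⟩⟩
  obtain ⟨hm5, e, he, f, hf, ⟨φ, hφ⟩, hq⟩ := hc.classification hG hm hexp
  refine ⟨hm5, e, he, ⟨f, hf, ⟨φ, hφ⟩, hq⟩, ?_, ?_⟩
  · rintro rfl
    obtain ⟨ψ, ⟨χ⟩⟩ := StringC.pres_mulEquiv_prod_semidirectProduct hm5
    exact ⟨ψ, ⟨φ.symm.trans χ⟩⟩
  · rintro -
    obtain ⟨χ, ψ, ⟨ω⟩⟩ := StringC.pres_mulEquiv_semidirectProduct_semidirectProduct hm5 he
    exact ⟨χ, ψ, ⟨φ.symm.trans ω⟩⟩
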